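/- Let $K$ be a complete discretely valued field of characteristic $0$ with valuation ring $\mathcal{R}$, and fix a non-zero non-unit $\pi\in\mathcal{R}$. Let $A$ be a reduced $K$-affinoid algebra and let $\mathcal{A}\subset A$ be an affine formal model, i.e. an $\mathcal{R}$-subalgebra which spans $A$ over $K$ and is an $\mathcal{R}$-torsion-free homomorphic image of some $\mathcal{R}\langle x_1,\dots,x_n\rangle$. Let $\mathcal{L}$ be a smooth $(\mathcal{R},\mathcal{A})$-Lie algebra, i.e. a Lie–Rinehart algebra that is finitely generated and projective as an $\mathcal{A}$-module; extend its action on $\mathcal{A}$ $K$-linearly to $A=K\otimes_{\mathcal{R}}\mathcal{A}$, and write $x\cdot f$ for the action of $x\in\mathcal{L}$ on $f\in A$. For an $(\mathcal{R},\mathcal{A})$-Lie algebra $\mathcal{M}$ let $\widehat{U(\mathcal{M})}$ be the $\pi$-adic completion of its enveloping algebra and $\widehat{U(\mathcal{M})}_K=K\otimes_{\mathcal{R}}\widehat{U(\mathcal{M})}$. All modules are right modules. Let $F=\{f_1,\dots,f_r\}\subset A$ be such that $\{(x\cdot f_1,\dots,x\cdot f_r) : x\in\mathcal{L}\}=\mathcal{A}^r$,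 and let $\mathcal{C}=C_{\mathcal{L}}(F)=\{y\in\mathcal{L} : y\cdot f=0 \text{ for all } f\in F\}$. The elements of $F$ are central in $\widehat{U(\mathcal{C})}_K$; let $(F)$ be the two-sided ideal of $\widehat{U(\mathcal{C})}_K$ which they generate. For a finitely generated $\widehat{U(\mathcal{L})}_K$-module $M$ put $$M[F]=\{m\in M : mf=0 \text{ for all } f\in F\},\qquad M_{\mathrm{Dp}}(F)=\Big\{m\in M : \lim_{n\to\infty} m\,\tfrac{f^n}{n!}=0 \text{ for all } f\in F\Big\},$$ where limits are taken in the canonical topology of $M$, for which the $\widehat{U(\mathcal{L})}$-lattices (finitely generated $\widehat{U(\mathcal{L})}$-submodules that generate $M$ over $K$) form a basis of neighbourhoods of $0$. Then the functors $$N\mapsto N\otimes_{\widehat{U(\mathcal{C})}_K}\widehat{U(\mathcal{L})}_K\qquad\text{and}\qquad M\mapsto M[F]$$ are well-defined, mutually inverse equivalences of categories between the category of finitely generated $\widehat{U(\mathcal{C})}_K/(F)$-modules and the category of finitely generated $\widehat{U(\mathcal{L})}_K$-modules $M$ such that $M=M_{\mathrm{Dp}}(F)$. -/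

import Mathlib

open TensorProduct CategoryTheory MulOpposite

universe u

namespace RigidKashiwara

noncomputable section

/-! ### Tate algebras, affinoid algebras and affine formal models -/

section Affinoid

variable (R K : Type u) [CommRing R] [IsDomain R] [Field K] [Algebra R K] [IsFractionRing R K]

/-- The coefficients of the power series `f` over `K = Frac R` tend to zero (`R` is a discrete
valuation ring): for every nonzero `s ∈ R`, all but finitely many of them lie in `sR`. -/
def CoeffsTendToZero {n : ℕ} (f : MvPowerSeries (Fin n) K) : Prop :=
  ∀ s : R, s ≠ 0 → ∀ᶠ α in Filter.cofinite, ∃ c : R, MvPowerSeries.coeff α f = algebraMap R K (s * c)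

set_option linter.unusedSectionVars false

variable {R K} in
theorem CoeffsTendToZero.add {n : ℕ} {f g : MvPowerSeries (Fin n) K}
    (hf : CoeffsTendToZero R K f) (hg : CoeffsTendToZero R K g) :
    CoeffsTendToZero R K (f + g) := by
  intro s hs
  filter_upwards [hf s hs, hg s hs] with α ⟨c, hc⟩ ⟨d, hd⟩
  exact ⟨c + d, by rw [map_add, hc, hd, mul_add, map_add]⟩

variable {R K} in
theorem CoeffsTendToZero.exists_denominator {n : ℕ} {f : MvPowerSeries (Fin n) K}
    (hf : CoeffsTendToZero R K f) :
    ∃ b : R, b ≠ 0 ∧ ∀ α, ∃ c : R, algebraMap R K b * MvPowerSeries.coeff α f = algebraMap R K c := by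
  classical
  have hfin : {α | ¬ ∃ c : R, MvPowerSeries.coeff α f = algebraMap R K (1 * c)}.Finite :=
    hf 1 one_ne_zero
  obtain ⟨b, hb⟩ := IsLocalization.exist_integer_multiples_of_finset (nonZeroDivisors R)
    (hfin.toFinset.image fun α => MvPowerSeries.coeff α f)
  refine ⟨b, nonZeroDivisors.ne_zero b.2, fun α => ?_⟩
  by_cases h : ∃ c : R, MvPowerSeries.coeff α f = algebraMap R K (1 * c)
  · obtain ⟨c, hc⟩ := h
    exact ⟨b * c, by rw [hc, one_mul, map_mul]⟩
  · obtain ⟨c, hc⟩ := hb (MvPowerSeries.coeff α f)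
      (Finset.mem_image.2 ⟨α, hfin.mem_toFinset.2 h, rfl⟩)
    exact ⟨c, by rw [hc, Algebra.smul_def]⟩

variable {R K} in
theorem CoeffsTendToZero.mul {n : ℕ} {f g : MvPowerSeries (Fin n) K}
    (hf : CoeffsTendToZero R K f) (hg : CoeffsTendToZero R K g) :
    CoeffsTendToZero R K (f * g) := by
  classical
  intro s hs
  obtain ⟨a, ha, hfa⟩ := hf.exists_denominator
  obtain ⟨b, hb, hgb⟩ := hg.exists_denominator
  have inj := IsFractionRing.injective R K
  have ha' : algebraMap R K a ≠ 0 := (map_ne_zero_iff _ inj).2 ha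
  have hb' : algebraMap R K b ≠ 0 := (map_ne_zero_iff _ inj).2 hb
  have hS := hf (s * b) (mul_ne_zero hs hb)
  have hT := hg (s * a) (mul_ne_zero hs ha)
  rw [Filter.eventually_cofinite] at hS hT ⊢
  refine (hS.add hT).subset fun γ hγ => ?_
  by_contra hcon
  apply hγ
  have key : ∀ p ∈ Finset.HasAntidiagonal.antidiagonal γ, ∃ c : R,
      MvPowerSeries.coeff p.1 f * MvPowerSeries.coeff p.2 g = algebraMap R K (s * c) := by
    intro p hp
    by_cases h1 : ∃ c : R, MvPowerSeries.coeff p.1 f = algebraMap R K (s * b * c)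
    · obtain ⟨c, hc⟩ := h1
      obtain ⟨d, hd⟩ := hgb p.2
      refine ⟨c * d, ?_⟩
      rw [hc, map_mul, map_mul, map_mul, map_mul, ← hd]; ring
    · by_cases h2 : ∃ c : R, MvPowerSeries.coeff p.2 g = algebraMap R K (s * a * c)
      · obtain ⟨c, hc⟩ := h2
        obtain ⟨d, hd⟩ := hfa p.1
        refine ⟨c * d, ?_⟩
        rw [hc, map_mul, map_mul, map_mul, map_mul, ← hd]; ring
      · exact absurd (Set.mem_add.2 ⟨p.1, h1, p.2, h2, Finset.HasAntidiagonal.mem_antidiagonal.1 hp⟩) hcon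
  choose! c hc using key
  refine ⟨∑ p ∈ Finset.HasAntidiagonal.antidiagonal γ, c p, ?_⟩
  rw [MvPowerSeries.coeff_mul, Finset.mul_sum, map_sum]
  exact Finset.sum_congr rfl hc

/-- The Tate algebra `K⟨x₁, …, xₙ⟩`. -/
def tateAlgebra (n : ℕ) : Subalgebra K (MvPowerSeries (Fin n) K) where
  carrier := {f | CoeffsTendToZero R K f}
  mul_mem' hf hg := CoeffsTendToZero.mul hf hg
  add_mem' hf hg := CoeffsTendToZero.add hf hg
  algebraMap_mem' r := by
    classical
    intro s hs
    rw [Filter.eventually_cofinite]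
    refine (Set.finite_singleton (0 : Fin n →₀ ℕ)).subset fun α hα => ?_
    by_contra h
    refine hα ⟨0, ?_⟩
    rw [Set.mem_singleton_iff] at h
    rw [MvPowerSeries.algebraMap_apply, MvPowerSeries.coeff_C, if_neg h, mul_zero, map_zero]

/-- `R⟨x₁, …, xₙ⟩`: the series in the Tate algebra all of whose coefficients lie in `R`. -/
def integralTateAlgebra (n : ℕ) : Subalgebra R (MvPowerSeries (Fin n) K) :=
  (tateAlgebra R K n).restrictScalars R ⊓
    (MvPowerSeries.mapAlgHom (σ := Fin n) (Algebra.ofId R K)).range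

/-- A `K`-affinoid algebra: a homomorphic image of a Tate algebra. -/
def IsAffinoidAlgebra (A : Type u) [CommRing A] [Algebra K A] : Prop :=
  ∃ (n : ℕ) (φ : tateAlgebra R K n →ₐ[K] A), Function.Surjective φ

/-- An admissible `R`-algebra: a homomorphic image of some `R⟨x₁, …, xₙ⟩` without `R`-torsion. -/
def IsAdmissibleAlgebra (B : Type u) [CommRing B] [Algebra R B] : Prop :=
  (∃ (n : ℕ) (φ : integralTateAlgebra R K n →ₐ[R] B), Function.Surjective φ) ∧
    ∀ (r : R) (b : B), r ≠ 0 → r • b = 0 → b = 0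

/-- The subalgebra `𝒜` is an affine formal model in the `K`-algebra `A`. -/
class IsAffineFormalModel {A : Type u} [CommRing A] [Algebra K A] [Algebra R A]
    (𝒜 : Subalgebra R A) : Prop where
  admissible : IsAdmissibleAlgebra R K 𝒜
  span_eq_top : Submodule.span K (𝒜 : Set A) = ⊤

variable {A : Type u} [CommRing A] [Algebra K A] [Algebra R A] [IsScalarTower R K A]
  (𝒜 : Subalgebra R A)

/-- The multiplication map `K ⊗ 𝒜 → A`. -/
def modelMap : K ⊗[R] 𝒜 →ₐ[K] A :=
  Algebra.TensorProduct.lift (Algebra.ofId K A) 𝒜.val fun _ _ => Commute.all _ _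

theorem modelMap_tmul (c : K) (a : 𝒜) : modelMap R K 𝒜 (c ⊗ₜ a) = c • (a : A) := by
  simp [modelMap, Algebra.ofId_apply, Algebra.smul_def]

theorem modelMap_bijective [IsAffineFormalModel R K 𝒜] :
    Function.Bijective (modelMap R K 𝒜) := by
  have inj := IsFractionRing.injective R K
  constructor
  · rw [injective_iff_map_eq_zero]
    intro z hz
    obtain ⟨⟨a, s⟩, hs⟩ := IsLocalizedModule.surj (nonZeroDivisors R)
      (TensorProduct.mk R K 𝒜 1) z
    have hs' : (s : R) • z = (1 : K) ⊗ₜ[R] a := hs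
    have h0 : (a : A) = 0 := by
      have h := congrArg (modelMap R K 𝒜) hs'
      rw [modelMap_tmul, one_smul, ← algebraMap_smul K (s : R) z, map_smul, hz, smul_zero] at h
      exact h.symm
    have ha : a = 0 := Subtype.ext h0
    rw [ha, TensorProduct.tmul_zero] at hs'
    have hne : algebraMap R K s ≠ 0 := (map_ne_zero_iff _ inj).2 (nonZeroDivisors.ne_zero s.2)
    rw [← algebraMap_smul K (s : R) z] at hs'
    have h := congrArg (fun w => (algebraMap R K s)⁻¹ • w) hs'
    simp only [smul_smul, inv_mul_cancel₀ hne, one_smul, smul_zero] at h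
    exact h
  · intro a
    have ha : a ∈ Submodule.span K (𝒜 : Set A) :=
      (IsAffineFormalModel.span_eq_top (R := R) (K := K) (𝒜 := 𝒜)) ▸ Submodule.mem_top
    induction ha using Submodule.span_induction with
    | mem x hx => exact ⟨1 ⊗ₜ ⟨x, hx⟩, by rw [modelMap_tmul, one_smul]⟩
    | zero => exact ⟨0, map_zero _⟩
    | add x y _ _ hx hy =>
      obtain ⟨x', rfl⟩ := hx
      obtain ⟨y', rfl⟩ := hy
      exact ⟨x' + y', map_add _ _ _⟩
    | smul c x _ hx =>
      obtain ⟨x', rfl⟩ := hx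
      exact ⟨c • x', map_smul _ _ _⟩

/-- The canonical identification `K ⊗ 𝒜 = A` for an affine formal model `𝒜` in `A`. -/
def modelEquiv [IsAffineFormalModel R K 𝒜] : K ⊗[R] 𝒜 ≃ₐ[K] A :=
  AlgEquiv.ofBijective (modelMap R K 𝒜) (modelMap_bijective R K 𝒜)

theorem modelEquiv_tmul [IsAffineFormalModel R K 𝒜] (c : K) (a : 𝒜) :
    modelEquiv R K 𝒜 (c ⊗ₜ a) = c • (a : A) :=
  modelMap_tmul R K 𝒜 c a

end Affinoid

/-! ### Lie–Rinehart algebras: action on `A`, centralisers, enveloping algebras -/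

section Action

variable (R K : Type u) [CommRing R] [IsDomain R] [Field K] [Algebra R K] [IsFractionRing R K]
  {A : Type u} [CommRing A] [Algebra K A] [Algebra R A] [IsScalarTower R K A]
  (𝒜 : Subalgebra R A) [IsAffineFormalModel R K 𝒜]
  {L : Type u} [LieRing L] [LieAlgebra R L] [Module 𝒜 L] [LieRingModule L 𝒜]
  [LieRinehartRing 𝒜 L] [LieRinehartAlgebra R 𝒜 L]

/-- The action `f ↦ x · f` of `x ∈ L` on `A = K ⊗ 𝒜`: the `K`-linear extension of the derivation
`a ↦ ⁅x, a⁆` of `𝒜` given by the anchor map. -/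
def act (x : L) : A →ₗ[K] A :=
  (modelEquiv R K 𝒜).toLinearMap ∘ₗ
    (LieModule.toEnd R L 𝒜 x).baseChange K ∘ₗ (modelEquiv R K 𝒜).symm.toLinearMap

theorem act_modelEquiv (x : L) (c : K) (a : 𝒜) :
    act R K 𝒜 x (modelEquiv R K 𝒜 (c ⊗ₜ a)) = modelEquiv R K 𝒜 (c ⊗ₜ ⁅x, a⁆) := by
  simp [act]

theorem exists_eq_modelEquiv_tmul (f : A) :
    ∃ (s : R) (a : 𝒜), s ≠ 0 ∧ f = modelEquiv R K 𝒜 ((algebraMap R K s)⁻¹ ⊗ₜ a) := by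
  have inj := IsFractionRing.injective R K
  obtain ⟨z, rfl⟩ := (modelEquiv R K 𝒜).surjective f
  obtain ⟨⟨a, s⟩, hs⟩ := IsLocalizedModule.surj (nonZeroDivisors R)
    (TensorProduct.mk R K 𝒜 1) z
  have hs' : (s : R) • z = (1 : K) ⊗ₜ[R] a := hs
  have hne : algebraMap R K s ≠ 0 := (map_ne_zero_iff _ inj).2 (nonZeroDivisors.ne_zero s.2)
  refine ⟨s, a, nonZeroDivisors.ne_zero s.2, congrArg _ ?_⟩
  rw [← algebraMap_smul K (s : R) z] at hs'
  have h := congrArg (fun w => (algebraMap R K s)⁻¹ • w) hs'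
  simp only [smul_smul, inv_mul_cancel₀ hne, one_smul, TensorProduct.smul_tmul', smul_eq_mul,
    mul_one] at h
  exact h

/-- The centraliser `C_L(F) = {y ∈ L | y · f = 0 for all f ∈ F}`. -/
def centraliser (F : Set A) : LieRinehartSubalgebra 𝒜 L where
  carrier := {y | ∀ f ∈ F, act R K 𝒜 y f = 0}
  zero_mem' := fun f _ => by
    obtain ⟨s, a, -, rfl⟩ := exists_eq_modelEquiv_tmul R K 𝒜 f
    rw [act_modelEquiv, zero_lie, tmul_zero, map_zero]
  add_mem' := fun {x y} hx hy f hf => by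
    have h1 := hx f hf
    have h2 := hy f hf
    obtain ⟨s, a, -, rfl⟩ := exists_eq_modelEquiv_tmul R K 𝒜 f
    rw [act_modelEquiv] at h1 h2 ⊢
    rw [add_lie, tmul_add, map_add, h1, h2, add_zero]
  smul_mem' := fun b {x} hx f hf => by
    have h1 := hx f hf
    obtain ⟨s, a, -, rfl⟩ := exists_eq_modelEquiv_tmul R K 𝒜 f
    rw [act_modelEquiv, modelEquiv_tmul] at h1 ⊢
    rw [LieRinehartRing.lie_smul_eq_mul, Subalgebra.coe_mul, ← mul_smul_comm, h1, mul_zero]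
  lie_mem' := fun {x y} hx hy f hf => by
    have h1 := hx f hf
    have h2 := hy f hf
    obtain ⟨s, a, -, rfl⟩ := exists_eq_modelEquiv_tmul R K 𝒜 f
    have key : ∀ (z : L) (w : L), act R K 𝒜 w (modelEquiv R K 𝒜 ((algebraMap R K s)⁻¹ ⊗ₜ a)) = 0 →
        modelEquiv R K 𝒜 ((algebraMap R K s)⁻¹ ⊗ₜ ⁅z, ⁅w, a⁆⁆) = 0 := by
      intro z w hw
      rw [act_modelEquiv] at hw
      rw [← act_modelEquiv, hw, map_zero]
    rw [act_modelEquiv, lie_lie, tmul_sub, map_sub, key x y h2, key y x h1, sub_zero]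

theorem mem_centraliser {F : Set A} {y : L} :
    y ∈ centraliser R K 𝒜 F ↔ ∀ f ∈ F, act R K 𝒜 y f = 0 :=
  Iff.rfl

end Action

section Enveloping

variable (R A L : Type u) [CommRing R] [CommRing A] [Algebra R A] [LieRing L] [LieAlgebra R L]
  [Module A L] [LieRingModule L A]

/-- The defining relations of the enveloping algebra, on the tensor algebra of `A × L`. -/
inductive EnvelopingRel : TensorAlgebra R (A × L) → TensorAlgebra R (A × L) → Prop
  | one : EnvelopingRel (TensorAlgebra.ι R (1, 0)) 1
  | mul (a b : A) : EnvelopingRel (TensorAlgebra.ι R (a * b, 0))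
      (TensorAlgebra.ι R (a, 0) * TensorAlgebra.ι R (b, 0))
  | smul (a : A) (x : L) : EnvelopingRel (TensorAlgebra.ι R (0, a • x))
      (TensorAlgebra.ι R (a, 0) * TensorAlgebra.ι R (0, x))
  | lie (x y : L) : EnvelopingRel (TensorAlgebra.ι R (0, ⁅x, y⁆))
      (TensorAlgebra.ι R (0, x) * TensorAlgebra.ι R (0, y)
        - TensorAlgebra.ι R (0, y) * TensorAlgebra.ι R (0, x))
  | anchor (x : L) (a : A) : EnvelopingRel (TensorAlgebra.ι R (⁅x, a⁆, 0))
      (TensorAlgebra.ι R (0, x) * TensorAlgebra.ι R (a, 0)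
        - TensorAlgebra.ι R (a, 0) * TensorAlgebra.ι R (0, x))

/-- The enveloping algebra `U(L)` of the `(R, A)`-Lie algebra `L`: the `R`-algebra generated by
`A` and `L`, subject to the relations that `A → U(L)` is a ring homomorphism, `L → U(L)` is
`A`-linear and a Lie homomorphism, and `[x, a] = ρ(x)(a)`. -/
def Enveloping : Type u := RingQuot (EnvelopingRel R A L)

instance : Ring (Enveloping R A L) := inferInstanceAs (Ring (RingQuot (EnvelopingRel R A L)))

instance : Algebra R (Enveloping R A L) :=
  inferInstanceAs (Algebra R (RingQuot (EnvelopingRel R A L)))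

namespace Enveloping

def mk : TensorAlgebra R (A × L) →ₐ[R] Enveloping R A L :=
  RingQuot.mkAlgHom R (EnvelopingRel R A L)

variable {R A L} in
theorem mk_rel {s t : TensorAlgebra R (A × L)} (h : EnvelopingRel R A L s t) :
    mk R A L s = mk R A L t :=
  RingQuot.mkAlgHom_rel R h

theorem mk_surjective : Function.Surjective (mk R A L) :=
  RingQuot.mkAlgHom_surjective R _

/-- The canonical map `A → U(L)`. -/
def ιA : A →ₐ[R] Enveloping R A L :=
  AlgHom.ofLinearMap ((mk R A L).toLinearMap ∘ₗ TensorAlgebra.ι R ∘ₗ LinearMap.inl R A L)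
    (by simpa using mk_rel (EnvelopingRel.one (R := R) (A := A) (L := L)))
    (fun a b => by simpa using mk_rel (EnvelopingRel.mul (R := R) (L := L) a b))

theorem ιA_apply (a : A) : ιA R A L a = mk R A L (TensorAlgebra.ι R (a, 0)) := rfl

/-- The canonical map `L → U(L)`. -/
def ιL : L →ₗ[R] Enveloping R A L :=
  (mk R A L).toLinearMap ∘ₗ TensorAlgebra.ι R ∘ₗ LinearMap.inr R A L

theorem ιL_apply (x : L) : ιL R A L x = mk R A L (TensorAlgebra.ι R (0, x)) := rfl

variable {L} {L' : Type u} [LieRing L'] [LieAlgebra R L'] [Module A L'] [LieRingModule L' A]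

/-- The map `U(L') → U(L)` induced by a homomorphism `L' → L` over `A`. -/
def map (g : LieRinehartAlgebra.Hom (AlgHom.id R A) L' L) :
    Enveloping R A L' →ₐ[R] Enveloping R A L :=
  RingQuot.liftAlgHom R ⟨(mk R A L).comp (TensorAlgebra.lift R
      (TensorAlgebra.ι R ∘ₗ LinearMap.prodMap LinearMap.id (g.toLieHom : L' →ₗ[R] L))), by
    intro s t h
    cases h with
    | one => simpa using mk_rel (EnvelopingRel.one (R := R) (A := A) (L := L))
    | mul a b => simpa using mk_rel (EnvelopingRel.mul (R := R) (L := L) a b)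
    | smul a x =>
      have h := g.map_smul_apply a x
      simpa [h] using mk_rel (EnvelopingRel.smul (R := R) a (g x))
    | lie x y => simpa using mk_rel (EnvelopingRel.lie (R := R) (A := A) (g x) (g y))
    | anchor x a =>
      have h : ⁅x, a⁆ = ⁅g x, a⁆ := g.apply_lie a x
      simpa [h] using mk_rel (EnvelopingRel.anchor (R := R) (g x) a)⟩

theorem map_mk_ι (g : LieRinehartAlgebra.Hom (AlgHom.id R A) L' L) (a : A) (x : L') :
    map R A g (mk R A L' (TensorAlgebra.ι R (a, x))) = mk R A L (TensorAlgebra.ι R (a, g x)) := by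
  change RingQuot.liftAlgHom R _ (RingQuot.mkAlgHom R _ _) = _
  rw [RingQuot.liftAlgHom_mkAlgHom_apply]
  simp

theorem map_ιA (g : LieRinehartAlgebra.Hom (AlgHom.id R A) L' L) (a : A) :
    map R A g (ιA R A L' a) = ιA R A L a := by
  have : g (0 : L') = 0 := map_zero g.toLieHom
  rw [ιA_apply, map_mk_ι, this, ιA_apply]

/-- An element of `A` killed by `L` is central in `U(L)`. -/
theorem ιA_central {a : A} (ha : ∀ x : L, ⁅x, a⁆ = 0) (z : Enveloping R A L) :
    Commute (ιA R A L a) z := by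
  obtain ⟨t, rfl⟩ := mk_surjective R A L z
  induction t using TensorAlgebra.induction with
  | algebraMap r => rw [AlgHom.commutes]; exact Algebra.commute_algebraMap_right r _
  | ι w =>
    obtain ⟨b, x⟩ := w
    have h : ((b, x) : A × L) = (b, 0) + (0, x) := by simp
    rw [h, map_add, map_add]
    refine Commute.add_right ?_ ?_
    · exact (Commute.all a b).map (ιA R A L)
    · have h2 := mk_rel (EnvelopingRel.anchor (R := R) x a)
      rw [ha x] at h2
      have h0 : ((0, 0) : A × L) = 0 := rfl
      rw [h0, map_zero, map_zero, map_sub, map_mul, map_mul] at h2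
      exact (sub_eq_zero.1 h2.symm).symm
  | mul s t hs ht => rw [map_mul]; exact hs.mul_right ht
  | add s t hs ht => rw [map_add]; exact hs.add_right ht

end Enveloping

end Enveloping

/-! ### `π`-adic completion of a not necessarily commutative algebra -/

section Completion

variable {R : Type u} [CommRing R] (π : R) (B : Type u) [Ring B] [Algebra R B]

/-- The two-sided ideal `πⁿB`. -/
def powIdeal (n : ℕ) : Ideal B := Ideal.span {algebraMap R B (π ^ n)}

variable {B} in
theorem mem_powIdeal {n : ℕ} {b : B} :
    b ∈ powIdeal π B n ↔ ∃ c : B, c * algebraMap R B (π ^ n) = b :=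
  Ideal.mem_span_singleton'

instance (n : ℕ) : (powIdeal π B n).IsTwoSided where
  mul_mem_of_left {a} b ha := by
    obtain ⟨c, rfl⟩ := (mem_powIdeal π).1 ha
    exact (mem_powIdeal π).2 ⟨c * b, by rw [mul_assoc, mul_assoc, Algebra.commutes]⟩

theorem powIdeal_anti {m n : ℕ} (h : m ≤ n) : powIdeal π B n ≤ powIdeal π B m := by
  intro b hb
  obtain ⟨c, rfl⟩ := (mem_powIdeal π).1 hb
  refine (mem_powIdeal π).2 ⟨c * algebraMap R B (π ^ (n - m)), ?_⟩
  rw [mul_assoc, ← map_mul, ← pow_add, Nat.sub_add_cancel h]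

/-- The `π`-adic completion `lim B / πⁿB`. -/
def Completion : Subalgebra R (∀ n : ℕ, B ⧸ powIdeal π B n) where
  carrier := {x | ∀ (m n : ℕ) (h : m ≤ n), Ideal.Quotient.factor (powIdeal_anti π B h) (x n) = x m}
  mul_mem' := fun {x y} hx hy m n h => by
    simp only [Pi.mul_apply, map_mul, hx m n h, hy m n h]
  add_mem' := fun {x y} hx hy m n h => by
    simp only [Pi.add_apply, map_add, hx m n h, hy m n h]
  algebraMap_mem' := fun _ _ _ _ => rfl

/-- The canonical map from `B` to its completion. -/
def toCompletion : B →ₐ[R] Completion π B :=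
  AlgHom.codRestrict (AlgHom.pi fun n => Ideal.Quotient.mkₐ R (powIdeal π B n)) _
    fun _ _ _ _ => rfl

theorem toCompletion_val (b : B) (n : ℕ) :
    (toCompletion π B b).1 n = Ideal.Quotient.mk (powIdeal π B n) b := rfl

theorem toCompletion_central {b : B} (hb : ∀ c : B, Commute b c) (z : Completion π B) :
    Commute (toCompletion π B b) z := by
  refine Subtype.ext (funext fun n => ?_)
  obtain ⟨c, hc⟩ := Ideal.Quotient.mk_surjective (z.1 n)
  change Ideal.Quotient.mk (powIdeal π B n) b * z.1 n = z.1 n * Ideal.Quotient.mk (powIdeal π B n) b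
  rw [← hc, ← map_mul, ← map_mul, (hb c).eq]

variable {B} {B' : Type u} [Ring B'] [Algebra R B']

theorem powIdeal_le_comap (g : B →ₐ[R] B') (n : ℕ) :
    powIdeal π B n ≤ (powIdeal π B' n).comap (g : B →+* B') := by
  intro b hb
  obtain ⟨c, rfl⟩ := (mem_powIdeal π).1 hb
  exact (mem_powIdeal π).2 ⟨g c, by simp⟩

/-- Functoriality of the completion. -/
def completionMap (g : B →ₐ[R] B') : Completion π B →ₐ[R] Completion π B' where
  toFun z := ⟨fun n => Ideal.quotientMap _ (g : B →+* B') (powIdeal_le_comap π g n) (z.1 n), by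
    intro m n h
    obtain ⟨b, hb⟩ := Ideal.Quotient.mk_surjective (z.1 n)
    have hm := z.2 m n h
    dsimp only
    rw [← hm, ← hb]; rfl⟩
  map_one' := Subtype.ext (funext fun n => map_one (Ideal.quotientMap _ _ _))
  map_mul' x y := Subtype.ext (funext fun n => map_mul (Ideal.quotientMap _ _ _) _ _)
  map_zero' := Subtype.ext (funext fun n => map_zero (Ideal.quotientMap _ _ _))
  map_add' x y := Subtype.ext (funext fun n => map_add (Ideal.quotientMap _ _ _) _ _)
  commutes' r := Subtype.ext (funext fun n =>
    congrArg (Ideal.Quotient.mk (powIdeal π B' n)) (g.commutes r))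

theorem completionMap_toCompletion (g : B →ₐ[R] B') (b : B) :
    completionMap π g (toCompletion π B b) = toCompletion π B' (g b) := rfl

end Completion

/-! ### The algebras `Û(L)` and `Û(L)_K = K ⊗ Û(L)` -/

section CompletedEnveloping

variable {R : Type u} (K : Type u) [CommRing R] [IsDomain R] [Field K] [Algebra R K]
  [IsFractionRing R K] (π : R)
  {A : Type u} [CommRing A] [Algebra K A] [Algebra R A] [IsScalarTower R K A]
  (𝒜 : Subalgebra R A)
  (L : Type u) [LieRing L] [LieAlgebra R L] [Module 𝒜 L] [LieRingModule L 𝒜]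

/-- `Û(L)`, the `π`-adic completion of the enveloping algebra. -/
abbrev UHat : Type u := Completion π (Enveloping R 𝒜 L)

/-- `Û(L)_K = K ⊗ Û(L)`. -/
abbrev UHatK : Type u := K ⊗[R] UHat π 𝒜 L

/-- The canonical map `A = K ⊗ 𝒜 → Û(L)_K`. -/
def functionMap [IsAffineFormalModel R K 𝒜] : A →ₐ[K] UHatK K π 𝒜 L :=
  (Algebra.TensorProduct.map (AlgHom.id K K)
    ((toCompletion π (Enveloping R 𝒜 L)).comp (Enveloping.ιA R 𝒜 L))).comp
    (modelEquiv R K 𝒜).symm.toAlgHom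

theorem functionMap_modelEquiv [IsAffineFormalModel R K 𝒜] (c : K) (a : 𝒜) :
    functionMap K π 𝒜 L (modelEquiv R K 𝒜 (c ⊗ₜ a)) =
      c ⊗ₜ toCompletion π _ (Enveloping.ιA R 𝒜 L a) := by
  simp [functionMap]

variable {L} {L' : Type u} [LieRing L'] [LieAlgebra R L'] [Module 𝒜 L'] [LieRingModule L' 𝒜]

/-- The map `Û(L')_K → Û(L)_K` induced by a homomorphism `L' → L` over `𝒜`. -/
def UHatK.map (g : LieRinehartAlgebra.Hom (AlgHom.id R 𝒜) L' L) :
    UHatK K π 𝒜 L' →ₐ[K] UHatK K π 𝒜 L :=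
  Algebra.TensorProduct.map (AlgHom.id K K) (completionMap π (Enveloping.map R 𝒜 g))

theorem UHatK.map_functionMap [IsAffineFormalModel R K 𝒜]
    (g : LieRinehartAlgebra.Hom (AlgHom.id R 𝒜) L' L) (f : A) :
    UHatK.map K π 𝒜 g (functionMap K π 𝒜 L' f) = functionMap K π 𝒜 L f := by
  obtain ⟨s, a, -, rfl⟩ := exists_eq_modelEquiv_tmul R K 𝒜 f
  rw [functionMap_modelEquiv, functionMap_modelEquiv, UHatK.map, Algebra.TensorProduct.map_tmul,
    completionMap_toCompletion, Enveloping.map_ιA, AlgHom.id_apply]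

variable [LieRinehartRing 𝒜 L] [LieRinehartAlgebra R 𝒜 L]

/-- The elements of `F` are central in `Û(C_L(F))_K`. -/
theorem functionMap_central [IsAffineFormalModel R K 𝒜] {F : Set A} {f : A} (hf : f ∈ F)
    (v : UHatK K π 𝒜 (centraliser R K 𝒜 F : LieRinehartSubalgebra 𝒜 L)) :
    Commute (functionMap K π 𝒜 (centraliser R K 𝒜 F : LieRinehartSubalgebra 𝒜 L) f) v := by
  obtain ⟨s, a, hs, rfl⟩ := exists_eq_modelEquiv_tmul R K 𝒜 f
  have inj := IsFractionRing.injective R K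
  have hne : algebraMap R K s ≠ 0 := (map_ne_zero_iff _ inj).2 hs
  have ha : ∀ x : (centraliser R K 𝒜 F : LieRinehartSubalgebra 𝒜 L), ⁅x, a⁆ = 0 := by
    intro x
    have h := x.2 _ hf
    rw [act_modelEquiv, modelEquiv_tmul, smul_eq_zero_iff_right (inv_ne_zero hne)] at h
    exact Subtype.ext h
  rw [functionMap_modelEquiv]
  induction v using TensorProduct.induction_on with
  | zero => exact Commute.zero_right _
  | tmul c z =>
    have h := toCompletion_central π _ (Enveloping.ιA_central R 𝒜 ha) z
    rw [Commute, SemiconjBy, Algebra.TensorProduct.tmul_mul_tmul,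
      Algebra.TensorProduct.tmul_mul_tmul, mul_comm, h.eq]
  | add x y hx hy => exact hx.add_right hy

end CompletedEnveloping

/-! ### Right modules, induction and invariants

Right modules over a ring `V` are modules over `Vᵐᵒᵖ`; `m * v` is written `op v • m`. -/

section RightModules

variable {V U : Type u} [Ring V] [Ring U] (φ : V →+* U)

/-- The relations `u ⊗ n v = v u ⊗ n`. -/
def tensorRelations (N : Type u) [AddCommGroup N] [Module Vᵐᵒᵖ N] :
    Submodule Uᵐᵒᵖ (U ⊗[ℤ] N) :=
  Submodule.span Uᵐᵒᵖ {t | ∃ (u : U) (v : V) (n : N),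
    t = (φ v * u) ⊗ₜ[ℤ] n - u ⊗ₜ[ℤ] (op v • n)}

/-- The right `U`-module `N ⊗_V U`, for a right `V`-module `N` and a ring homomorphism `V → U`; the
class of `u ⊗ₜ n` stands for `n ⊗ u`, and `U` acts by right multiplication on `u`. -/
abbrev Induced (N : Type u) [AddCommGroup N] [Module Vᵐᵒᵖ N] : Type u :=
  (U ⊗[ℤ] N) ⧸ tensorRelations φ N

/-- `g ⊗ U : N ⊗_V U → N' ⊗_V U`. -/
def Induced.map {N N' : Type u} [AddCommGroup N] [Module Vᵐᵒᵖ N] [AddCommGroup N']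
    [Module Vᵐᵒᵖ N'] (g : N →ₗ[Vᵐᵒᵖ] N') : Induced φ N →ₗ[Uᵐᵒᵖ] Induced φ N' :=
  Submodule.mapQ _ _
    (TensorProduct.AlgebraTensorModule.map (LinearMap.id (R := Uᵐᵒᵖ) (M := U))
      g.toAddMonoidHom.toIntLinearMap) (by
    rw [tensorRelations, Submodule.span_le]
    rintro _ ⟨u, v, n, rfl⟩
    refine Submodule.subset_span ⟨u, v, g n, ?_⟩
    simp)

theorem Induced.hom_ext {N : Type u} [AddCommGroup N] [Module Vᵐᵒᵖ N] {P : Type u}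
    [AddCommGroup P] [Module Uᵐᵒᵖ P] {g h : Induced φ N →ₗ[Uᵐᵒᵖ] P}
    (H : ∀ (u : U) (n : N), g (Submodule.Quotient.mk (u ⊗ₜ n)) = h (Submodule.Quotient.mk (u ⊗ₜ n))) :
    g = h := by
  refine LinearMap.ext fun z => ?_
  obtain ⟨t, rfl⟩ := Submodule.Quotient.mk_surjective _ z
  induction t using TensorProduct.induction_on with
  | zero => rw [Submodule.Quotient.mk_zero, map_zero, map_zero]
  | tmul u n => exact H u n
  | add x y hx hy => rw [Submodule.Quotient.mk_add, map_add, map_add, hx, hy]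

/-- The functor `N ↦ N ⊗_V U` from right `V`-modules to right `U`-modules. -/
def inductionFunctor : ModuleCat.{u} Vᵐᵒᵖ ⥤ ModuleCat.{u} Uᵐᵒᵖ where
  obj N := ModuleCat.of Uᵐᵒᵖ (Induced φ N)
  map g := ModuleCat.ofHom (Induced.map φ g.hom)
  map_id _ := ModuleCat.hom_ext (Induced.hom_ext φ fun _ _ => rfl)
  map_comp _ _ := ModuleCat.hom_ext (Induced.hom_ext φ fun _ _ => rfl)

/-- The quotient of `V` by the two-sided ideal generated by `s`. -/
abbrev QuotientBy (s : Set V) : Type u := (TwoSidedIdeal.span s).ringCon.Quotient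

/-- `M[t] = {m ∈ M | m z = 0 for all z ∈ t}`. -/
def killedBy (t : Set U) (M : Type u) [AddCommGroup M] [Module Uᵐᵒᵖ M] : AddSubgroup M where
  carrier := {m | ∀ z ∈ t, op z • m = 0}
  zero_mem' _ _ := smul_zero _
  add_mem' hx hy z hz := by rw [smul_add, hx z hz, hy z hz, add_zero]
  neg_mem' hx z hz := by rw [smul_neg, hx z hz, neg_zero]

variable {φ} {s : Set V} {t : Set U}

/-- The action of `V` on `M[φ(s)]`, for `s` central in `V`. -/
def killedByAction (hs : ∀ z ∈ s, ∀ v : V, Commute z v) (hst : φ '' s = t)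
    (M : Type u) [AddCommGroup M] [Module Uᵐᵒᵖ M] :
    V →+* (AddMonoid.End (killedBy t M))ᵐᵒᵖ where
  toFun v := op
    { toFun := fun m => ⟨op (φ v) • m.1, by
        intro z hz
        obtain ⟨w, hw, rfl⟩ := hst ▸ hz
        rw [smul_smul, ← op_mul, ← map_mul, ← (hs w hw v).eq, map_mul, op_mul, mul_smul,
          m.2 _ hz, smul_zero]⟩
      map_zero' := Subtype.ext (smul_zero _)
      map_add' := fun _ _ => Subtype.ext (smul_add _ _ _) }
  map_one' := unop_injective (AddMonoidHom.ext fun m => Subtype.ext (by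
    change op (φ 1) • m.1 = m.1
    rw [map_one, op_one, one_smul]))
  map_mul' v w := unop_injective (AddMonoidHom.ext fun m => Subtype.ext (by
    change op (φ (v * w)) • m.1 = op (φ w) • op (φ v) • m.1
    rw [map_mul, op_mul, mul_smul]))
  map_zero' := unop_injective (AddMonoidHom.ext fun m => Subtype.ext (by
    change op (φ 0) • m.1 = 0
    rw [map_zero, op_zero, zero_smul]))
  map_add' v w := unop_injective (AddMonoidHom.ext fun m => Subtype.ext (by
    change op (φ (v + w)) • m.1 = op (φ v) • m.1 + op (φ w) • m.1
    rw [map_add, MulOpposite.op_add, add_smul]))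

theorem killedByAction_le_ker (hs : ∀ z ∈ s, ∀ v : V, Commute z v) (hst : φ '' s = t)
    (M : Type u) [AddCommGroup M] [Module Uᵐᵒᵖ M] :
    (TwoSidedIdeal.span s).ringCon ≤ RingCon.ker (killedByAction hs hst M) := by
  have h : TwoSidedIdeal.span s ≤ TwoSidedIdeal.ker (killedByAction hs hst M) := by
    rw [TwoSidedIdeal.span_le]
    intro z hz
    rw [SetLike.mem_coe, TwoSidedIdeal.mem_ker]
    exact unop_injective (AddMonoidHom.ext fun m =>
      Subtype.ext (m.2 _ (hst ▸ Set.mem_image_of_mem φ hz)))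
  intro x y hxy
  have h1 := h ((TwoSidedIdeal.rel_iff _ x y).1 hxy)
  rw [TwoSidedIdeal.mem_ker, map_sub, sub_eq_zero] at h1
  exact h1

/-- The right `V/(s)`-module structure on `M[φ(s)]`, for `s` central in `V`: the class of `v ∈ V`
sends `m` to `m φ(v)`. -/
@[reducible] def killedByModule (hs : ∀ z ∈ s, ∀ v : V, Commute z v) (hst : φ '' s = t)
    (M : Type u) [AddCommGroup M] [Module Uᵐᵒᵖ M] :
    Module (QuotientBy s)ᵐᵒᵖ (killedBy t M) :=
  Module.compHom (killedBy t M) ((RingEquiv.opOp (AddMonoid.End (killedBy t M))).symm.toRingHom.comp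
    (RingHom.op (RingCon.lift _ (killedByAction hs hst M) (killedByAction_le_ker hs hst M))))

theorem killedByModule_smul (hs : ∀ z ∈ s, ∀ v : V, Commute z v) (hst : φ '' s = t)
    (M : Type u) [AddCommGroup M] [Module Uᵐᵒᵖ M] (v : V) (m : killedBy t M) :
    letI := killedByModule hs hst M
    ((op ((TwoSidedIdeal.span s).ringCon.mk' v) • m : killedBy t M) : M) = op (φ v) • (m : M) :=
  rfl

/-- The functor `M ↦ M[t]` from right `U`-modules to right `V/(s)`-modules, where `s` is central in
`V` and `t = φ(s)`. -/
def killedByFunctor (hs : ∀ z ∈ s, ∀ v : V, Commute z v) (hst : φ '' s = t) :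
    ModuleCat.{u} Uᵐᵒᵖ ⥤ ModuleCat.{u} (QuotientBy s)ᵐᵒᵖ where
  obj M :=
    letI := killedByModule hs hst M
    ModuleCat.of (QuotientBy s)ᵐᵒᵖ (killedBy t M)
  map {M M'} g :=
    letI := killedByModule hs hst M
    letI := killedByModule hs hst M'
    ModuleCat.ofHom
      { toFun := fun m => ⟨g.hom m.1, fun z hz => by rw [← map_smul, m.2 z hz, map_zero]⟩
        map_add' := fun m m' => Subtype.ext (map_add g.hom _ _)
        map_smul' := fun q m => by
          obtain ⟨v, hv⟩ := RingCon.mk'_surjective _ q.unop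
          obtain rfl : q = op ((TwoSidedIdeal.span s).ringCon.mk' v) := unop_injective hv.symm
          exact Subtype.ext (map_smul g.hom (op (φ v)) m.1) }
  map_id _ := rfl
  map_comp _ _ := rfl

/-- The functor `N ↦ N ⊗_V U` from right `V/(s)`-modules to right `U`-modules. -/
def quotientInductionFunctor (φ : V →+* U) (s : Set V) :
    ModuleCat.{u} (QuotientBy s)ᵐᵒᵖ ⥤ ModuleCat.{u} Uᵐᵒᵖ :=
  ModuleCat.restrictScalars (RingHom.op (TwoSidedIdeal.span s).ringCon.mk') ⋙ inductionFunctor φ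

/-- The finitely generated right modules over a ring. -/
def finitelyGenerated (V : Type u) [Ring V] : ObjectProperty (ModuleCat.{u} Vᵐᵒᵖ) :=
  fun N => Module.Finite Vᵐᵒᵖ N

end RightModules

/-! ### Lattices, divided powers and the two functors -/

section Kashiwara

variable {R : Type u} (K : Type u) [CommRing R] [IsDomain R] [Field K] [Algebra R K]
  [IsFractionRing R K] (π : R)
  {A : Type u} [CommRing A] [Algebra K A] [Algebra R A] [IsScalarTower R K A]
  (𝒜 : Subalgebra R A)
  (L : Type u) [LieRing L] [LieAlgebra R L] [Module 𝒜 L] [LieRingModule L 𝒜]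

/-- `Λ` is a `Û(L)`-lattice in the right `Û(L)_K`-module `M`: a finitely generated
`Û(L)`-submodule of `M` which generates `M` as a `K`-vector space. -/
structure IsLattice {M : Type u} [AddCommGroup M] [Module (UHatK K π 𝒜 L)ᵐᵒᵖ M]
    (Λ : AddSubgroup M) : Prop where
  fg : ∃ S : Finset M, Λ = AddSubgroup.closure
    {m | ∃ x ∈ S, ∃ u : UHat π 𝒜 L, m = op ((1 : K) ⊗ₜ[R] u : UHatK K π 𝒜 L) • x}
  span : AddSubgroup.closure
    {m | ∃ c : K, ∃ x ∈ Λ, m = op (algebraMap K (UHatK K π 𝒜 L) c) • x} = ⊤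

/-- The sequence `x` tends to zero in the canonical topology of the finitely generated right
`Û(L)_K`-module `M`. Multiples `πᵏΛ` of lattices are lattices, any two lattices are commensurable,
and the lattices form a basis of neighbourhoods of zero for the canonical (Banach) topology. -/
def TendsToZero {M : Type u} [AddCommGroup M] [Module (UHatK K π 𝒜 L)ᵐᵒᵖ M] (x : ℕ → M) : Prop :=
  ∀ Λ : AddSubgroup M, IsLattice K π 𝒜 L Λ → ∀ᶠ n in Filter.atTop, x n ∈ Λ

variable [IsAffineFormalModel R K 𝒜]

/-- `M_Dp(F) = {m ∈ M | m fⁿ/n! → 0 for all f ∈ F}`. -/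
def dividedPowerPart (F : Set A) (M : Type u) [AddCommGroup M]
    [Module (UHatK K π 𝒜 L)ᵐᵒᵖ M] : Set M :=
  {m | ∀ f ∈ F, TendsToZero K π 𝒜 L fun n : ℕ =>
    op (functionMap K π 𝒜 L ((n.factorial : K)⁻¹ • f ^ n)) • m}

/-- The finitely generated right `Û(L)_K`-modules `M` such that `M = M_Dp(F)`. -/
def finitelyGeneratedDp (F : Set A) : ObjectProperty (ModuleCat.{u} (UHatK K π 𝒜 L)ᵐᵒᵖ) :=
  fun M => finitelyGenerated (UHatK K π 𝒜 L) M ∧ dividedPowerPart K π 𝒜 L F M = Set.univ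

variable [LieRinehartRing 𝒜 L] [LieRinehartAlgebra R 𝒜 L] (F : Set A)

/-- `Û(C)_K`, where `C = C_L(F)`. -/
abbrev CentHatK : Type u := UHatK K π 𝒜 (centraliser R K 𝒜 F : LieRinehartSubalgebra 𝒜 L)

/-- The map `Û(C)_K → Û(L)_K` induced by the inclusion of `C = C_L(F)` in `L`. -/
def centInclusion : CentHatK K π 𝒜 L F →+* UHatK K π 𝒜 L :=
  (UHatK.map K π 𝒜 ((centraliser R K 𝒜 F : LieRinehartSubalgebra 𝒜 L).incl R)).toRingHom

/-- The image of `F` in `Û(C)_K`. -/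
def centImage : Set (CentHatK K π 𝒜 L F) := functionMap K π 𝒜 _ '' F

theorem centInclusion_image :
    centInclusion K π 𝒜 L F '' centImage K π 𝒜 L F = functionMap K π 𝒜 L '' F := by
  rw [centImage, Set.image_image]
  exact Set.image_congr fun f _ => UHatK.map_functionMap K π 𝒜 _ f

theorem centImage_central :
    ∀ z ∈ centImage K π 𝒜 L F, ∀ v : CentHatK K π 𝒜 L F, Commute z v := by
  rintro _ ⟨f, hf, rfl⟩ v
  exact functionMap_central K π 𝒜 hf v

/-- `Û(C)_K/(F)`, where `C = C_L(F)`. -/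
abbrev CentHatKMod : Type u := QuotientBy (centImage K π 𝒜 L F)

/-- `N ↦ N ⊗_{Û(C)_K} Û(L)_K`, from right `Û(C)_K/(F)`-modules to right `Û(L)_K`-modules. -/
def pushforward : ModuleCat.{u} (CentHatKMod K π 𝒜 L F)ᵐᵒᵖ ⥤ ModuleCat.{u} (UHatK K π 𝒜 L)ᵐᵒᵖ :=
  quotientInductionFunctor (centInclusion K π 𝒜 L F) (centImage K π 𝒜 L F)

/-- `M ↦ M[F] = {m ∈ M | m f = 0 for all f ∈ F}`, from right `Û(L)_K`-modules to right
`Û(C)_K/(F)`-modules. -/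
def pullback : ModuleCat.{u} (UHatK K π 𝒜 L)ᵐᵒᵖ ⥤ ModuleCat.{u} (CentHatKMod K π 𝒜 L F)ᵐᵒᵖ :=
  killedByFunctor (t := functionMap K π 𝒜 L '' F) (centImage_central K π 𝒜 L F)
    (centInclusion_image K π 𝒜 L F)

end Kashiwara

end

end RigidKashiwara

/-!
Throughout, modules are right modules, `Û(L)` is the `π`-adic completion of the enveloping algebra
and `Û(L)_K` is `Û(L)` with `π` inverted.

**Noetherianity and topology.** A strictly convergent power series is a polynomial modulo `π`, so
`𝒜 / π` is a quotient of a polynomial ring. The opposite of `U(L) / π` is therefore almost commutative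
over a noetherian ring: it is generated by finitely many elements whose commutators have lower
order. Such a ring is noetherian, because a left ideal is generated by elements whose symbols
generate the ideal of symbols (`AlmostCommutative.isNoetherianRing`,
`isNoetherian_enveloping_quotient`). Hence `Û(L)` is a complete unit ball in `Û(L)_K` that is right
noetherian modulo `π` (`CompleteBall`, `completeBall_UHat`). Successive approximation then shows
that `Û(L)_K` is right noetherian, that saturated modules of relations are finitely generated, and
that finitely generated modules are separated and complete for the topology of balls `πⁿ ∑ sᵢ Û(L)`.
This topology is the one defined by lattices (`tendsToZero_iff_nullSeq`).

**One function.** Let `d · f = 1` and `L · f ⊆ 𝒜`. Then `L = C ⊕ 𝒜 d` with `C = C_L(f)`, and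
`U(L) = ⨁ₖ U(C) dᵏ`. The sum is direct because `U(L)` acts on sequences in `U(C)` by the formulas for left
multiplication on such sums (`Enveloping.Splitting.rep`), and this action returns the coefficients.
After completion, `Û(L)_K` consists of series `∑ vₖ Dᵏ` with `vₖ` in `Û(C)_K` tending to zero, where
`D x - x D = 1` for the central element `x = f` of `Û(C)_K`: differential operators in one variable
(`OreStep`).

If `x` kills `N`, the elements of `N ⊗ Û(L)_K` have well-defined coefficients, which determine them
(`OreStep.IsCoeff.eq_zero`), and `x` acts on `∑ nₖ ⊗ Dᵏ` as the derivative with respect to `D`. So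
`N` is the kernel of `x` (`OreStep.mem_range_iff`), and the divided powers `xⁿ / n!`, which act with
binomial coefficients, tend to zero (`OreStep.nullSeq_of_isInduced`). Conversely, if the divided
powers of `x` tend to zero on `M`, then `P(m) = ∑ (-1)ᵇ m (xᵇ / b!) Dᵇ` converges to an element
killed by `x`, and the Taylor expansion `m = ∑ P(m xᵏ / k!) Dᵏ` shows that `M` is generated by the
kernel of `x`; comparing coefficients, `M` is induced from it (`OreStep.finite_and_isInduced`).

**Several functions.** The remaining functions are coordinates on `C_L(f₀)`, and the centraliser of
all the functions in `L` is the centraliser of the remaining ones in `C_L(f₀)`. Induction in stages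
gives both directions by induction on the number of functions (`injective_and_range`,
`RigidKashiwara.finite_and_isInduced`). Since any of the functions can be taken first, the divided
powers of each of them tend to zero on a module induced from `C_L(F)` (`IsCentraliser.nullSeq`).
Induced modules are characterised by a universal property (`IsInduced`), so that the tensor product
and the part killed by `F` can be compared without reference to their construction.
-/


namespace RigidKashiwara

/-! ### Almost commutative rings are noetherian -/

section AlmostCommutative

variable {S S₀ : Type u} [Ring S] [CommRing S₀] (ι : S₀ →+* S) {d : ℕ} (y : Fin d → S)

/-- The additive subgroup of `S` spanned by the products `ι a * y i₁ * ⋯ * y iₖ` with `k < n`. -/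
def wordsBelow (n : ℕ) : AddSubgroup S :=
  AddSubgroup.closure {s | ∃ (a : S₀) (l : List (Fin d)), l.length < n ∧ s = ι a * (l.map y).prod}

/-- A ring `S` generated by the image of a commutative ring `S₀` and finitely many elements `y i`,
whose commutators with each other and with `S₀` have lower order. -/
structure AlmostCommutative : Prop where
  comm_base : ∀ i a, ∃ b, y i * ι a = ι a * y i + ι b
  comm_gen : ∀ i j, ∃ (b : S₀) (c : Fin d → S₀),
    y i * y j = y j * y i + ι b + ∑ k, ι (c k) * y k
  generate : ∀ s : S, s ∈ Subring.closure (Set.range ι ∪ Set.range y)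

variable {ι y}

theorem word_mem_wordsBelow (a : S₀) {l : List (Fin d)} {n : ℕ} (h : l.length < n) :
    ι a * (l.map y).prod ∈ wordsBelow ι y n :=
  AddSubgroup.subset_closure ⟨a, l, h, rfl⟩

theorem word_mem_wordsBelow' {l : List (Fin d)} {n : ℕ} (h : l.length < n) :
    (l.map y).prod ∈ wordsBelow ι y n := by
  simpa using word_mem_wordsBelow (ι := ι) (y := y) 1 h

theorem wordsBelow_mono {m n : ℕ} (h : m ≤ n) : wordsBelow ι y m ≤ wordsBelow ι y n :=
  AddSubgroup.closure_mono fun _ ⟨a, l, hl, e⟩ => ⟨a, l, hl.trans_le h, e⟩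

theorem wordsBelow_zero : wordsBelow ι y 0 = ⊥ := by
  rw [wordsBelow, eq_bot_iff, AddSubgroup.closure_le]
  rintro _ ⟨a, l, hl, rfl⟩
  exact absurd hl (Nat.not_lt_zero _)

/-- An additive map sends `wordsBelow n` into a subgroup as soon as it does so for words. -/
theorem wordsBelow_induction {n : ℕ} {G : AddSubgroup S} (T : S →+ S)
    (h : ∀ (a : S₀) (l : List (Fin d)), l.length < n → T (ι a * (l.map y).prod) ∈ G)
    {s : S} (hs : s ∈ wordsBelow ι y n) : T s ∈ G := by
  have : wordsBelow ι y n ≤ G.comap T := by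
    rw [wordsBelow, AddSubgroup.closure_le]
    rintro _ ⟨a, l, hl, rfl⟩
    exact h a l hl
  exact this hs

theorem base_mul_mem (a : S₀) {n : ℕ} {s : S} (hs : s ∈ wordsBelow ι y n) :
    ι a * s ∈ wordsBelow ι y n :=
  wordsBelow_induction (AddMonoidHom.mulLeft (ι a)) (fun b l hl => by
    rw [AddMonoidHom.coe_mulLeft, ← mul_assoc, ← map_mul]
    exact word_mem_wordsBelow _ hl) hs

theorem mul_word_mem (l' : List (Fin d)) {n : ℕ} {s : S} (hs : s ∈ wordsBelow ι y n) :
    s * (l'.map y).prod ∈ wordsBelow ι y (n + l'.length) :=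
  wordsBelow_induction (AddMonoidHom.mulRight ((l'.map y).prod)) (fun b l hl => by
    rw [AddMonoidHom.mulRight_apply, mul_assoc, ← List.prod_append, ← List.map_append]
    exact word_mem_wordsBelow _ (by rw [List.length_append]; omega)) hs

namespace AlmostCommutative

theorem gen_mul_mem (h : AlmostCommutative ι y) (i : Fin d) {n : ℕ} {s : S}
    (hs : s ∈ wordsBelow ι y n) : y i * s ∈ wordsBelow ι y (n + 1) :=
  wordsBelow_induction (AddMonoidHom.mulLeft (y i)) (fun a l hl => by
    obtain ⟨b, hb⟩ := h.comm_base i a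
    rw [AddMonoidHom.coe_mulLeft, ← mul_assoc, hb, add_mul, mul_assoc, ← List.prod_cons,
      ← List.map_cons]
    exact add_mem (word_mem_wordsBelow _ (by simpa using hl))
      (word_mem_wordsBelow _ (hl.trans (Nat.lt_succ_self n)))) hs

theorem word_mul_mem (h : AlmostCommutative ι y) (l : List (Fin d)) {n : ℕ} {s : S}
    (hs : s ∈ wordsBelow ι y n) : (l.map y).prod * s ∈ wordsBelow ι y (n + l.length) := by
  induction l with
  | nil => simpa using hs
  | cons i l ih =>
    rw [List.map_cons, List.prod_cons, mul_assoc, List.length_cons, ← add_assoc]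
    exact h.gen_mul_mem i ih

theorem exhaust (h : AlmostCommutative ι y) (s : S) : ∃ n, s ∈ wordsBelow ι y n := by
  induction h.generate s using Subring.closure_induction with
  | mem s hs =>
    obtain ⟨a, rfl⟩ | ⟨i, rfl⟩ := hs
    · exact ⟨1, by simpa using word_mem_wordsBelow (ι := ι) (y := y) a (l := []) one_pos⟩
    · exact ⟨2, by simpa using word_mem_wordsBelow' (ι := ι) (y := y) (l := [i]) one_lt_two⟩
  | zero => exact ⟨0, zero_mem _⟩
  | one => exact ⟨1, by simpa using word_mem_wordsBelow' (ι := ι) (y := y) (l := []) one_pos⟩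
  | add s t _ _ hs ht =>
    obtain ⟨m, hs⟩ := hs
    obtain ⟨n, ht⟩ := ht
    exact ⟨max m n, add_mem (wordsBelow_mono (le_max_left _ _) hs)
      (wordsBelow_mono (le_max_right _ _) ht)⟩
  | neg s _ hs =>
    obtain ⟨m, hs⟩ := hs
    exact ⟨m, neg_mem hs⟩
  | mul s t _ _ hs ht =>
    obtain ⟨m, hs⟩ := hs
    obtain ⟨n, ht⟩ := ht
    refine ⟨n + m, wordsBelow_induction (AddMonoidHom.mulRight t) (fun a l hl => ?_) hs⟩
    rw [AddMonoidHom.mulRight_apply, mul_assoc]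
    exact base_mul_mem a (wordsBelow_mono (by omega) (h.word_mul_mem l ht))

/-- Words commute with `S₀` up to shorter words. -/
theorem word_comm_base (h : AlmostCommutative ι y) (l : List (Fin d)) (a : S₀) :
    (l.map y).prod * ι a - ι a * (l.map y).prod ∈ wordsBelow ι y l.length := by
  induction l with
  | nil => simp [zero_mem]
  | cons i l ih =>
    obtain ⟨b, hb⟩ := h.comm_base i a
    have key : ((i :: l).map y).prod * ι a - ι a * ((i :: l).map y).prod =
        y i * ((l.map y).prod * ι a - ι a * (l.map y).prod) + ι b * (l.map y).prod := by
      have : y i * ι a * (l.map y).prod = (ι a * y i + ι b) * (l.map y).prod := by rw [hb]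
      simp only [List.map_cons, List.prod_cons, mul_sub, ← mul_assoc, this, add_mul]
      abel
    rw [key, List.length_cons]
    exact add_mem (h.gen_mul_mem i ih) (word_mem_wordsBelow _ (Nat.lt_succ_self _))

/-- Permuting the letters changes a word by shorter words. -/
theorem word_perm (h : AlmostCommutative ι y) {l l' : List (Fin d)} (hl : l.Perm l') :
    (l.map y).prod - (l'.map y).prod ∈ wordsBelow ι y l.length := by
  induction hl with
  | nil => simp [zero_mem]
  | cons i _ ih =>
    rw [List.map_cons, List.map_cons, List.prod_cons, List.prod_cons, ← mul_sub, List.length_cons]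
    exact h.gen_mul_mem i ih
  | swap i j l =>
    obtain ⟨b, c, hbc⟩ := h.comm_gen j i
    simp only [List.map_cons, List.prod_cons, List.length_cons]
    rw [← mul_assoc, ← mul_assoc, ← sub_mul, hbc, add_assoc (y i * y j),
      add_sub_cancel_left, add_mul, Finset.sum_mul]
    refine add_mem (word_mem_wordsBelow _ (by omega)) (sum_mem fun k _ => ?_)
    rw [mul_assoc, ← List.prod_cons, ← List.map_cons]
    exact word_mem_wordsBelow _ (by simp)
  | trans p q ih ih' =>
    have := add_mem ih (p.length_eq ▸ ih')
    rwa [sub_add_sub_cancel] at this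

end AlmostCommutative

variable (ι y)

/-- The word in the `y i` attached to an exponent vector. -/
noncomputable def monomialWord (α : Fin d →₀ ℕ) : List (Fin d) := (Finsupp.toMultiset α).toList

theorem length_monomialWord (α : Fin d →₀ ℕ) : (monomialWord α).length = α.degree := by
  rw [monomialWord, Multiset.length_toList, Finsupp.card_toMultiset]
  rfl

theorem monomialWord_add (α β : Fin d →₀ ℕ) :
    (monomialWord (α + β)).Perm (monomialWord α ++ monomialWord β) := by
  rw [← Multiset.coe_eq_coe, ← Multiset.coe_add]
  simp [monomialWord]

/-- Evaluation of polynomials in ordered monomials: `∑ a_α X^α ↦ ∑ ι a_α y^α`. It is only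
multiplicative up to terms of lower order. -/
noncomputable def orderedEval : MvPolynomial (Fin d) S₀ →+ S :=
  letI : Module S₀ S := Module.compHom S ι
  ((MvPolynomial.basisMonomials (Fin d) S₀).constr ℕ
    fun α => ((monomialWord α).map y).prod).toAddMonoidHom

theorem orderedEval_monomial (α : Fin d →₀ ℕ) (a : S₀) :
    orderedEval ι y (MvPolynomial.monomial α a) = ι a * ((monomialWord α).map y).prod := by
  let : Module S₀ S := Module.compHom S ι
  have h : MvPolynomial.monomial α a = a • MvPolynomial.basisMonomials (Fin d) S₀ α := by
    rw [MvPolynomial.coe_basisMonomials, MvPolynomial.smul_monomial, smul_eq_mul, mul_one]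
  change (MvPolynomial.basisMonomials (Fin d) S₀).constr ℕ _ _ = _
  rw [h, map_smul, Module.Basis.constr_basis]
  rfl

variable {ι y}

open MvPolynomial in
theorem homogeneous_induction {n : ℕ} {P : MvPolynomial (Fin d) S₀ → Prop} (h0 : P 0)
    (hadd : ∀ p q, P p → P q → P (p + q)) (hmon : ∀ α a, α.degree = n → P (monomial α a))
    {p : MvPolynomial (Fin d) S₀} (hp : p.IsHomogeneous n) : P p := by
  rw [p.as_sum]
  refine Finset.sum_induction _ P hadd h0 fun α hα => hmon _ _ ?_
  have := hp (mem_support_iff.1 hα)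
  rwa [Finsupp.degree_eq_weight_one]

open MvPolynomial in
/-- Multiplication by a monomial is multiplication by the corresponding word, up to lower order. -/
theorem AlmostCommutative.orderedEval_monomial_mul (h : AlmostCommutative ι y)
    (α : Fin d →₀ ℕ) (a : S₀) {n : ℕ} {p : MvPolynomial (Fin d) S₀} (hp : p.IsHomogeneous n) :
    ι a * ((monomialWord α).map y).prod * orderedEval ι y p - orderedEval ι y (monomial α a * p) ∈
      wordsBelow ι y (α.degree + n) := by
  refine homogeneous_induction (P := fun p => ι a * ((monomialWord α).map y).prod *
    orderedEval ι y p - orderedEval ι y (monomial α a * p) ∈ wordsBelow ι y (α.degree + n))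
    (by simp [zero_mem]) (fun p q hp hq => ?_) (fun β b hβ => ?_) hp
  · have := add_mem hp hq
    rwa [sub_add_sub_comm, ← mul_add, ← map_add, ← map_add, ← mul_add] at this
  · rw [monomial_mul, orderedEval_monomial, orderedEval_monomial]
    have h1 := base_mul_mem a (mul_word_mem (monomialWord β) (h.word_comm_base (monomialWord α) b))
    have h2 := base_mul_mem (a * b) (h.word_perm (monomialWord_add α β))
    rw [length_monomialWord, length_monomialWord, hβ] at h1
    rw [length_monomialWord, map_add, hβ] at h2
    have := sub_mem h1 h2
    convert this using 1
    rw [List.map_append, List.prod_append, map_mul]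
    simp only [mul_sub, sub_mul, mul_assoc]
    abel

open MvPolynomial in
/-- Every element of order at most `n` has a symbol: a homogeneous polynomial of degree `n` whose
ordered evaluation agrees with it up to lower order. The symbol need not be unique. -/
theorem AlmostCommutative.exists_symbol {n : ℕ} {s : S} (hs : s ∈ wordsBelow ι y (n + 1))
    (h : AlmostCommutative ι y) :
    ∃ p : MvPolynomial (Fin d) S₀,
      p.IsHomogeneous n ∧ s - orderedEval ι y p ∈ wordsBelow ι y n := by
  induction hs using AddSubgroup.closure_induction with
  | mem s hs =>
    obtain ⟨a, l, hl, rfl⟩ := hs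
    obtain hl | hl := (Nat.lt_succ_iff_lt_or_eq.1 hl)
    · exact ⟨0, isHomogeneous_zero _ _ _, by simpa using word_mem_wordsBelow a hl⟩
    · refine ⟨monomial (Multiset.toFinsupp (l : Multiset (Fin d))) a,
        isHomogeneous_monomial _ ?_, ?_⟩
      · rw [← length_monomialWord, monomialWord, Multiset.toFinsupp_toMultiset,
          Multiset.length_toList, Multiset.coe_card, hl]
      · rw [orderedEval_monomial, ← mul_sub]
        refine base_mul_mem a ?_
        rw [← hl]
        refine h.word_perm ?_
        rw [monomialWord, Multiset.toFinsupp_toMultiset, ← Multiset.coe_eq_coe, Multiset.coe_toList]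
  | zero => exact ⟨0, isHomogeneous_zero _ _ _, by simp [zero_mem]⟩
  | add s t _ _ hs ht =>
    obtain ⟨p, hp, hs⟩ := hs
    obtain ⟨q, hq, ht⟩ := ht
    exact ⟨p + q, hp.add hq, by rw [map_add, add_sub_add_comm]; exact add_mem hs ht⟩
  | neg s _ hs =>
    obtain ⟨p, hp, hs⟩ := hs
    exact ⟨-p, hp.neg, by rw [map_neg, ← neg_sub']; exact neg_mem hs⟩

open MvPolynomial in
/-- Division by a family `s t ∈ I` whose symbols are the `t ∈ T`: every homogeneous component of a
polynomial in the ideal generated by `T` is the symbol of an element of the left ideal generated by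
the `s t`. -/
theorem AlmostCommutative.lift_symbol (h : AlmostCommutative ι y)
    (T : Set (MvPolynomial (Fin d) S₀)) (I : Ideal S)
    (hT : ∀ t ∈ T, ∃ n, t.IsHomogeneous n ∧ ∃ s ∈ I, s - orderedEval ι y t ∈ wordsBelow ι y n)
    {p : MvPolynomial (Fin d) S₀} (hp : p ∈ Ideal.span T) (n : ℕ) :
    ∃ s ∈ I, s - orderedEval ι y (homogeneousComponent n p) ∈ wordsBelow ι y n := by
  induction hp using Submodule.span_induction generalizing n with
  | mem t ht =>
    obtain ⟨m, hm, s, hs, hst⟩ := hT t ht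
    rw [homogeneousComponent_of_mem hm]
    split_ifs with hmn
    · exact ⟨s, hs, hmn ▸ hst⟩
    · exact ⟨0, zero_mem _, by simp [zero_mem]⟩
  | zero => exact ⟨0, zero_mem _, by simp [zero_mem]⟩
  | add p q _ _ hp hq =>
    obtain ⟨s, hs, hp⟩ := hp n
    obtain ⟨t, ht, hq⟩ := hq n
    exact ⟨s + t, add_mem hs ht, by rw [map_add, map_add, add_sub_add_comm]; exact add_mem hp hq⟩
  | smul q p _ hp =>
    induction q using MvPolynomial.induction_on' with
    | add q q' hq hq' =>
      obtain ⟨s, hs, hp⟩ := hq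
      obtain ⟨t, ht, hq⟩ := hq'
      exact ⟨s + t, add_mem hs ht, by
        rw [add_smul, map_add, map_add, add_sub_add_comm]; exact add_mem hp hq⟩
    | monomial α a =>
      by_cases hα : α.degree ≤ n
      · have e : homogeneousComponent n (monomial α a • p) =
            monomial α a * homogeneousComponent (n - α.degree) p := by
          ext β
          rw [smul_eq_mul, coeff_homogeneousComponent, coeff_monomial_mul', coeff_monomial_mul']
          by_cases hβ : α ≤ β
          · have : β.degree = α.degree + (β - α).degree := by
              rw [← map_add, add_tsub_cancel_of_le hβ]
            rw [if_pos hβ, if_pos hβ, coeff_homogeneousComponent]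
            by_cases h1 : β.degree = n
            · rw [if_pos h1, if_pos (by omega)]
            · rw [if_neg h1, if_neg (by omega), mul_zero]
          · simp [hβ]
        obtain ⟨s, hs, hp⟩ := hp (n - α.degree)
        refine ⟨ι a * ((monomialWord α).map y).prod * s, I.mul_mem_left _ hs, ?_⟩
        rw [e]
        have h1 := h.orderedEval_monomial_mul α a
          (homogeneousComponent_isHomogeneous (n - α.degree) p)
        have h2 := base_mul_mem a (h.word_mul_mem (monomialWord α) hp)
        rw [length_monomialWord, Nat.sub_add_cancel hα, ← mul_assoc] at h2
        rw [Nat.add_sub_cancel' hα] at h1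
        have := add_mem h2 h1
        rwa [mul_sub, sub_add_sub_cancel] at this
      · refine ⟨0, zero_mem _, ?_⟩
        have e : homogeneousComponent n (monomial α a • p) = 0 := by
          ext β
          rw [smul_eq_mul, coeff_homogeneousComponent, coeff_monomial_mul', coeff_zero]
          split_ifs with h1 h2
          · have : β.degree = α.degree + (β - α).degree := by
              rw [← map_add, add_tsub_cancel_of_le h2]
            omega
          · rfl
          · rfl
        rw [e, map_zero, sub_zero]
        exact zero_mem _

open MvPolynomial in
/-- An almost commutative ring over a noetherian ring is noetherian: a left ideal is generated by
elements whose symbols generate its ideal of symbols. -/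
theorem AlmostCommutative.isNoetherianRing [IsNoetherianRing S₀] (h : AlmostCommutative ι y) :
    IsNoetherianRing S := by
  rw [isNoetherianRing_iff_ideal_fg]
  intro I
  -- the symbols of elements of `I`; finitely many of them generate the same ideal
  set Sym : Set (MvPolynomial (Fin d) S₀) := {p | ∃ n, p.IsHomogeneous n ∧
    ∃ s ∈ I, s - orderedEval ι y p ∈ wordsBelow ι y n} with hSym
  obtain ⟨T, hT, hTJ⟩ := (Submodule.fg_span_iff_fg_span_finset_subset Sym).1
    (IsNoetherian.noetherian (Ideal.span Sym))
  have hT' : ∀ t : T, ∃ s : S, s ∈ I ∧ ∃ n, t.1.IsHomogeneous n ∧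
      s - orderedEval ι y t.1 ∈ wordsBelow ι y n := fun t => by
    obtain ⟨n, hn, s, hs, hst⟩ := hT t.2
    exact ⟨s, hs, n, hn, hst⟩
  choose s hsI n hn hs using hT'
  refine (Submodule.fg_def).2 ⟨Set.range s, Set.finite_range s, le_antisymm ?_ ?_⟩
  · rw [Submodule.span_le]
    rintro _ ⟨t, rfl⟩
    exact hsI t
  -- an element of order `m` is reduced to one of smaller order by cancelling its symbol
  · have key : ∀ m, ∀ z ∈ wordsBelow ι y m, z ∈ I → z ∈ Submodule.span S (Set.range s) := by
      intro m
      induction m with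
      | zero =>
        intro z hz _
        rw [wordsBelow_zero, AddSubgroup.mem_bot] at hz
        rw [hz]
        exact zero_mem _
      | succ m ih =>
        intro z hz hzI
        obtain ⟨p, hp, hzp⟩ := h.exists_symbol hz
        have hpJ : p ∈ Ideal.span (T : Set (MvPolynomial (Fin d) S₀)) := by
          change p ∈ Submodule.span _ _
          rw [← hTJ]
          exact Submodule.subset_span ⟨m, hp, z, hzI, hzp⟩
        obtain ⟨w, hw, hwp⟩ := h.lift_symbol T (Submodule.span S (Set.range s))
          (fun t ht => ⟨n ⟨t, ht⟩, hn ⟨t, ht⟩, s ⟨t, ht⟩, Submodule.subset_span ⟨_, rfl⟩,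
            hs ⟨t, ht⟩⟩) hpJ m
        rw [homogeneousComponent_of_mem hp, if_pos rfl] at hwp
        have hle : Submodule.span S (Set.range s) ≤ I := by
          rw [Submodule.span_le]
          rintro _ ⟨t, rfl⟩
          exact hsI t
        have := ih (z - w) (by simpa using sub_mem hzp hwp) (sub_mem hzI (hle hw))
        simpa using add_mem this hw
    intro z hz
    obtain ⟨m, hm⟩ := h.exhaust z
    exact key m z hm hz

end AlmostCommutative

/-! ### Modules over complete noetherian rings with `π` inverted -/

section CompleteBall

variable {R : Type u} [CommRing R] (π : R)

/-- The sequence `b` tends to zero `π`-adically. -/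
def PiNull {B : Type u} [AddCommGroup B] [Module R B] (b : ℕ → B) : Prop :=
  ∀ n, ∀ᶠ k in Filter.atTop, ∃ c, b k = π ^ n • c

variable {U₀ U : Type u} [Ring U₀] [Algebra R U₀] [Ring U] [Algebra R U]

/-- `U₀` is `π`-adically complete and separated with `U₀ / π U₀` right noetherian, `π` is invertible
in `U`, and `U` is spanned by the image of `U₀` after inverting `π`. The map `U₀ → U` need not be
injective. Completeness is stated as the convergence of series of null sequences. -/
structure CompleteBall (ι : U₀ →ₐ[R] U) : Prop where
  sep : ∀ u : U₀, (∀ n, ∃ v, u = π ^ n • v) → u = 0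
  summable : ∀ b : ℕ → U₀, PiNull π b →
    ∃ s, ∀ n, ∀ᶠ k in Filter.atTop, ∃ v, s - ∑ i ∈ Finset.range k, b i = π ^ n • v
  noeth : ∃ (S : Type u) (_ : Ring S) (ρ : U₀ →+* S), IsNoetherian Sᵐᵒᵖ S ∧
    Function.Surjective ρ ∧ ∀ u, ρ u = 0 ↔ ∃ v, u = π • v
  isUnit : IsUnit (algebraMap R U π)
  surj : ∀ u : U, ∃ n v, π ^ n • u = ι v

variable {π} {ι : U₀ →ₐ[R] U}

theorem piNull_pow_smul {B : Type u} [AddCommGroup B] [Module R B] (b : ℕ → B) :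
    PiNull π fun i => π ^ i • b i := fun n => by
  filter_upwards [Filter.eventually_ge_atTop n] with k hk
  exact ⟨π ^ (k - n) • b k, by rw [smul_smul, ← pow_add, Nat.add_sub_cancel' hk]⟩

/-- Successive approximation: if every element of `X` is a combination of the `κ j` up to `π X`,
then it is a combination of the `κ j`. -/
theorem CompleteBall.approx (h : CompleteBall π ι) {α β : Type*} [Fintype α] [Fintype β]
    (κ : β → α → U₀) (X : Set (α → U₀))
    (hX : ∀ a ∈ X, ∃ w : β → U₀, ∃ a' ∈ X, ∀ i, a i = ∑ j, κ j i * w j + π • a' i)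
    {a : α → U₀} (ha : a ∈ X) : ∃ w : β → U₀, ∀ i, a i = ∑ j, κ j i * w j := by
  -- the successive remainders are `π ^ n • s n`, and the coefficients are `∑ πᵏ w (s k)`
  choose! w a' ha' hw using hX
  let s : ℕ → α → U₀ := fun n => a'^[n] a
  have hs : ∀ n, s n ∈ X := by
    intro n
    induction n with
    | zero => exact ha
    | succ n ih =>
      change a'^[n + 1] a ∈ X
      rw [Function.iterate_succ_apply']
      exact ha' _ ih
  have hsum : ∀ n i, a i = ∑ j, κ j i * ∑ k ∈ Finset.range n, π ^ k • w (s k) j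
      + π ^ n • s n i := by
    intro n i
    induction n with
    | zero => simp [s]
    | succ n ih =>
      have e : s (n + 1) = a' (s n) := Function.iterate_succ_apply' _ _ _
      rw [ih, hw _ (hs n) i, e]
      simp only [Finset.sum_range_succ, mul_add, Finset.sum_add_distrib, smul_add, Finset.smul_sum,
        mul_smul_comm, smul_smul, ← pow_succ, add_assoc]
  choose W hW using fun j => h.summable (fun k => π ^ k • w (s k) j) (piNull_pow_smul _)
  refine ⟨W, fun i => sub_eq_zero.1 (h.sep _ fun n => ?_)⟩
  have hev : ∀ᶠ k in Filter.atTop, ∀ j, ∃ v, W j - ∑ l ∈ Finset.range k, π ^ l • w (s l) j =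
      π ^ n • v := Filter.eventually_all.2 fun j => hW j n
  obtain ⟨k, hk, hnk⟩ := (hev.and (Filter.eventually_ge_atTop n)).exists
  choose v hv using hk
  refine ⟨π ^ (k - n) • s k i - ∑ j, κ j i * v j, ?_⟩
  have e : ∑ j, κ j i * W j = ∑ j, κ j i * ∑ l ∈ Finset.range k, π ^ l • w (s l) j +
      π ^ n • ∑ j, κ j i * v j := by
    rw [Finset.smul_sum, ← Finset.sum_add_distrib]
    refine Finset.sum_congr rfl fun j _ => ?_
    rw [← mul_smul_comm, ← hv j, mul_sub, add_sub_cancel]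
  rw [hsum k i, e, smul_sub, smul_smul, ← pow_add, Nat.add_sub_cancel' hnk]
  abel

/-- A `π`-saturated right submodule of a finite free module is finitely generated: generators modulo
`π` are lifted, and saturation lets successive approximation take place inside the submodule. -/
theorem CompleteBall.exists_generators (h : CompleteBall π ι) {α : Type*} [Fintype α]
    (Q : Submodule U₀ᵐᵒᵖ (α → U₀)) (hQ : ∀ a, π • a ∈ Q → a ∈ Q) :
    ∃ (l : ℕ) (κ : Fin l → α → U₀), (∀ j, κ j ∈ Q) ∧
      ∀ a ∈ Q, ∃ w : Fin l → U₀, ∀ i, a i = ∑ j, κ j i * w j := by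
  obtain ⟨S, _, ρ, hS, hρ, hker⟩ := h.noeth
  have : RingHomSurjective (RingHom.op ρ) := ⟨fun x => by
    obtain ⟨y, hy⟩ := hρ x.unop
    exact ⟨op y, unop_injective hy⟩⟩
  let T : (α → U₀) →ₛₗ[RingHom.op ρ] (α → S) :=
    { toFun := fun a i => ρ (a i)
      map_add' := fun a b => funext fun i => map_add ρ _ _
      map_smul' := fun u a => funext fun i => map_mul ρ _ _ }
  obtain ⟨l, t, ht⟩ := Submodule.fg_iff_exists_fin_generating_family.1
    (IsNoetherian.noetherian (Q.map T))
  have hmem : ∀ j, t j ∈ Q.map T := fun j => ht ▸ Submodule.subset_span ⟨j, rfl⟩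
  choose κ hκ hκt using hmem
  refine ⟨l, κ, hκ, fun a ha => h.approx κ (Q : Set (α → U₀)) (fun a ha => ?_) ha⟩
  have h1 : T a ∈ Submodule.span Sᵐᵒᵖ (Set.range t) := ht ▸ ⟨a, ha, rfl⟩
  obtain ⟨c, hc⟩ := (Submodule.mem_span_range_iff_exists_fun _).1 h1
  choose w hw using fun j => hρ (c j).unop
  have h2 : ∀ i, ρ (a i - ∑ j, κ j i * w j) = 0 := by
    intro i
    have h3 := congrFun hc i
    rw [Finset.sum_apply] at h3
    rw [map_sub, map_sum, sub_eq_zero]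
    refine h3.symm.trans (Finset.sum_congr rfl fun j _ => ?_)
    rw [map_mul, hw, ← hκt]
    rfl
  choose a' ha' using fun i => (hker _).1 (h2 i)
  refine ⟨w, a', hQ _ ?_, fun i => ?_⟩
  · have e : π • a' = a - ∑ j, op (w j) • κ j := by
      ext i
      rw [Pi.smul_apply, ← ha', Pi.sub_apply, Finset.sum_apply]
      rfl
    rw [e]
    exact sub_mem ha (sum_mem fun j _ => Q.smul_mem _ (hκ j))
  · rw [← ha', add_sub_cancel]

theorem CompleteBall.isUnit_op (h : CompleteBall π ι) (n : ℕ) :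
    IsUnit (op (algebraMap R U (π ^ n))) := by
  rw [map_pow]
  exact (h.isUnit.pow n).op

theorem CompleteBall.pow_smul_injective (h : CompleteBall π ι) (n : ℕ) {x y : U}
    (hxy : π ^ n • x = π ^ n • y) : x = y := by
  rw [Algebra.smul_def, Algebra.smul_def, map_pow] at hxy
  exact (h.isUnit.pow n).mul_left_cancel hxy

/-- Finitely many elements of `U` have a common denominator. -/
theorem CompleteBall.exists_common (h : CompleteBall π ι) {α : Type*} [Fintype α] (u : α → U) :
    ∃ n, ∃ v : α → U₀, ∀ i, π ^ n • u i = ι (v i) := by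
  choose n v hv using fun i => h.surj (u i)
  refine ⟨∑ i, n i, fun i => π ^ (∑ i, n i - n i) • v i, fun i => ?_⟩
  have hi : n i ≤ ∑ i, n i := Finset.single_le_sum (fun _ _ => Nat.zero_le _) (Finset.mem_univ i)
  rw [map_smul, ← hv, smul_smul, ← pow_add, Nat.sub_add_cancel hi]

/-- `U` is right noetherian: a right ideal of `U` is generated by its part in the unit ball, which
is saturated. -/
theorem CompleteBall.isNoetherianRing_op (h : CompleteBall π ι) : IsNoetherianRing Uᵐᵒᵖ := by
  rw [isNoetherianRing_iff_ideal_fg]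
  intro I
  let Q : Submodule U₀ᵐᵒᵖ (Unit → U₀) :=
    { carrier := {a | op (ι (a ())) ∈ I}
      zero_mem' := by simp
      add_mem' := fun {a b} ha hb => by
        simp only [Set.mem_ofPred_eq, Pi.add_apply, map_add] at *
        exact add_mem ha hb
      smul_mem' := fun u a ha => by
        change op (ι (a () * u.unop)) ∈ I
        rw [map_mul, op_mul]
        exact I.mul_mem_left _ ha }
  obtain ⟨l, κ, hκ, hgen⟩ := h.exists_generators Q (fun a ha => by
    change op (ι (a ())) ∈ I
    have h1 : op (ι (π • a ())) ∈ I := ha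
    rw [map_smul, Algebra.smul_def, Algebra.commutes, op_mul] at h1
    have h2 := h.isUnit_op 1
    rw [pow_one] at h2
    exact (Ideal.unit_mul_mem_iff_mem I h2).1 h1)
  refine (Submodule.fg_def).2 ⟨Set.range fun j => op (ι (κ j ())), Set.finite_range _,
    le_antisymm ?_ ?_⟩
  · rw [Submodule.span_le]
    rintro _ ⟨j, rfl⟩
    exact hκ j
  · intro z hz
    obtain ⟨n, v, hv⟩ := h.surj z.unop
    have hzv : op (algebraMap R U (π ^ n)) * z = op (ι v) := by
      rw [← hv, Algebra.smul_def, Algebra.commutes, op_mul, op_unop]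
    obtain ⟨w, hw⟩ := hgen (fun _ => v) (by
      change op (ι v) ∈ I
      rw [← hzv]
      exact I.mul_mem_left _ hz)
    refine (Ideal.unit_mul_mem_iff_mem _ (h.isUnit_op n)).1 ?_
    rw [hzv]
    rw [show v = _ from hw (), map_sum, Finset.op_sum]
    refine sum_mem fun j _ => ?_
    rw [map_mul, op_mul]
    exact Submodule.smul_mem _ _ (Submodule.subset_span ⟨j, rfl⟩)

/-! ### Balls in finitely generated modules -/

variable (π ι) {M : Type u} [AddCommGroup M] [Module Uᵐᵒᵖ M]

/-- `πⁿ ∑ sᵢ U₀`, for a finite family `s` in a right `U`-module. -/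
def ball {α : Type*} [Fintype α] (n : ℕ) (s : α → M) : AddSubgroup M where
  carrier := {m | ∃ a : α → U₀, m = ∑ i, op (ι (π ^ n • a i)) • s i}
  zero_mem' := ⟨0, by simp⟩
  add_mem' := by
    rintro _ _ ⟨a, rfl⟩ ⟨b, rfl⟩
    exact ⟨a + b, by simp [add_smul, Finset.sum_add_distrib]⟩
  neg_mem' := by
    rintro _ ⟨a, rfl⟩
    exact ⟨-a, by simp [Finset.sum_neg_distrib]⟩

variable {π ι}

theorem op_algebraMap_smul (r : R) (u : U) (m : M) :
    op (r • u) • m = op (algebraMap R U r) • op u • m := by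
  rw [smul_smul, ← op_mul, Algebra.smul_def, Algebra.commutes]

theorem op_algebraMap_smul' (r : R) (u : U) (m : M) :
    op (r • u) • m = op u • op (algebraMap R U r) • m := by
  rw [smul_smul, ← op_mul, Algebra.smul_def]

theorem mem_ball_iff {α : Type*} [Fintype α] {n : ℕ} {s : α → M} {m : M} :
    m ∈ ball π ι n s ↔ ∃ m' ∈ ball π ι 0 s, m = op (algebraMap R U (π ^ n)) • m' := by
  constructor
  · rintro ⟨a, rfl⟩
    refine ⟨_, ⟨a, rfl⟩, ?_⟩
    simp only [Finset.smul_sum, ← op_algebraMap_smul, ← map_smul, pow_zero, one_smul]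
  · rintro ⟨_, ⟨a, rfl⟩, rfl⟩
    refine ⟨a, ?_⟩
    simp only [Finset.smul_sum, ← op_algebraMap_smul, ← map_smul, pow_zero, one_smul]

theorem smul_mem_ball {α : Type*} [Fintype α] {n : ℕ} {s : α → M} {m : M}
    (hm : m ∈ ball π ι n s) (u : U₀) : op (ι u) • m ∈ ball π ι n s := by
  obtain ⟨a, rfl⟩ := hm
  refine ⟨fun i => a i * u, ?_⟩
  rw [Finset.smul_sum]
  refine Finset.sum_congr rfl fun i _ => ?_
  rw [smul_smul, ← op_mul, ← map_mul, smul_mul_assoc]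

theorem smul_mem_ball_add {α : Type*} [Fintype α] {n : ℕ} {s : α → M} {m : M}
    (hm : m ∈ ball π ι n s) (k : ℕ) :
    op (algebraMap R U (π ^ k)) • m ∈ ball π ι (k + n) s := by
  obtain ⟨m', hm', rfl⟩ := mem_ball_iff.1 hm
  refine mem_ball_iff.2 ⟨m', hm', ?_⟩
  rw [smul_smul, ← op_mul, ← map_mul, ← pow_add, add_comm]

theorem CompleteBall.mem_ball_of_smul (h : CompleteBall π ι) {α : Type*} [Fintype α] {n k : ℕ}
    {s : α → M} {m : M} (hm : op (algebraMap R U (π ^ k)) • m ∈ ball π ι (k + n) s) :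
    m ∈ ball π ι n s := by
  obtain ⟨m', hm', e⟩ := mem_ball_iff.1 hm
  refine mem_ball_iff.2 ⟨m', hm', (h.isUnit_op (U := U) k).smul_left_cancel.1 ?_⟩
  rw [e, smul_smul, ← op_mul, ← map_mul, ← pow_add, add_comm]

/-- Every element lies in some dilate of the ball of a generating family. -/
theorem CompleteBall.exists_smul_mem_ball (h : CompleteBall π ι) {α : Type*} [Fintype α]
    {s : α → M} {m : M} (hm : m ∈ Submodule.span Uᵐᵒᵖ (Set.range s)) :
    ∃ k, op (algebraMap R U (π ^ k)) • m ∈ ball π ι 0 s := by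
  obtain ⟨c, rfl⟩ := (Submodule.mem_span_range_iff_exists_fun _).1 hm
  obtain ⟨n, v, hv⟩ := h.exists_common fun i => (c i).unop
  refine ⟨n, v, ?_⟩
  rw [Finset.smul_sum]
  refine Finset.sum_congr rfl fun i _ => ?_
  rw [pow_zero, one_smul, ← hv, op_algebraMap_smul, op_unop]

/-- Balls of two families are commensurable. -/
theorem CompleteBall.exists_ball_le (h : CompleteBall π ι) {α β : Type*} [Fintype α] [Fintype β]
    (s : α → M) {t : β → M} (ht : ∀ i, s i ∈ Submodule.span Uᵐᵒᵖ (Set.range t)) :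
    ∃ k, ∀ n, ball π ι (k + n) s ≤ ball π ι n t := by
  choose k hk using fun i => h.exists_smul_mem_ball (ht i)
  refine ⟨∑ i, k i, fun n => ?_⟩
  rintro _ ⟨a, rfl⟩
  refine sum_mem fun i _ => ?_
  have hi : k i ≤ ∑ i, k i := Finset.single_le_sum (fun _ _ => Nat.zero_le _) (Finset.mem_univ i)
  have e : op (ι (π ^ (∑ i, k i + n) • a i)) • s i =
      op (ι (π ^ (∑ i, k i - k i) • a i)) • op (algebraMap R U (π ^ n)) •
        op (algebraMap R U (π ^ k i)) • s i := by
    rw [smul_smul (op (algebraMap R U (π ^ n))), ← op_mul, ← map_mul, ← op_algebraMap_smul',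
      ← map_smul, smul_smul, ← pow_add, ← pow_add]
    congr 5
    omega
  rw [e]
  exact smul_mem_ball (smul_mem_ball_add (hk i) n) _

/-- Finitely generated modules are separated: the submodule of relations among the generators is
finitely generated, hence closed. -/
theorem CompleteBall.eq_zero_of_mem_ball (h : CompleteBall π ι) {α : Type*} [Fintype α]
    (s : α → M) {m : M} (hm : ∀ n, m ∈ ball π ι n s) : m = 0 := by
  let ev : (α → U₀) → M := fun a => ∑ i, op (ι (a i)) • s i
  have ev_smul : ∀ a, ev (π • a) = op (algebraMap R U π) • ev a := fun a => by
    simp only [ev, Finset.smul_sum, ← op_algebraMap_smul, ← map_smul, Pi.smul_apply]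
  have ev_sub : ∀ a b, ev (a - b) = ev a - ev b := fun a b => by
    simp [ev, sub_smul, Finset.sum_sub_distrib]
  have hu : IsUnit (op (algebraMap R U π)) := by simpa using h.isUnit_op (U := U) 1
  let Q : Submodule U₀ᵐᵒᵖ (α → U₀) :=
    { carrier := {a | ev a = 0}
      zero_mem' := by simp [ev]
      add_mem' := fun {a b} ha hb => by
        have e : ev (a + b) = ev a + ev b := by simp [ev, add_smul, Finset.sum_add_distrib]
        rw [Set.mem_ofPred_eq] at *
        rw [e, ha, hb, add_zero]
      smul_mem' := fun u a ha => by
        have e : ev (u • a) = op (ι u.unop) • ev a := by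
          simp only [ev, Finset.smul_sum]
          refine Finset.sum_congr rfl fun i _ => ?_
          rw [smul_smul, ← op_mul, ← map_mul]
          rfl
        rw [Set.mem_ofPred_eq] at *
        rw [e, ha, smul_zero] }
  obtain ⟨l, κ, hκ, hgen⟩ := h.exists_generators Q (fun a ha => by
    have h1 : ev (π • a) = 0 := ha
    rw [ev_smul] at h1
    exact hu.smul_left_cancel.1 (h1.trans (smul_zero _).symm))
  obtain ⟨a, ha⟩ := hm 0
  have ham : m = ev a := by simpa only [pow_zero, one_smul] using ha
  have ham' : a ∈ {a | ∀ n, ev a ∈ ball π ι n s} := fun n => by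
    rw [← ham]
    exact hm n
  -- if `ev a` lies in every ball, then `a` is `π b` up to a relation, with `ev b` in every ball
  obtain ⟨w, hw⟩ := h.approx κ {a | ∀ n, ev a ∈ ball π ι n s} (fun a ha => by
    obtain ⟨b, hb⟩ := ha 1
    have hb' : ev a = ev (π • b) :=
      hb.trans (by simp only [pow_one]; rfl)
    obtain ⟨w, hw⟩ := hgen (a - π • b) (by
      change ev (a - π • b) = 0
      rw [ev_sub, hb', sub_self])
    refine ⟨w, b, fun n => ?_, fun i => ?_⟩
    · have := ha (1 + n)
      rw [hb', ev_smul] at this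
      exact h.mem_ball_of_smul (k := 1) (by rwa [pow_one])
    · rw [← hw i, Pi.sub_apply, Pi.smul_apply, sub_add_cancel]) ham'
  have : a = ∑ j, op (w j) • κ j := by
    ext i
    rw [hw i, Finset.sum_apply]
    rfl
  rw [ham]
  change a ∈ Q
  rw [this]
  exact sum_mem fun j _ => Q.smul_mem _ (hκ j)

/-- Finitely generated modules are complete. -/
theorem CompleteBall.exists_sum (h : CompleteBall π ι) {α : Type*} [Fintype α] (s : α → M)
    (x : ℕ → M) (hx : ∀ n, ∀ᶠ k in Filter.atTop, x k ∈ ball π ι n s) :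
    ∃ m, ∀ n, ∀ᶠ k in Filter.atTop, m - ∑ i ∈ Finset.range k, x i ∈ ball π ι n s := by
  classical
  obtain ⟨k₀, hk₀⟩ := Filter.eventually_atTop.1 (hx 0)
  -- for each term, coefficients divisible by a power of `π` that is as high as possible, up to `k`
  have hch : ∀ k, ∃ a : α → U₀, x (k₀ + k) = ∑ i, op (ι (a i)) • s i ∧
      ∀ n ≤ k, x (k₀ + k) ∈ ball π ι n s → ∃ b : α → U₀, a = π ^ n • b := by
    intro k
    let n := Nat.findGreatest (fun n => x (k₀ + k) ∈ ball π ι n s) k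
    have hn : x (k₀ + k) ∈ ball π ι n s :=
      Nat.findGreatest_spec (P := fun n => x (k₀ + k) ∈ ball π ι n s) (Nat.zero_le k)
        (hk₀ _ (Nat.le_add_right _ _))
    obtain ⟨b, hb⟩ := hn
    refine ⟨π ^ n • b, hb, fun n' hn' hx' => ⟨π ^ (n - n') • b, ?_⟩⟩
    have : n' ≤ n := Nat.le_findGreatest hn' hx'
    rw [smul_smul, ← pow_add, Nat.add_sub_cancel' this]
  choose a ha hdiv using hch
  have hnull : ∀ i, PiNull π fun k => a k i := fun i n => by
    have h1 : ∀ᶠ k in Filter.atTop, x (k₀ + k) ∈ ball π ι n s :=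
      (Filter.tendsto_add_atTop_nat k₀).eventually (hx n) |>.mono fun k hk => by rwa [add_comm]
    filter_upwards [h1, Filter.eventually_ge_atTop n] with k hk hnk
    obtain ⟨b, hb⟩ := hdiv k n hnk hk
    exact ⟨b i, by rw [hb]; rfl⟩
  choose A hA using fun i => h.summable _ (hnull i)
  refine ⟨∑ k ∈ Finset.range k₀, x k + ∑ i, op (ι (A i)) • s i, fun n => ?_⟩
  have hev : ∀ᶠ k in Filter.atTop, ∀ i, ∃ v, A i - ∑ l ∈ Finset.range k, a l i = π ^ n • v :=
    Filter.eventually_all.2 fun i => hA i n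
  obtain ⟨k₁, hk₁⟩ := Filter.eventually_atTop.1 hev
  refine Filter.eventually_atTop.2 ⟨k₀ + k₁, fun k hk => ?_⟩
  obtain ⟨k, rfl⟩ := Nat.exists_eq_add_of_le (le_trans (Nat.le_add_right k₀ k₁) hk)
  choose v hv using hk₁ k (by omega)
  refine ⟨v, ?_⟩
  rw [Finset.sum_range_add, add_sub_add_left_eq_sub]
  simp only [ha, ← hv]
  rw [Finset.sum_comm, ← Finset.sum_sub_distrib]
  refine Finset.sum_congr rfl fun i _ => ?_
  rw [map_sub, MulOpposite.op_sub, sub_smul, map_sum, Finset.op_sum, Finset.sum_smul]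

end CompleteBall

section CompleteBall

variable {R : Type u} [CommRing R] {π : R} {U₀ U : Type u} [Ring U₀] [Algebra R U₀] [Ring U]
  [Algebra R U] {ι : U₀ →ₐ[R] U} {M : Type u} [AddCommGroup M] [Module Uᵐᵒᵖ M]

/-- A null sequence of multiples of `πᵖ` is `πᵖ` times a null sequence. -/
theorem PiNull.exists_div {B : Type u} [AddCommGroup B] [Module R B] {b : ℕ → B}
    (hb : PiNull π b) {p : ℕ} (hp : ∀ k, ∃ v, b k = π ^ p • v) :
    ∃ w : ℕ → B, PiNull π w ∧ ∀ k, b k = π ^ p • w k := by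
  classical
  have hch : ∀ k, ∃ w, b k = π ^ p • w ∧
      ∀ n ≤ k, (∃ v, b k = π ^ (p + n) • v) → ∃ v, w = π ^ n • v := by
    intro k
    let n := Nat.findGreatest (fun n => ∃ v, b k = π ^ (p + n) • v) k
    obtain ⟨v, hv⟩ : ∃ v, b k = π ^ (p + n) • v :=
      Nat.findGreatest_spec (P := fun n => ∃ v, b k = π ^ (p + n) • v) (Nat.zero_le k) (hp k)
    refine ⟨π ^ n • v, by rw [hv, smul_smul, pow_add], fun n' hn' hx' => ⟨π ^ (n - n') • v, ?_⟩⟩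
    have : n' ≤ n := Nat.le_findGreatest hn' hx'
    rw [smul_smul, ← pow_add, Nat.add_sub_cancel' this]
  choose w hw hdiv using hch
  refine ⟨w, fun n => ?_, hw⟩
  filter_upwards [hb (p + n), Filter.eventually_ge_atTop n] with k hk hnk
  exact hdiv k n hnk hk

variable (π ι) in
/-- The sequence `x` in the finitely generated right `U`-module `M` tends to zero in the canonical
topology: it is eventually in `πⁿ ∑ sᵢ U₀` for every `n` and every finite generating family `s`. -/
def NullSeq (x : ℕ → M) : Prop :=
  ∀ (k : ℕ) (s : Fin k → M), Submodule.span Uᵐᵒᵖ (Set.range s) = ⊤ →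
    ∀ n, ∀ᶠ i in Filter.atTop, x i ∈ ball π ι n s

theorem CompleteBall.nullSeq_of_ball (h : CompleteBall π ι) {α : Type*} [Fintype α] (s : α → M)
    {x : ℕ → M} (hx : ∀ n, ∀ᶠ i in Filter.atTop, x i ∈ ball π ι n s) : NullSeq π ι x := by
  intro k t ht n
  obtain ⟨l, hl⟩ := h.exists_ball_le s (t := t) fun i => ht ▸ Submodule.mem_top
  exact (hx (l + n)).mono fun i hi => hl n hi

theorem NullSeq.eventually_mem_ball (h : CompleteBall π ι) [Module.Finite Uᵐᵒᵖ M] {x : ℕ → M}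
    (hx : NullSeq π ι x) {α : Type*} [Fintype α] {s : α → M}
    (hs : Submodule.span Uᵐᵒᵖ (Set.range s) = ⊤) (n : ℕ) :
    ∀ᶠ i in Filter.atTop, x i ∈ ball π ι n s := by
  obtain ⟨k, t, ht⟩ := Module.Finite.exists_fin (R := Uᵐᵒᵖ) (M := M)
  obtain ⟨l, hl⟩ := h.exists_ball_le t (t := s) fun i => hs ▸ Submodule.mem_top
  exact (hx k t ht (l + n)).mono fun i hi => hl n hi

theorem ball_map {M' : Type u} [AddCommGroup M'] [Module Uᵐᵒᵖ M'] (g : M →ₗ[Uᵐᵒᵖ] M')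
    {α : Type*} [Fintype α] {n : ℕ} {s : α → M} {m : M} (hm : m ∈ ball π ι n s) :
    g m ∈ ball π ι n (g ∘ s) := by
  obtain ⟨a, rfl⟩ := hm
  exact ⟨a, by simp only [map_sum, map_smul, Function.comp_apply]⟩

theorem nat_smul_op (k : ℕ) (u : U) (m : M) : op (k • u) • m = k • op u • m := by
  rw [← Nat.cast_smul_eq_nsmul Uᵐᵒᵖ k (op u • m), smul_smul, nsmul_eq_mul, op_mul,
    (Nat.cast_commute k (op u)).eq]
  rfl

end CompleteBall

/-! ### Differential operators in one variable -/

section OreStep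

variable {R : Type u} [CommRing R] (π : R) {V₀ V U₀ U : Type u} [Ring V₀] [Algebra R V₀] [Ring V]
  [Algebra R V] [Ring U₀] [Algebra R U₀] [Ring U] [Algebra R U]

/-- `U` is obtained from `V` by adjoining a derivation `D` with `D x - x D = 1`, where `x` is
central in `V`: the elements of the unit ball `U₀` are the series `∑ vₖ Dᵏ` with `vₖ` in the unit
ball `V₀` tending to zero. The maps `c k` return the coefficients `vₖ`, and `c₀ k` is
their restriction to the unit balls. The sequence `xd k` stands for `xᵏ / k!`. -/
structure OreStep (ιV : V₀ →ₐ[R] V) (ιU : U₀ →ₐ[R] U) (φ₀ : V₀ →ₐ[R] U₀) (φ : V →+* U)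
    (x : V) (xd : ℕ → V) where
  D : U₀
  c₀ : ℕ → U₀ →ₗ[R] V₀
  c : ℕ → U →+ V
  ballV : CompleteBall π ιV
  ballU : CompleteBall π ιU
  map_ι : ∀ v, φ (ιV v) = ιU (φ₀ v)
  central : ∀ v, Commute x v
  comm : ιU D * φ x = φ x * ιU D + 1
  c₀_mul : ∀ k v u, c₀ k (φ₀ v * u) = v * c₀ k u
  c₀_pow : ∀ k j, c₀ k (D ^ j) = if k = j then 1 else 0
  c₀_null : ∀ u, PiNull π fun k => c₀ k u
  c₀_inj : ∀ u, (∀ k, c₀ k u = 0) → u = 0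
  c_mul : ∀ k v u, c k (φ v * u) = v * c k u
  c_ι : ∀ k u, c k (ιU u) = ιV (c₀ k u)
  xd_zero : xd 0 = 1
  xd_succ : ∀ n, (n + 1) • xd (n + 1) = xd n * x
  nat_unit : ∀ n : ℕ, IsUnit ((n + 1 : ℕ) : V)

variable {π} {ιV : V₀ →ₐ[R] V} {ιU : U₀ →ₐ[R] U} {φ₀ : V₀ →ₐ[R] U₀} {φ : V →+* U}
  {x : V} {xd : ℕ → V}

namespace OreStep

theorem map_algebraMap (h : OreStep π ιV ιU φ₀ φ x xd) (r : R) :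
    φ (algebraMap R V r) = algebraMap R U r := by
  rw [← ιV.commutes r, h.map_ι, φ₀.commutes, ιU.commutes]

theorem map_base_smul (h : OreStep π ιV ιU φ₀ φ x xd) (r : R) (v : V) : φ (r • v) = r • φ v := by
  rw [Algebra.smul_def, map_mul, h.map_algebraMap, ← Algebra.smul_def]

theorem c_smul (h : OreStep π ιV ιU φ₀ φ x xd) (k : ℕ) (r : R) (u : U) :
    h.c k (r • u) = r • h.c k u := by
  rw [Algebra.smul_def, ← h.map_algebraMap, h.c_mul, ← Algebra.smul_def]

theorem c_pow (h : OreStep π ιV ιU φ₀ φ x xd) (k j : ℕ) :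
    h.c k (ιU h.D ^ j) = if k = j then 1 else 0 := by
  rw [← map_pow, h.c_ι, h.c₀_pow]
  split_ifs <;> simp

theorem c_one (h : OreStep π ιV ιU φ₀ φ x xd) (k : ℕ) :
    h.c k 1 = if k = 0 then 1 else 0 := by
  rw [← h.c_pow k 0, pow_zero]

theorem c_basis (h : OreStep π ιV ιU φ₀ φ x xd) (k j : ℕ) (v : V) :
    h.c k (φ v * ιU h.D ^ j) = if k = j then v else 0 := by
  rw [h.c_mul, h.c_pow]
  split_ifs <;> simp

/-- Every null sequence in `V₀` is the coefficient sequence of the series `∑ wₖ Dᵏ`. -/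
theorem exists_series (h : OreStep π ιV ιU φ₀ φ x xd) {w : ℕ → V₀} (hw : PiNull π w) :
    ∃ W : U₀, (∀ k, h.c₀ k W = w k) ∧ ∀ n, ∀ᶠ k in Filter.atTop,
      ∃ v, W - ∑ i ∈ Finset.range k, φ₀ (w i) * h.D ^ i = π ^ n • v := by
  obtain ⟨W, hW⟩ := h.ballU.summable (fun i => φ₀ (w i) * h.D ^ i) (fun n => by
    filter_upwards [hw n] with k ⟨v, hv⟩
    exact ⟨φ₀ v * h.D ^ k, by rw [hv, map_smul, smul_mul_assoc]⟩)
  refine ⟨W, fun k => sub_eq_zero.1 (h.ballV.sep _ fun n => ?_), hW⟩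
  obtain ⟨l, ⟨v, hv⟩, hl⟩ := ((hW n).and (Filter.eventually_gt_atTop k)).exists
  refine ⟨h.c₀ k v, ?_⟩
  rw [← map_smul, ← hv, map_sub, map_sum]
  congr 1
  rw [Finset.sum_eq_single k]
  · rw [h.c₀_mul, h.c₀_pow, if_pos rfl, mul_one]
  · intro i _ hi
    rw [h.c₀_mul, h.c₀_pow, if_neg (Ne.symm hi), mul_zero]
  · intro hk
    exact absurd (Finset.mem_range.2 hl) hk

/-- Every element of `U₀` is the sum of its coefficients times powers of `D`. -/
theorem expansion (h : OreStep π ιV ιU φ₀ φ x xd) (u : U₀) (n : ℕ) :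
    ∃ k v, u - ∑ i ∈ Finset.range k, φ₀ (h.c₀ i u) * h.D ^ i = π ^ n • v := by
  obtain ⟨W, hW, hn⟩ := h.exists_series (h.c₀_null u)
  have : u = W := sub_eq_zero.1 (h.c₀_inj _ fun k => by rw [map_sub, hW, sub_self])
  obtain ⟨k, v, hv⟩ := (hn n).exists
  exact ⟨k, v, this ▸ hv⟩

/-- A bounded additive map `U → V` that commutes with powers of `π` is determined by its values on
the products `v Dʲ`. -/
theorem eq_zero_of_basis (h : OreStep π ιV ιU φ₀ φ x xd) (E : U →+ V)
    (hπ : ∀ n u, E (π ^ n • u) = π ^ n • E u)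
    (hb : ∃ t, ∀ u, ∃ v, π ^ t • E (ιU u) = ιV v)
    (h0 : ∀ v j, E (φ v * ιU h.D ^ j) = 0) (u : U) : E u = 0 := by
  obtain ⟨t, ht⟩ := hb
  have key : ∀ u, E (ιU u) = 0 := by
    intro u
    have h1 : π ^ t • E (ιU u) = 0 := by
      refine h.ballV.eq_zero_of_mem_ball (M := V) (fun _ : Unit => 1) fun n => ?_
      obtain ⟨k, v, hv⟩ := h.expansion u n
      obtain ⟨v', hv'⟩ := ht v
      refine ⟨fun _ => v', ?_⟩
      have e : u = ∑ i ∈ Finset.range k, φ₀ (h.c₀ i u) * h.D ^ i + π ^ n • v := by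
        rw [← hv, add_sub_cancel]
      rw [e, map_add, map_smul, map_add, hπ, map_sum, map_sum, Finset.sum_eq_zero, zero_add,
        smul_smul, mul_comm, ← smul_smul, hv']
      · simp
      · intro i _
        rw [map_mul, map_pow, ← h.map_ι, h0]
    exact h.ballV.pow_smul_injective t (by rw [h1, smul_zero])
  obtain ⟨n, v, hv⟩ := h.ballU.surj u
  refine h.ballV.pow_smul_injective n ?_
  rw [← hπ, hv, key, smul_zero]

theorem pow_comm (h : OreStep π ιV ιU φ₀ φ x xd) (j : ℕ) :
    ιU h.D ^ (j + 1) * φ x = φ x * ιU h.D ^ (j + 1) + (j + 1) • ιU h.D ^ j := by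
  induction j with
  | zero => simpa using h.comm
  | succ j ih =>
    rw [pow_succ', mul_assoc, ih, mul_add, ← mul_assoc, h.comm, add_mul, one_mul, mul_assoc,
      mul_smul_comm, ← pow_succ', ← pow_succ', add_assoc]
    congr 1
    rw [add_smul (j + 1) 1, one_smul, add_comm]

/-- Right multiplication by `x` differentiates the coefficients. -/
theorem c_mul_x (h : OreStep π ιV ιU φ₀ φ x xd) (k : ℕ) (u : U) :
    h.c k (u * φ x) = h.c k u * x + (k + 1) • h.c (k + 1) u := by
  let E : U →+ V := (h.c k).comp (AddMonoidHom.mulRight (φ x)) -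
    ((AddMonoidHom.mulRight x).comp (h.c k) + (k + 1) • h.c (k + 1))
  have hE : ∀ u, E u = h.c k (u * φ x) - (h.c k u * x + (k + 1) • h.c (k + 1) u) := fun _ => rfl
  refine sub_eq_zero.1 ((hE u).symm.trans (h.eq_zero_of_basis E ?_ ?_ ?_ u))
  · intro n u
    rw [hE, hE, smul_mul_assoc, h.c_smul, h.c_smul, h.c_smul, smul_sub, smul_add, smul_mul_assoc,
      smul_comm (π ^ n)]
  · obtain ⟨t, x₀, hx₀⟩ := h.ballV.surj x
    refine ⟨t, fun u => ⟨h.c₀ k (u * φ₀ x₀) - (h.c₀ k u * x₀ + (k + 1) • π ^ t • h.c₀ (k + 1) u),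
      ?_⟩⟩
    rw [hE, smul_sub, ← h.c_smul, ← mul_smul_comm, ← h.map_base_smul, hx₀, h.map_ι, ← map_mul,
      h.c_ι, h.c_ι, h.c_ι, smul_add, ← mul_smul_comm, hx₀, map_sub, map_add, map_mul ιV, map_nsmul,
      map_smul, smul_comm (π ^ t)]
  · intro v j
    rw [hE]
    cases j with
    | zero =>
      rw [pow_zero, mul_one, ← map_mul]
      have e : ∀ i w, h.c i (φ w) = if i = 0 then w else 0 := fun i w => by
        simpa using h.c_basis i 0 w
      rw [e, e, e]
      rcases Nat.eq_zero_or_pos k with rfl | hk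
      · simp
      · simp [hk.ne']
    | succ j =>
      rw [mul_assoc, h.pow_comm, mul_add, map_add, ← mul_assoc, ← map_mul, mul_smul_comm,
        map_nsmul, h.c_basis, h.c_basis, h.c_basis, h.c_basis]
      rcases eq_or_ne k j with rfl | hk
      · simp
      · rcases eq_or_ne k (j + 1) with rfl | hk'
        · simp
        · simp [hk, hk']

theorem c_mul_D (h : OreStep π ιV ιU φ₀ φ x xd) (k : ℕ) (u : U) :
    h.c (k + 1) (u * ιU h.D) = h.c k u := by
  let E : U →+ V := (h.c (k + 1)).comp (AddMonoidHom.mulRight (ιU h.D)) - h.c k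
  have hE : ∀ u, E u = h.c (k + 1) (u * ιU h.D) - h.c k u := fun _ => rfl
  refine sub_eq_zero.1 ((hE u).symm.trans (h.eq_zero_of_basis E ?_ ?_ ?_ u))
  · intro n u
    rw [hE, hE, smul_mul_assoc, h.c_smul, h.c_smul, smul_sub]
  · refine ⟨0, fun u => ⟨h.c₀ (k + 1) (u * h.D) - h.c₀ k u, ?_⟩⟩
    rw [hE, pow_zero, one_smul, ← map_mul, h.c_ι, h.c_ι, map_sub]
  · intro v j
    rw [hE, mul_assoc, ← pow_succ, h.c_basis, h.c_basis]
    simp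

theorem c_zero_mul_D (h : OreStep π ιV ιU φ₀ φ x xd) (u : U) :
    h.c 0 (u * ιU h.D) = 0 := by
  let E : U →+ V := (h.c 0).comp (AddMonoidHom.mulRight (ιU h.D))
  have hE : ∀ u, E u = h.c 0 (u * ιU h.D) := fun _ => rfl
  refine (hE u).symm.trans (h.eq_zero_of_basis E ?_ ?_ ?_ u)
  · intro n u
    rw [hE, hE, smul_mul_assoc, h.c_smul]
  · refine ⟨0, fun u => ⟨h.c₀ 0 (u * h.D), ?_⟩⟩
    rw [hE, pow_zero, one_smul, ← map_mul, h.c_ι]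
  · intro v j
    rw [hE, mul_assoc, ← pow_succ, h.c_basis]
    simp

theorem nsmul_injective (h : OreStep π ιV ιU φ₀ φ x xd) {N : Type u} [AddCommGroup N]
    [Module Vᵐᵒᵖ N] (k : ℕ) {n n' : N} (e : (k + 1) • n = (k + 1) • n') : n = n' := by
  have hu : IsUnit (op ((k + 1 : ℕ) : V)) := (h.nat_unit k).op
  refine hu.smul_left_cancel.1 ?_
  have : ∀ m : N, op ((k + 1 : ℕ) : V) • m = (k + 1) • m := fun m => by
    rw [← Nat.cast_smul_eq_nsmul Vᵐᵒᵖ (k + 1) m]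
    rfl
  rw [this, this, e]

theorem xd_mul (h : OreStep π ιV ιU φ₀ φ x xd) (a b : ℕ) :
    xd a * xd b = (a + b).choose a • xd (a + b) := by
  induction b with
  | zero => simp [h.xd_zero]
  | succ b ih =>
    refine h.nsmul_injective (N := V) b ?_
    rw [← mul_smul_comm, h.xd_succ, ← mul_assoc, ih, smul_mul_assoc, ← h.xd_succ, smul_smul,
      smul_smul, add_assoc]
    congr 1
    have := Nat.add_one_mul_choose_eq (a + b) a
    have h2 := Nat.choose_symm_add (a := a) (b := b + 1)
    have h3 := Nat.choose_symm_add (a := a) (b := b)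
    rw [← add_assoc] at h2
    rw [← add_assoc, h2, h3, mul_comm]
    have h4 := Nat.add_one_mul_choose_eq (a + b) b
    rw [h4, mul_comm]

end OreStep

end OreStep

/-! ### Induced modules -/

section IsInduced

variable {V V' U : Type u} [Ring V] [Ring V'] [Ring U]

/-- The additive map `j : N → M` identifies the right `U`-module `M` with `N ⊗_V U`: it has the
universal property of `n ↦ n ⊗ 1`. -/
structure IsInduced (φ : V →+* U) {N M : Type u} [AddCommGroup N] [Module Vᵐᵒᵖ N] [AddCommGroup M]
    [Module Uᵐᵒᵖ M] (j : N →+ M) : Prop where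
  semi : ∀ v n, j (op v • n) = op (φ v) • j n
  gen : Submodule.span Uᵐᵒᵖ (Set.range j) = ⊤
  univ : ∀ (P : Type u) [AddCommGroup P] [Module Uᵐᵒᵖ P] (g : N →+ P),
    (∀ v n, g (op v • n) = op (φ v) • g n) → ∃ h : M →ₗ[Uᵐᵒᵖ] P, ∀ n, h (j n) = g n

variable {N M P : Type u} [AddCommGroup N] [AddCommGroup M] [AddCommGroup P]

/-- The canonical map `N → N ⊗_V U`. -/
def Induced.unit (φ : V →+* U) (N : Type u) [AddCommGroup N] [Module Vᵐᵒᵖ N] : N →+ Induced φ N :=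
  (Submodule.mkQ (tensorRelations φ N)).toAddMonoidHom.comp
    (TensorProduct.mk ℤ U N 1).toAddMonoidHom

theorem Induced.unit_apply (φ : V →+* U) [Module Vᵐᵒᵖ N] (n : N) :
    Induced.unit φ N n = Submodule.Quotient.mk (1 ⊗ₜ n) := rfl

theorem Induced.op_smul_unit (φ : V →+* U) [Module Vᵐᵒᵖ N] (u : U) (n : N) :
    op u • Induced.unit φ N n = Submodule.Quotient.mk (u ⊗ₜ n) := by
  rw [Induced.unit_apply, ← Submodule.Quotient.mk_smul, TensorProduct.smul_tmul', op_smul_eq_mul,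
    one_mul]

theorem Induced.induction (φ : V →+* U) [Module Vᵐᵒᵖ N] {p : Induced φ N → Prop}
    (hadd : ∀ x y, p x → p y → p (x + y)) (h0 : p 0)
    (h : ∀ (u : U) (n : N), p (op u • Induced.unit φ N n)) (x : Induced φ N) : p x := by
  obtain ⟨t, rfl⟩ := Submodule.Quotient.mk_surjective _ x
  induction t using TensorProduct.induction_on with
  | zero => exact h0
  | tmul u n => rw [← Induced.op_smul_unit]; exact h u n
  | add x y hx hy => rw [Submodule.Quotient.mk_add]; exact hadd _ _ hx hy

theorem Induced.unit_semi (φ : V →+* U) [Module Vᵐᵒᵖ N] (v : V) (n : N) :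
    Induced.unit φ N (op v • n) = op (φ v) • Induced.unit φ N n := by
  rw [Induced.op_smul_unit, Induced.unit_apply, eq_comm, Submodule.Quotient.eq]
  exact Submodule.subset_span ⟨1, v, n, by rw [mul_one]⟩

/-- A map to a right `U`-module that is semilinear over `V → U` extends to `N ⊗_V U`. -/
def Induced.desc (φ : V →+* U) [Module Vᵐᵒᵖ N] [Module Uᵐᵒᵖ P] (g : N →+ P)
    (hg : ∀ v n, g (op v • n) = op (φ v) • g n) : Induced φ N →ₗ[Uᵐᵒᵖ] P :=
  Submodule.liftQ _
    { toFun := TensorProduct.lift (LinearMap.mk₂ ℤ (fun (u : U) (n : N) => op u • g n)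
        (fun _ _ _ => by rw [MulOpposite.op_add, add_smul])
        (fun c u n => by
          rw [MulOpposite.op_smul, smul_assoc])
        (fun _ _ _ => by rw [map_add, smul_add])
        (fun c u n => by rw [map_zsmul, smul_comm]))
      map_add' := map_add _
      map_smul' := fun w t => by
        rw [RingHom.id_apply]
        induction t using TensorProduct.induction_on with
        | zero => simp
        | tmul u n =>
          rw [TensorProduct.smul_tmul', TensorProduct.lift.tmul, TensorProduct.lift.tmul]
          change op (u * w.unop) • g n = w • op u • g n
          rw [op_mul, mul_smul, op_unop]
        | add x y hx hy => rw [smul_add, map_add, map_add, smul_add, hx, hy] } (by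
    rw [tensorRelations, Submodule.span_le]
    rintro _ ⟨u, v, n, rfl⟩
    rw [SetLike.mem_coe, LinearMap.mem_ker, map_sub, sub_eq_zero]
    change op (φ v * u) • g n = op u • g (op v • n)
    rw [hg, op_mul, mul_smul])

theorem Induced.desc_unit (φ : V →+* U) [Module Vᵐᵒᵖ N] [Module Uᵐᵒᵖ P] (g : N →+ P)
    (hg : ∀ v n, g (op v • n) = op (φ v) • g n) (n : N) :
    Induced.desc φ g hg (Induced.unit φ N n) = g n := by
  change op (1 : U) • g n = g n
  rw [op_one, one_smul]

theorem Induced.span_unit (φ : V →+* U) (N : Type u) [AddCommGroup N] [Module Vᵐᵒᵖ N] :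
    Submodule.span Uᵐᵒᵖ (Set.range (Induced.unit φ N)) = ⊤ := by
  refine eq_top_iff.2 fun x _ => ?_
  refine Induced.induction φ (fun _ _ => add_mem) (zero_mem _) (fun u n => ?_) x
  exact Submodule.smul_mem _ _ (Submodule.subset_span ⟨n, rfl⟩)

theorem isInduced_unit (φ : V →+* U) (N : Type u) [AddCommGroup N] [Module Vᵐᵒᵖ N] :
    IsInduced φ (Induced.unit φ N) where
  semi := Induced.unit_semi φ
  gen := Induced.span_unit φ N
  univ _ _ _ g hg := ⟨Induced.desc φ g hg, Induced.desc_unit φ g hg⟩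

/-- A left `V`-linear map `c : U → V` induces `n ⊗ u ↦ n c(u)` from `N ⊗_V U` to `N`. -/
theorem Induced.exists_coeff (φ : V →+* U) (N : Type u) [AddCommGroup N] [Module Vᵐᵒᵖ N]
    (c : U →+ V) (hc : ∀ v u, c (φ v * u) = v * c u) :
    ∃ C : Induced φ N →+ N, ∀ u n, C (op u • Induced.unit φ N n) = op (c u) • n := by
  let f : U ⊗[ℤ] N →ₗ[ℤ] N := TensorProduct.lift (LinearMap.mk₂ ℤ (fun (u : U) (n : N) =>
        op (c u) • n)
        (fun _ _ _ => by rw [map_add, MulOpposite.op_add, add_smul])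
        (fun k u n => by
          rw [map_zsmul, MulOpposite.op_smul, smul_assoc])
        (fun _ _ _ => by rw [smul_add])
        (fun k u n => by rw [smul_comm]))
  have hf : ∀ u n, f (u ⊗ₜ n) = op (c u) • n := fun _ _ => rfl
  have hker : ∀ t ∈ tensorRelations φ N, f t = 0 := by
    intro t ht
    -- `c` is not right linear, so the relations are multiplied by `w` before the induction
    suffices ∀ w : Uᵐᵒᵖ, f (w • t) = 0 by simpa using this 1
    induction ht using Submodule.span_induction with
    | mem t ht =>
      obtain ⟨u, v, n, rfl⟩ := ht
      intro w
      rw [smul_sub, TensorProduct.smul_tmul', TensorProduct.smul_tmul', map_sub, hf, hf,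
        sub_eq_zero]
      change op (c (φ v * u * w.unop)) • n = op (c (u * w.unop)) • op v • n
      rw [mul_assoc, hc, op_mul, mul_smul]
    | zero => simp
    | add x y _ _ hx hy => intro w; rw [smul_add, map_add, hx, hy, add_zero]
    | smul a x _ hx => intro w; rw [smul_smul]; exact hx _
  let e := (Submodule.Quotient.restrictScalarsEquiv ℤ (tensorRelations φ N)).symm.toLinearMap
  refine ⟨((((tensorRelations φ N).restrictScalars ℤ).liftQ f hker).comp e).toAddMonoidHom,
    fun u n => ?_⟩
  rw [Induced.op_smul_unit]
  exact hf u n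

namespace IsInduced

variable {φ : V →+* V'} {ψ : V' →+* U} {N' : Type u} [AddCommGroup N'] [Module Vᵐᵒᵖ N]
  [Module V'ᵐᵒᵖ N'] [Module Uᵐᵒᵖ M] {j : N →+ N'} {k : N' →+ M}

/-- Induction in stages. -/
theorem trans (hj : IsInduced φ j) (hk : IsInduced ψ k) : IsInduced (ψ.comp φ) (k.comp j) where
  semi v n := by
    rw [AddMonoidHom.comp_apply, hj.semi, hk.semi]
    rfl
  gen := by
    refine eq_top_iff.2 (hk.gen.symm.trans_le (Submodule.span_le.2 ?_))
    rintro _ ⟨n', rfl⟩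
    have hn' : n' ∈ Submodule.span V'ᵐᵒᵖ (Set.range j) := hj.gen ▸ Submodule.mem_top
    induction hn' using Submodule.span_induction with
    | mem x hx =>
      obtain ⟨n, rfl⟩ := hx
      exact Submodule.subset_span ⟨n, rfl⟩
    | zero => rw [map_zero]; exact zero_mem _
    | add x y _ _ hx hy => rw [map_add]; exact add_mem hx hy
    | smul a x _ hx =>
      have := hk.semi a.unop x
      rw [op_unop] at this
      rw [this]
      exact Submodule.smul_mem _ _ hx
  univ P _ _ g hg := by
    let : Module V'ᵐᵒᵖ P := Module.compHom P (RingHom.op ψ)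
    obtain ⟨g', hg'⟩ := hj.univ P g hg
    obtain ⟨h, hh⟩ := hk.univ P g'.toAddMonoidHom (fun v n => g'.map_smul (op v) n)
    exact ⟨h, fun n => (hh (j n)).trans (hg' n)⟩

/-- If `N → N'` is induced along `φ` and `N → M` is induced along `ψ ∘ φ`, then `N → M` factors
through a map `N' → M` that is induced along `ψ`. -/
theorem exists_factor (hj : IsInduced φ j) {l : N →+ M} (hl : IsInduced (ψ.comp φ) l) :
    ∃ k : N' →+ M, IsInduced ψ k ∧ k.comp j = l := by
  obtain ⟨k, hk⟩ : ∃ k : N' →+ M, (∀ v n, k (op v • n) = op (ψ v) • k n) ∧ k.comp j = l := by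
    let : Module V'ᵐᵒᵖ M := Module.compHom M (RingHom.op ψ)
    obtain ⟨g', hg'⟩ := hj.univ M l hl.semi
    exact ⟨g'.toAddMonoidHom, fun v n => g'.map_smul (op v) n, AddMonoidHom.ext hg'⟩
  have hkj : ∀ n, k (j n) = l n := fun n => DFunLike.congr_fun hk.2 n
  refine ⟨k, ⟨hk.1, ?_, fun P _ _ g hg => ?_⟩, hk.2⟩
  · refine eq_top_iff.2 (hl.gen.symm.trans_le (Submodule.span_mono ?_))
    rintro _ ⟨n, rfl⟩
    exact ⟨j n, hkj n⟩
  · obtain ⟨h, hh⟩ := hl.univ P (g.comp j) (fun v n => by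
      rw [AddMonoidHom.comp_apply, hj.semi, hg]
      rfl)
    refine ⟨h, fun n' => ?_⟩
    have hn' : n' ∈ Submodule.span V'ᵐᵒᵖ (Set.range j) := hj.gen ▸ Submodule.mem_top
    induction hn' using Submodule.span_induction with
    | mem x hx =>
      obtain ⟨n, rfl⟩ := hx
      rw [hkj, hh]
      rfl
    | zero => simp
    | add x y _ _ hx hy => rw [map_add, map_add, map_add, hx, hy]
    | smul a x _ hx =>
      have h1 := hk.1 a.unop x
      have h2 := hg a.unop x
      rw [op_unop] at h1 h2
      rw [h1, h2, map_smul, hx]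

/-- `M` is induced from `N` as soon as the canonical map `N ⊗_V U → M` is bijective. -/
theorem of_bijective {l : N →+ M} {φ : V →+* U} (hl : ∀ v n, l (op v • n) = op (φ v) • l n)
    (hbij : Function.Bijective (Induced.desc φ l hl)) : IsInduced φ l where
  semi := hl
  gen := by
    refine eq_top_iff.2 fun m _ => ?_
    obtain ⟨x, rfl⟩ := hbij.2 m
    refine Induced.induction φ (p := fun x => Induced.desc φ l hl x ∈ _)
      (fun x y hx hy => ?_) ?_ (fun u n => ?_) x
    · rw [map_add]; exact add_mem hx hy
    · rw [map_zero]; exact zero_mem _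
    · rw [map_smul, Induced.desc_unit]
      exact Submodule.smul_mem _ _ (Submodule.subset_span ⟨n, rfl⟩)
  univ P _ _ g hg := by
    let e := LinearEquiv.ofBijective _ hbij
    refine ⟨(Induced.desc φ g hg).comp e.symm.toLinearMap, fun n => ?_⟩
    have : e.symm (l n) = Induced.unit φ N n := by
      rw [LinearEquiv.symm_apply_eq]
      exact (Induced.desc_unit φ l hl n).symm
    rw [LinearMap.comp_apply, LinearEquiv.coe_coe, this, Induced.desc_unit]

theorem bijective_desc {l : N →+ M} {φ : V →+* U} (hl : IsInduced φ l) :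
    Function.Bijective (Induced.desc φ l hl.semi) := by
  obtain ⟨h, hh⟩ := hl.univ (Induced φ N) (Induced.unit φ N) (Induced.unit_semi φ)
  constructor
  · refine Function.LeftInverse.injective (g := h) fun x => ?_
    refine Induced.induction φ (p := fun x => h (Induced.desc φ l hl.semi x) = x)
      (fun x y hx hy => ?_) ?_ (fun u n => ?_) x
    · rw [map_add, map_add, hx, hy]
    · simp
    · rw [map_smul, map_smul, Induced.desc_unit, hh]
  · rw [← LinearMap.range_eq_top, ← top_le_iff, ← hl.gen, Submodule.span_le]
    rintro _ ⟨n, rfl⟩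
    exact ⟨Induced.unit φ N n, Induced.desc_unit φ l hl.semi n⟩

/-- A module induced from a finitely generated module is finitely generated. -/
theorem finite {l : N →+ M} {φ : V →+* U} (hl : IsInduced φ l) [Module.Finite Vᵐᵒᵖ N] :
    Module.Finite Uᵐᵒᵖ M := by
  obtain ⟨k, s, hs⟩ := Module.Finite.exists_fin (R := Vᵐᵒᵖ) (M := N)
  refine ⟨Submodule.fg_def.2 ⟨Set.range (l ∘ s), Set.finite_range _, ?_⟩⟩
  rw [← top_le_iff, ← hl.gen, Submodule.span_le]
  rintro _ ⟨n, rfl⟩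
  have hn : n ∈ Submodule.span Vᵐᵒᵖ (Set.range s) := hs ▸ Submodule.mem_top
  induction hn using Submodule.span_induction with
  | mem x hx =>
    obtain ⟨i, rfl⟩ := hx
    exact Submodule.subset_span ⟨i, rfl⟩
  | zero => rw [map_zero]; exact zero_mem _
  | add x y _ _ hx hy => rw [map_add]; exact add_mem hx hy
  | smul a x _ hx =>
    have h1 := hl.semi a.unop x
    rw [op_unop] at h1
    rw [h1]
    exact Submodule.smul_mem _ _ hx

end IsInduced

end IsInduced

/-! ### Modules induced along a ring of differential operators -/

theorem IsInduced.induction {V U N M : Type u} [Ring V] [Ring U] [AddCommGroup N] [AddCommGroup M]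
    [Module Vᵐᵒᵖ N] [Module Uᵐᵒᵖ M] {φ : V →+* U} {j : N →+ M} (hj : IsInduced φ j) {p : M → Prop}
    (hadd : ∀ x y, p x → p y → p (x + y)) (h0 : p 0) (h : ∀ (u : U) (n : N), p (op u • j n))
    (m : M) : p m := by
  obtain ⟨x, rfl⟩ := hj.bijective_desc.2 m
  refine Induced.induction φ (p := fun x => p (Induced.desc φ j hj.semi x)) (fun x y hx hy => ?_) ?_
    (fun u n => ?_) x
  · rw [map_add]; exact hadd _ _ hx hy
  · rw [map_zero]; exact h0
  · rw [map_smul, Induced.desc_unit]; exact h u n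

section OreModule

variable {R : Type u} [CommRing R] {π : R} {V₀ V U₀ U : Type u} [Ring V₀] [Algebra R V₀] [Ring V]
  [Algebra R V] [Ring U₀] [Algebra R U₀] [Ring U] [Algebra R U]
  {ιV : V₀ →ₐ[R] V} {ιU : U₀ →ₐ[R] U} {φ₀ : V₀ →ₐ[R] U₀} {φ : V →+* U} {x : V} {xd : ℕ → V}
  {N M : Type u} [AddCommGroup N] [AddCommGroup M] [Module Vᵐᵒᵖ N] [Module Uᵐᵒᵖ M]

namespace OreStep

/-- The map `C k` returns the `k`-th coefficient of the elements `∑ nₖ ⊗ Dᵏ` of the induced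
module. -/
def IsCoeff (h : OreStep π ιV ιU φ₀ φ x xd) (j : N →+ M) (C : ℕ → M →+ N) : Prop :=
  ∀ k u n, C k (op u • j n) = op (h.c k u) • n

theorem exists_isCoeff (h : OreStep π ιV ιU φ₀ φ x xd) {j : N →+ M} (hj : IsInduced φ j) :
    ∃ C, h.IsCoeff j C := by
  choose C hC using fun k => Induced.exists_coeff φ N (h.c k) (h.c_mul k)
  obtain ⟨g, hg⟩ := hj.univ (Induced φ N) (Induced.unit φ N) (Induced.unit_semi φ)
  refine ⟨fun k => (C k).comp g.toAddMonoidHom, fun k u n => ?_⟩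
  change C k (g _) = _
  rw [map_smul, hg, hC]

variable {h : OreStep π ιV ιU φ₀ φ x xd} {j : N →+ M} {C : ℕ → M →+ N}

namespace IsCoeff

theorem apply_j (hC : h.IsCoeff j C) (k : ℕ) (n : N) : C k (j n) = if k = 0 then n else 0 := by
  have := hC k 1 n
  rw [op_one, one_smul, h.c_one] at this
  rw [this]
  split_ifs <;> simp

/-- If `x` kills `N`, it acts on `∑ nₖ ⊗ Dᵏ` as the derivative with respect to `D`. -/
theorem apply_x (hC : h.IsCoeff j C) (hj : IsInduced φ j) (hx : ∀ n : N, op x • n = 0) (k : ℕ)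
    (m : M) : C k (op (φ x) • m) = (k + 1) • C (k + 1) m := by
  refine hj.induction (p := fun m => C k (op (φ x) • m) = (k + 1) • C (k + 1) m)
    (fun m m' hm hm' => ?_) ?_ (fun u n => ?_) m
  · rw [smul_add, map_add, map_add, hm, hm', smul_add]
  · simp
  · rw [smul_smul, ← op_mul, hC, hC, h.c_mul_x, MulOpposite.op_add, add_smul, op_mul, mul_smul,
      ← nat_smul_op, smul_smul, ← op_mul,
      ← (h.central _).eq, op_mul, mul_smul, hx, smul_zero, zero_add]

theorem apply_xd (hC : h.IsCoeff j C) (hj : IsInduced φ j) (hx : ∀ n : N, op x • n = 0) (b k : ℕ)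
    (m : M) : C k (op (φ (xd b)) • m) = (b + k).choose b • C (b + k) m := by
  induction b generalizing k with
  | zero => simp [h.xd_zero]
  | succ b ih =>
    refine h.nsmul_injective b ?_
    rw [← map_nsmul, ← nat_smul_op, ← map_nsmul, h.xd_succ, map_mul, op_mul, mul_smul,
      hC.apply_x hj hx, ih, smul_smul, smul_smul, Nat.add_right_comm b 1 k, ← add_assoc]
    congr 1
    have h1 := Nat.add_one_mul_choose_eq (b + k) b
    have h2 := Nat.choose_succ_right_eq (b + k + 1) b
    rw [mul_comm, mul_comm (b + 1), h2]
    have h3 : b + k + 1 - b = k + 1 := by omega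
    rw [h3]

theorem apply_D (hC : h.IsCoeff j C) (hj : IsInduced φ j) (b k : ℕ) (m : M) :
    C k (op (ιU h.D ^ b) • m) = if b ≤ k then C (k - b) m else 0 := by
  have h1 : ∀ k m, C (k + 1) (op (ιU h.D) • m) = C k m := by
    intro k m
    refine hj.induction (p := fun m => C (k + 1) (op (ιU h.D) • m) = C k m)
      (fun m m' hm hm' => ?_) ?_ (fun u n => ?_) m
    · rw [smul_add, map_add, map_add, hm, hm']
    · simp
    · rw [smul_smul, ← op_mul, hC, hC, h.c_mul_D]
  have h0 : ∀ m, C 0 (op (ιU h.D) • m) = 0 := by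
    intro m
    refine hj.induction (p := fun m => C 0 (op (ιU h.D) • m) = 0) (fun m m' hm hm' => ?_) ?_
      (fun u n => ?_) m
    · rw [smul_add, map_add, hm, hm', add_zero]
    · simp
    · rw [smul_smul, ← op_mul, hC, h.c_zero_mul_D, op_zero, zero_smul]
  induction b generalizing k with
  | zero => simp
  | succ b ih =>
    rw [pow_succ, op_mul, mul_smul]
    cases k with
    | zero => rw [h0, if_neg (by omega)]
    | succ k =>
      rw [h1, ih]
      simp

theorem apply_pi (hC : h.IsCoeff j C) (hj : IsInduced φ j) (k : ℕ) (r : R) (m : M) :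
    C k (op (algebraMap R U r) • m) = op (algebraMap R V r) • C k m := by
  refine hj.induction (p := fun m => C k (op (algebraMap R U r) • m) =
      op (algebraMap R V r) • C k m) (fun m m' hm hm' => ?_) ?_ (fun u n => ?_) m
  · rw [smul_add, map_add, map_add, hm, hm', smul_add]
  · simp
  · rw [← op_algebraMap_smul, hC, hC, h.c_smul, op_algebraMap_smul]

theorem apply_sum (hC : h.IsCoeff j C) {α : Type*} [Fintype α] (u : α → U₀) (n : α → N) (k : ℕ) :
    C k (∑ i, op (ιU (u i)) • j (n i)) = ∑ i, op (ιV (h.c₀ k (u i))) • n i := by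
  simp only [map_sum, hC k, h.c_ι]

end IsCoeff

/-- An element of an induced module becomes, after multiplication by a power of `π`, a finite sum
of integral multiples of elements of `N`. -/
theorem exists_integral (h : OreStep π ιV ιU φ₀ φ x xd) (hj : IsInduced φ j) (m : M) :
    ∃ (k t : ℕ) (n : Fin k → N) (u : Fin k → U₀),
      op (algebraMap R U (π ^ t)) • m = ∑ i, op (ιU (u i)) • j (n i) := by
  have hm : m ∈ Submodule.span Uᵐᵒᵖ (Set.range j) := hj.gen ▸ Submodule.mem_top
  obtain ⟨T, hT, hmT⟩ := Submodule.mem_span_finite_of_mem_span hm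
  choose n hn using fun i : Fin T.card => hT (T.equivFin.symm i).2
  have hrange : Set.range (fun i => j (n i)) = T := by
    ext y
    constructor
    · rintro ⟨i, rfl⟩
      simp only [hn]
      exact (T.equivFin.symm i).2
    · intro hy
      exact ⟨T.equivFin ⟨y, hy⟩, by simp [hn]⟩
  rw [← hrange] at hmT
  obtain ⟨t, u, hu⟩ := h.ballU.exists_smul_mem_ball hmT
  exact ⟨_, t, n, u, by simpa only [pow_zero, one_smul] using hu⟩

/-- An element of an induced module is determined by its coefficients. The proof uses that the
relations between finitely many elements of `N` form a finitely generated module, so that a null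
sequence of relations is a combination of finitely many relations with null sequences as
coefficients. -/
theorem IsCoeff.eq_zero (hC : h.IsCoeff j C) (hj : IsInduced φ j) {m : M} (hm : ∀ k, C k m = 0) :
    m = 0 := by
  obtain ⟨l, t, n, u, hu⟩ := h.exists_integral hj m
  suffices op (algebraMap R U (π ^ t)) • m = 0 from
    (h.ballU.isUnit_op t).smul_left_cancel.1 (this.trans (smul_zero _).symm)
  rw [hu]
  have hcoef : ∀ k, ∑ i, op (ιV (h.c₀ k (u i))) • n i = 0 := fun k => by
    rw [← hC.apply_sum, ← hu, hC.apply_pi hj, hm, smul_zero]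
  let ev : (Fin l → V₀) → N := fun a => ∑ i, op (ιV (a i)) • n i
  have ev_smul : ∀ t a, ev (π ^ t • a) = op (algebraMap R V (π ^ t)) • ev a := fun t a => by
    simp only [ev, Finset.smul_sum, ← op_algebraMap_smul, ← map_smul, Pi.smul_apply]
  let Q : Submodule V₀ᵐᵒᵖ (Fin l → V₀) :=
    { carrier := {a | ev a = 0}
      zero_mem' := by simp [ev]
      add_mem' := fun {a b} ha hb => by
        have e : ev (a + b) = ev a + ev b := by simp [ev, add_smul, Finset.sum_add_distrib]
        rw [Set.mem_ofPred_eq] at *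
        rw [e, ha, hb, add_zero]
      smul_mem' := fun u a ha => by
        have e : ev (u • a) = op (ιV u.unop) • ev a := by
          simp only [ev, Finset.smul_sum]
          refine Finset.sum_congr rfl fun i _ => ?_
          rw [smul_smul, ← op_mul, ← map_mul]
          rfl
        rw [Set.mem_ofPred_eq] at *
        rw [e, ha, smul_zero] }
  have hsat : ∀ t a, π ^ t • a ∈ Q → a ∈ Q := fun t a ha => by
    have h1 : ev (π ^ t • a) = 0 := ha
    rw [ev_smul] at h1
    exact (h.ballV.isUnit_op t).smul_left_cancel.1 (h1.trans (smul_zero _).symm)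
  obtain ⟨q, κ, hκ, hgen⟩ := h.ballV.exists_generators Q fun a ha =>
    hsat 1 a (by rwa [pow_one])
  have hnull : PiNull π fun k => (fun i => h.c₀ k (u i) : Fin l → V₀) := fun p => by
    have : ∀ᶠ k in Filter.atTop, ∀ i, ∃ v, h.c₀ k (u i) = π ^ p • v :=
      Filter.eventually_all.2 fun i => h.c₀_null (u i) p
    filter_upwards [this] with k hk
    choose v hv using hk
    exact ⟨v, funext hv⟩
  -- write the `k`-th relation as `πᵖ` times a combination of the `κ`, with `p ≤ k` maximal
  have hch : ∀ k, ∃ w : Fin q → V₀, (∀ i, h.c₀ k (u i) = ∑ e, κ e i * w e) ∧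
      ∀ p ≤ k, (∃ v : Fin l → V₀, (fun i => h.c₀ k (u i)) = π ^ p • v) → ∃ w', w = π ^ p • w' := by
    classical
    intro k
    let P : ℕ → Prop := fun p => ∃ v : Fin l → V₀, (fun i => h.c₀ k (u i)) = π ^ p • v
    obtain ⟨v, hv⟩ : P (Nat.findGreatest P k) :=
      Nat.findGreatest_spec (P := P) (Nat.zero_le k) ⟨fun i => h.c₀ k (u i), by simp⟩
    have hvQ : v ∈ Q := hsat (Nat.findGreatest P k) v (by rw [← hv]; exact hcoef k)
    obtain ⟨w, hw⟩ := hgen v hvQ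
    refine ⟨π ^ Nat.findGreatest P k • w, fun i => ?_, fun p hp hv' =>
      ⟨π ^ (Nat.findGreatest P k - p) • w, ?_⟩⟩
    · rw [show h.c₀ k (u i) = _ from congrFun hv i, Pi.smul_apply, hw, Finset.smul_sum]
      exact Finset.sum_congr rfl fun e _ => (mul_smul_comm _ _ _).symm
    · rw [smul_smul, ← pow_add, Nat.add_sub_cancel' (Nat.le_findGreatest hp hv')]
  choose w hw hwdiv using hch
  have hwnull : ∀ e, PiNull π fun k => w k e := fun e p => by
    filter_upwards [hnull p, Filter.eventually_ge_atTop p] with k hk hpk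
    obtain ⟨w', hw'⟩ := hwdiv k p hpk hk
    exact ⟨w' e, congrFun hw' e⟩
  choose W hW _ using fun e => h.exists_series (hwnull e)
  have huW : ∀ i, u i = ∑ e, φ₀ (κ e i) * W e := fun i => by
    refine sub_eq_zero.1 (h.c₀_inj _ fun k => ?_)
    rw [map_sub, map_sum, hw, sub_eq_zero]
    exact Finset.sum_congr rfl fun e _ => by rw [h.c₀_mul, hW]
  have hκ' : ∀ e, ∑ i, op (ιU (φ₀ (κ e i))) • j (n i) = 0 := fun e => by
    have h1 : ev (κ e) = 0 := hκ e
    have h2 := congrArg j h1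
    rw [map_sum, map_zero] at h2
    rw [← h2]
    exact Finset.sum_congr rfl fun i _ => by rw [hj.semi, h.map_ι]
  calc ∑ i, op (ιU (u i)) • j (n i)
      = ∑ i, ∑ e, op (ιU (W e)) • op (ιU (φ₀ (κ e i))) • j (n i) := by
        refine Finset.sum_congr rfl fun i _ => ?_
        rw [huW, map_sum, Finset.op_sum, Finset.sum_smul]
        exact Finset.sum_congr rfl fun e _ => by rw [map_mul, op_mul, mul_smul]
    _ = 0 := by
        rw [Finset.sum_comm]
        refine Finset.sum_eq_zero fun e _ => ?_
        rw [← Finset.smul_sum, hκ', smul_zero]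

/-- If the coefficients of `m` are combinations of the `n i` with null sequences of multiples of
`πᵖ` as coefficients, then `m` lies in `πᵖ ∑ nᵢ U₀`. -/
theorem IsCoeff.mem_ball (hC : h.IsCoeff j C) (hj : IsInduced φ j) {α : Type*} [Fintype α]
    (n : α → N) (w : α → ℕ → V₀) (hw : ∀ i, PiNull π (w i)) {p : ℕ}
    (hp : ∀ i k, ∃ v, w i k = π ^ p • v) {m : M}
    (hm : ∀ k, C k m = ∑ i, op (ιV (w i k)) • n i) : m ∈ ball π ιU p (j ∘ n) := by
  choose w' hw' hww' using fun i => (hw i).exists_div (hp i)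
  choose W hW _ using fun i => h.exists_series (hw' i)
  refine ⟨W, sub_eq_zero.1 (hC.eq_zero hj fun k => ?_)⟩
  rw [map_sub, Function.comp_def, hC.apply_sum, hm, sub_eq_zero]
  refine Finset.sum_congr rfl fun i _ => ?_
  rw [map_smul (h.c₀ k), hW, hww']

/-- The kernel of `x` in the induced module `N ⊗ U` is `N`, if `x` kills `N`. -/
theorem mem_range_iff (h : OreStep π ιV ιU φ₀ φ x xd) (hj : IsInduced φ j)
    (hx : ∀ n : N, op x • n = 0) (m : M) : (∃ n, j n = m) ↔ op (φ x) • m = 0 := by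
  obtain ⟨C, hC⟩ := h.exists_isCoeff hj
  constructor
  · rintro ⟨n, rfl⟩
    rw [← hj.semi, hx, map_zero]
  · intro hm
    refine ⟨C 0 m, sub_eq_zero.1 (hC.eq_zero hj fun k => ?_)⟩
    rw [map_sub, hC.apply_j]
    cases k with
    | zero => simp
    | succ k =>
      rw [if_neg (by omega), zero_sub, neg_eq_zero]
      refine h.nsmul_injective k ?_
      rw [← hC.apply_x hj hx, hm, map_zero, smul_zero]

theorem injective_of_isInduced (h : OreStep π ιV ιU φ₀ φ x xd) (hj : IsInduced φ j) :
    Function.Injective j := by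
  obtain ⟨C, hC⟩ := h.exists_isCoeff hj
  refine Function.LeftInverse.injective (g := C 0) fun n => ?_
  rw [hC.apply_j, if_pos rfl]

/-- The divided powers of `x` tend to zero on a module induced from a finitely generated module
killed by `x`. -/
theorem nullSeq_of_isInduced (h : OreStep π ιV ιU φ₀ φ x xd) (hj : IsInduced φ j)
    [Module.Finite Vᵐᵒᵖ N] (hx : ∀ n : N, op x • n = 0) (m : M) :
    NullSeq π ιU fun n => op (φ (xd n)) • m := by
  obtain ⟨C, hC⟩ := h.exists_isCoeff hj
  obtain ⟨l, t, n, u, hu⟩ := h.exists_integral hj m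
  refine h.ballU.nullSeq_of_ball (j ∘ n) fun p => ?_
  have hev : ∀ᶠ k in Filter.atTop, ∀ i, ∃ v, h.c₀ k (u i) = π ^ (t + p) • v :=
    Filter.eventually_all.2 fun i => h.c₀_null (u i) _
  obtain ⟨k₀, hk₀⟩ := Filter.eventually_atTop.1 hev
  refine Filter.eventually_atTop.2 ⟨k₀, fun b hb => ?_⟩
  refine h.ballU.mem_ball_of_smul (k := t) ?_
  have e : op (algebraMap R U (π ^ t)) • op (φ (xd b)) • m =
      op (φ (xd b)) • ∑ i, op (ιU (u i)) • j (n i) := by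
    rw [← hu, ← op_algebraMap_smul, op_algebraMap_smul']
  rw [e]
  refine hC.mem_ball hj n (fun i k => (b + k).choose b • h.c₀ (b + k) (u i)) (fun i q => ?_)
    (fun i k => ?_) fun k => ?_
  · have := (Filter.tendsto_add_atTop_nat b).eventually (h.c₀_null (u i) q)
    filter_upwards [this] with k ⟨v, hv⟩
    refine ⟨(b + k).choose b • v, ?_⟩
    rw [add_comm b k, hv, smul_comm]
  · obtain ⟨v, hv⟩ := hk₀ (b + k) (by omega) i
    exact ⟨(b + k).choose b • v, by rw [hv, smul_comm]⟩
  · rw [hC.apply_xd hj hx, hC.apply_sum, Finset.smul_sum]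
    exact Finset.sum_congr rfl fun i _ => by rw [map_nsmul, nat_smul_op]

/-- A sequence in `N` that tends to zero in the induced module tends to zero in `N`. -/
theorem nullSeq_descend (h : OreStep π ιV ιU φ₀ φ x xd) (hj : IsInduced φ j)
    [Module.Finite Vᵐᵒᵖ N] {y : ℕ → N} (hy : NullSeq π ιU fun n => j (y n)) : NullSeq π ιV y := by
  obtain ⟨C, hC⟩ := h.exists_isCoeff hj
  have := hj.finite
  obtain ⟨k, s, hs⟩ := Module.Finite.exists_fin (R := Vᵐᵒᵖ) (M := N)
  have hjs : Submodule.span Uᵐᵒᵖ (Set.range (j ∘ s)) = ⊤ := by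
    rw [← top_le_iff, ← hj.gen, Submodule.span_le]
    rintro _ ⟨n, rfl⟩
    have hn : n ∈ Submodule.span Vᵐᵒᵖ (Set.range s) := hs ▸ Submodule.mem_top
    obtain ⟨c, rfl⟩ := (Submodule.mem_span_range_iff_exists_fun _).1 hn
    rw [map_sum]
    refine sum_mem fun i _ => ?_
    rw [← op_unop (c i), hj.semi]
    exact Submodule.smul_mem _ _ (Submodule.subset_span ⟨i, rfl⟩)
  refine h.ballV.nullSeq_of_ball s fun p => ?_
  filter_upwards [hy k (j ∘ s) hjs p] with i hi
  obtain ⟨a, ha⟩ := hi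
  refine ⟨fun i => h.c₀ 0 (a i), ?_⟩
  have h1 := congrArg (C 0) ha
  rw [hC.apply_j, if_pos rfl] at h1
  rw [h1, Function.comp_def, hC.apply_sum]
  exact Finset.sum_congr rfl fun i _ => by rw [map_smul (h.c₀ 0)]

end OreStep

end OreModule

/-! ### The Taylor expansion -/

section OreCounit

variable {R : Type u} [CommRing R] {π : R} {V₀ V U₀ U : Type u} [Ring V₀] [Algebra R V₀] [Ring V]
  [Algebra R V] [Ring U₀] [Algebra R U₀] [Ring U] [Algebra R U]
  {ιV : V₀ →ₐ[R] V} {ιU : U₀ →ₐ[R] U} {φ₀ : V₀ →ₐ[R] U₀} {φ : V →+* U} {x : V} {xd : ℕ → V}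
  {N M M' : Type u} [AddCommGroup N] [AddCommGroup M] [AddCommGroup M'] [Module Vᵐᵒᵖ N]
  [Module Uᵐᵒᵖ M] [Module Uᵐᵒᵖ M']

namespace OreStep

/-- The partial sums of the series `∑ (-1)ᵇ m xᵇ/b! Dᵇ`, which projects `M` onto the kernel of
`x`. -/
def truncProj (h : OreStep π ιV ιU φ₀ φ x xd) (B : ℕ) (m : M) : M :=
  ∑ b ∈ Finset.range B, ((-1 : ℤ) ^ b) • op (ιU h.D ^ b) • op (φ (xd b)) • m

theorem map_truncProj (h : OreStep π ιV ιU φ₀ φ x xd) (B : ℕ) (g : M →ₗ[Uᵐᵒᵖ] M') (m : M) :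
    g (h.truncProj B m) = h.truncProj B (g m) := by
  simp only [truncProj, map_sum, map_zsmul, map_smul]

theorem truncProj_zero (h : OreStep π ιV ιU φ₀ φ x xd) (B : ℕ) : h.truncProj B (0 : M) = 0 := by
  simp [truncProj]

/-- The truncated projection multiplies the `k`-th coefficient by a partial alternating sum of
binomial coefficients, which is complete, hence zero for `k ≠ 0`, once `k < B`. -/
theorem IsCoeff.apply_truncProj {h : OreStep π ιV ιU φ₀ φ x xd} {j : N →+ M} {C : ℕ → M →+ N}
    (hC : h.IsCoeff j C) (hj : IsInduced φ j) (hx : ∀ n : N, op x • n = 0) (B k : ℕ) (m : M) :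
    C k (h.truncProj B m) = (∑ b ∈ Finset.range B, (-1 : ℤ) ^ b * (k.choose b : ℤ)) • C k m := by
  rw [truncProj, map_sum, Finset.sum_smul]
  refine Finset.sum_congr rfl fun b _ => ?_
  rw [map_zsmul, hC.apply_D hj, mul_smul]
  congr 1
  split_ifs with hb
  · rw [hC.apply_xd hj hx, Nat.add_sub_cancel' hb, natCast_zsmul]
  · rw [Nat.choose_eq_zero_of_lt (not_le.1 hb), Nat.cast_zero, zero_smul]

theorem sum_choose_of_lt {B k : ℕ} (hk : k < B) :
    ∑ b ∈ Finset.range B, (-1 : ℤ) ^ b * (k.choose b : ℤ) = if k = 0 then 1 else 0 := by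
  rw [← Int.alternating_sum_range_choose]
  symm
  refine Finset.sum_subset (Finset.range_mono hk) fun b _ hb => ?_
  rw [Nat.choose_eq_zero_of_lt (by simpa using hb), Nat.cast_zero, mul_zero]

/-- On an induced module, the truncated projections tend to the coefficient `C 0`. -/
theorem IsCoeff.truncProj_sub_mem_ball {h : OreStep π ιV ιU φ₀ φ x xd} {j : N →+ M}
    {C : ℕ → M →+ N} (hC : h.IsCoeff j C) (hj : IsInduced φ j) (hx : ∀ n : N, op x • n = 0)
    {l : ℕ} (n : Fin l → N) (u : Fin l → U₀) (p : ℕ) :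
    ∃ B, h.truncProj B (∑ i, op (ιU (u i)) • j (n i)) -
      j (C 0 (∑ i, op (ιU (u i)) • j (n i))) ∈ ball π ιU p (j ∘ n) := by
  have hev : ∀ᶠ k in Filter.atTop, ∀ i, ∃ v, h.c₀ k (u i) = π ^ p • v :=
    Filter.eventually_all.2 fun i => h.c₀_null (u i) _
  obtain ⟨B, hB⟩ := Filter.eventually_atTop.1 hev
  refine ⟨B + 1, ?_⟩
  let z : ℕ → ℤ := fun k => ∑ b ∈ Finset.range (B + 1), (-1 : ℤ) ^ b * (k.choose b : ℤ)
  refine hC.mem_ball hj n (fun i k => if k < B + 1 then 0 else z k • h.c₀ k (u i))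
    (fun i q => ?_) (fun i k => ?_) fun k => ?_
  · filter_upwards [h.c₀_null (u i) q] with k ⟨v, hv⟩
    rw [hv]
    split_ifs
    · exact ⟨0, by simp⟩
    · exact ⟨z k • v, by rw [smul_comm]⟩
  · split_ifs with hk
    · exact ⟨0, by simp⟩
    · obtain ⟨v, hv⟩ := hB k (by omega) i
      exact ⟨z k • v, by rw [hv, smul_comm]⟩
  · rw [map_sub, hC.apply_truncProj hj hx, hC.apply_j]
    split_ifs with h0 hk hk
    · subst h0
      rw [sum_choose_of_lt hk]
      simp
    · omega
    · rw [sum_choose_of_lt hk, if_neg h0]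
      simp
    · rw [sub_zero, hC.apply_sum, Finset.smul_sum]
      refine Finset.sum_congr rfl fun i _ => ?_
      rw [map_zsmul, MulOpposite.op_smul, smul_assoc]

/-- Let `N ⊆ M` be killed by `x`. The map `N ⊗ U → M` is injective: if `m` maps to zero, then so
do the truncated projections of `m`, whose limit is the constant coefficient of `m`. -/
theorem injective_desc (h : OreStep π ιV ιU φ₀ φ x xd) {j' : N →+ M'} (hj' : IsInduced φ j')
    {j : N →+ M} (hinj : Function.Injective j) (hx : ∀ n : N, op x • n = 0)
    (g : M' →ₗ[Uᵐᵒᵖ] M) (hg : ∀ n, g (j' n) = j n) : Function.Injective g := by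
  obtain ⟨C, hC⟩ := h.exists_isCoeff hj'
  rw [injective_iff_map_eq_zero]
  have key : ∀ m, g m = 0 → C 0 m = 0 := by
    intro m hm
    obtain ⟨l, t, n, u, hu⟩ := h.exists_integral hj' m
    have h1 : g (∑ i, op (ιU (u i)) • j' (n i)) = 0 := by rw [← hu, map_smul, hm, smul_zero]
    suffices C 0 (op (algebraMap R U (π ^ t)) • m) = 0 by
      rw [hC.apply_pi hj'] at this
      exact (h.ballV.isUnit_op t).smul_left_cancel.1 (this.trans (smul_zero _).symm)
    rw [hu]
    refine hinj ?_
    rw [map_zero]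
    refine h.ballU.eq_zero_of_mem_ball (j ∘ n) fun p => ?_
    obtain ⟨B, hB⟩ := hC.truncProj_sub_mem_ball hj' hx n u p
    have h2 := ball_map g hB
    rw [map_sub, h.map_truncProj, h1, h.truncProj_zero, zero_sub, hg] at h2
    have e : (g ∘ j' ∘ n : Fin l → M) = j ∘ n := funext fun i => hg _
    rw [e] at h2
    simpa using neg_mem h2
  intro m hm
  refine hC.eq_zero hj' fun k => ?_
  have h1 := key (op (φ (xd k)) • m) (by rw [map_smul, hm, smul_zero])
  rw [hC.apply_xd hj' hx] at h1
  simpa using h1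

/-- After multiplication by `x`, the truncated projection telescopes to its last term. -/
theorem truncProj_succ_x (h : OreStep π ιV ιU φ₀ φ x xd) (B : ℕ) (m : M) :
    op (φ x) • h.truncProj (B + 1) m =
      (-1 : ℤ) ^ B • op (ιU h.D ^ B) • op (φ (xd B * x)) • m := by
  induction B with
  | zero =>
    simp [truncProj, h.xd_zero]
  | succ B ih =>
    rw [truncProj, Finset.sum_range_succ, smul_add]
    change op (φ x) • h.truncProj (B + 1) m + _ = _
    rw [ih, smul_comm (op (φ x)), smul_smul (op (φ x)), ← op_mul, h.pow_comm, MulOpposite.op_add,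
      add_smul, smul_add, nat_smul_op, op_mul, mul_smul, smul_smul (op (φ x)), ← op_mul, ← map_mul,
      add_comm, add_assoc]
    refine add_eq_left.2 ?_
    rw [← h.xd_succ, map_nsmul, nat_smul_op, smul_comm (op (ιU h.D ^ B)) (B + 1),
      pow_succ (-1 : ℤ) B, mul_neg_one, neg_smul, neg_add_cancel]

/-- The finite form of the Taylor expansion `m = ∑ₖ P(m xᵏ/k!) Dᵏ`, where `P` is the projection onto
the kernel of `x`. -/
theorem taylor (h : OreStep π ιV ιU φ₀ φ x xd) (B : ℕ) (m : M) :
    ∑ k ∈ Finset.range (B + 1), op (ιU h.D ^ k) •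
      h.truncProj (B + 1 - k) (op (φ (xd k)) • m) = m := by
  have e : ∀ k b, op (ιU h.D ^ k) • ((-1 : ℤ) ^ b) • op (ιU h.D ^ b) • op (φ (xd b)) •
      op (φ (xd k)) • m = ((-1 : ℤ) ^ b * ((k + b).choose b : ℤ)) • op (ιU h.D ^ (k + b)) •
        op (φ (xd (k + b))) • m := by
    intro k b
    rw [smul_smul (op (φ (xd b))), ← op_mul, ← map_mul, h.xd_mul, Nat.choose_symm_add, map_nsmul,
      nat_smul_op, smul_comm (op (ιU h.D ^ b)) ((k + b).choose b),
      smul_comm (op (ιU h.D ^ k)) ((-1 : ℤ) ^ b), smul_comm (op (ιU h.D ^ k)) ((k + b).choose b),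
      smul_smul (op (ιU h.D ^ k)), ← op_mul, ← pow_add, mul_smul,
      natCast_zsmul, add_comm b k]
  have e2 := Finset.sum_range_diag_flip (B + 1) (fun k b => op (ιU h.D ^ k) • ((-1 : ℤ) ^ b) •
    op (ιU h.D ^ b) • op (φ (xd b)) • op (φ (xd k)) • m)
  simp only [truncProj, Finset.smul_sum]
  rw [← e2, Finset.sum_range_succ', Finset.sum_eq_zero, zero_add]
  · simp [h.xd_zero]
  · intro n _
    have e3 : ∀ k ∈ Finset.range (n + 1 + 1), op (ιU h.D ^ k) • ((-1 : ℤ) ^ (n + 1 - k)) •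
        op (ιU h.D ^ (n + 1 - k)) • op (φ (xd (n + 1 - k))) • op (φ (xd k)) • m =
        ((-1 : ℤ) ^ (n + 1 - k) * ((n + 1).choose (n + 1 - k) : ℤ)) • op (ιU h.D ^ (n + 1)) •
        op (φ (xd (n + 1))) • m := by
      intro k hk
      rw [e, Nat.add_sub_cancel' (Nat.lt_succ_iff.1 (Finset.mem_range.1 hk))]
    have e4 : ∑ k ∈ Finset.range (n + 1 + 1),
        (-1 : ℤ) ^ (n + 1 - k) * ((n + 1).choose (n + 1 - k) : ℤ) = 0 :=
      (Finset.sum_range_reflect (fun b => (-1 : ℤ) ^ b * ((n + 1).choose b : ℤ)) (n + 1 + 1)).trans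
        (by rw [Int.alternating_sum_range_choose, if_neg n.succ_ne_zero])
    rw [Finset.sum_congr rfl e3, ← Finset.sum_smul, e4, zero_smul]

/-- The projection `P(m) = ∑ (-1)ᵇ m xᵇ/b! Dᵇ` converges to an element killed by `x`. -/
theorem exists_proj (h : OreStep π ιV ιU φ₀ φ x xd) {l : ℕ} (s : Fin l → M) {m : M}
    (hm : ∀ n, ∀ᶠ b in Filter.atTop, op (φ (xd b)) • m ∈ ball π ιU n s) :
    ∃ e : M, op (φ x) • e = 0 ∧
      ∀ n, ∀ᶠ B in Filter.atTop, e - h.truncProj B m ∈ ball π ιU n s := by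
  have hterm : ∀ n, ∀ᶠ b in Filter.atTop,
      (-1 : ℤ) ^ b • op (ιU h.D ^ b) • op (φ (xd b)) • m ∈ ball π ιU n s := fun n => by
    filter_upwards [hm n] with b hb
    rw [← map_pow]
    exact zsmul_mem (smul_mem_ball hb _) _
  obtain ⟨e, he⟩ := h.ballU.exists_sum s _ hterm
  refine ⟨e, h.ballU.eq_zero_of_mem_ball s fun p => ?_, he⟩
  obtain ⟨t, x₀, hx₀⟩ := h.ballV.surj x
  have hmx : ∀ y n, y ∈ ball π ιU (t + n) s → op (φ x) • y ∈ ball π ιU n s := fun y n hy => by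
    refine h.ballU.mem_ball_of_smul (k := t) ?_
    rw [← op_algebraMap_smul, ← h.map_base_smul, hx₀, h.map_ι]
    exact smul_mem_ball hy _
  obtain ⟨B, hB, hB'⟩ := (((Filter.tendsto_add_atTop_nat 1).eventually (he (t + p))).and
    ((Filter.tendsto_add_atTop_nat 1).eventually (hm p))).exists
  have h1 := hmx _ _ hB
  have h2 : op (φ x) • h.truncProj (B + 1) m ∈ ball π ιU p s := by
    rw [h.truncProj_succ_x, ← h.xd_succ, map_nsmul, nat_smul_op, ← map_pow]
    exact zsmul_mem (smul_mem_ball (nsmul_mem hB' _) _) _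
  rw [smul_sub] at h1
  have := add_mem h1 h2
  rwa [truncProj, sub_add_cancel] at this

/-- If the divided powers of `x` tend to zero on the finitely generated module `M`, then `M` is
generated by the kernel of `x`. -/
theorem span_eq_top (h : OreStep π ιV ιU φ₀ φ x xd) [Module.Finite Uᵐᵒᵖ M]
    (hM : ∀ m : M, NullSeq π ιU fun n => op (φ (xd n)) • m) (P : Submodule Uᵐᵒᵖ M)
    (hP : ∀ m : M, op (φ x) • m = 0 → m ∈ P) : P = ⊤ := by
  obtain ⟨l, s, hs⟩ := Module.Finite.exists_fin (R := Uᵐᵒᵖ) (M := M)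
  have hev : ∀ (m : M) n, ∀ᶠ b in Filter.atTop, op (φ (xd b)) • m ∈ ball π ιU n s :=
    fun m n => hM m l s hs n
  -- in `M ⧸ P` the projections vanish, so the Taylor expansion of `m` is small there
  let s' : Fin l → M ⧸ P := P.mkQ ∘ s
  have htr : ∀ (m : M) n, ∀ᶠ B in Filter.atTop, P.mkQ (h.truncProj B m) ∈ ball π ιU n s' := by
    intro m n
    obtain ⟨e, hex, he⟩ := h.exists_proj s (hev m)
    filter_upwards [he n] with B hB
    have h1 := ball_map P.mkQ hB
    have h2 : P.mkQ e = 0 := (Submodule.Quotient.mk_eq_zero P).2 (hP e hex)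
    rw [map_sub, h2, zero_sub] at h1
    simpa using neg_mem h1
  refine eq_top_iff.2 fun m _ => (Submodule.Quotient.mk_eq_zero P).1 ?_
  refine h.ballU.eq_zero_of_mem_ball s' fun p => ?_
  obtain ⟨B, hB⟩ := Filter.eventually_atTop.1 (hev m p)
  have key : ∀ k, P.mkQ (h.truncProj (B + 1 - k) (op (φ (xd k)) • m)) ∈ ball π ιU p s' := by
    intro k
    obtain ⟨B', hB', hBB'⟩ := ((htr (op (φ (xd k)) • m) p).and
      (Filter.eventually_ge_atTop (B + 1 - k))).exists
    have e : h.truncProj B' (op (φ (xd k)) • m) - h.truncProj (B + 1 - k) (op (φ (xd k)) • m) ∈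
        ball π ιU p s := by
      rw [truncProj, truncProj, ← Finset.sum_Ico_eq_sub _ hBB']
      refine sum_mem fun b hb => zsmul_mem ?_ _
      rw [← map_pow]
      refine smul_mem_ball ?_ _
      rw [smul_smul, ← op_mul, ← map_mul, h.xd_mul, map_nsmul, nat_smul_op]
      exact nsmul_mem (hB _ (by rw [Finset.mem_Ico] at hb; omega)) _
    have h1 := ball_map P.mkQ e
    rw [map_sub] at h1
    simpa using sub_mem hB' h1
  have h2 := congrArg P.mkQ (h.taylor B m)
  change P.mkQ m ∈ _
  rw [← h2, map_sum]
  refine sum_mem fun k _ => ?_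
  rw [map_smul, ← map_pow]
  exact smul_mem_ball (key k) _

/-- If the divided powers of `x` tend to zero on the finitely generated module `M`, then the kernel
`N` of `x` in `M` is finitely generated and `N ⊗ U = M`. -/
theorem finite_and_isInduced (h : OreStep π ιV ιU φ₀ φ x xd) [Module.Finite Uᵐᵒᵖ M]
    (hM : ∀ m : M, NullSeq π ιU fun n => op (φ (xd n)) • m) {j : N →+ M}
    (hj : ∀ v n, j (op v • n) = op (φ v) • j n) (hinj : Function.Injective j)
    (hrange : ∀ m, (∃ n, j n = m) ↔ op (φ x) • m = 0) :
    Module.Finite Vᵐᵒᵖ N ∧ IsInduced φ j := by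
  have hx : ∀ n : N, op x • n = 0 := fun n => hinj (by
    rw [hj, map_zero, (hrange _).1 ⟨n, rfl⟩])
  have hu := isInduced_unit φ N
  have hgu : ∀ n, Induced.desc φ j hj (Induced.unit φ N n) = j n := Induced.desc_unit φ j hj
  have hbij : Function.Bijective (Induced.desc φ j hj) := by
    refine ⟨h.injective_desc hu hinj hx _ hgu, ?_⟩
    rw [← LinearMap.range_eq_top]
    refine h.span_eq_top hM _ fun m hm => ?_
    obtain ⟨n, rfl⟩ := (hrange m).2 hm
    exact ⟨_, hgu n⟩
  have hI := IsInduced.of_bijective hj hbij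
  refine ⟨?_, hI⟩
  -- `M` is generated by finitely many elements of `N`, whose constant coefficients generate `N`
  obtain ⟨C, hC⟩ := h.exists_isCoeff hI
  have : IsNoetherianRing Uᵐᵒᵖ := h.ballU.isNoetherianRing_op
  have hfg : (Submodule.span Uᵐᵒᵖ (Set.range j)).FG := IsNoetherian.noetherian _
  obtain ⟨T, hT, hTs⟩ := (Submodule.fg_span_iff_fg_span_finset_subset _).1 hfg
  choose n hn using fun i : T => hT i.2
  have hrange' : Set.range (fun i => j (n i)) = T := by
    ext y
    constructor
    · rintro ⟨i, rfl⟩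
      simp only [hn]
      exact i.2
    · intro hy
      exact ⟨⟨y, hy⟩, hn _⟩
  refine ⟨Submodule.fg_def.2 ⟨Set.range n, Set.finite_range _, eq_top_iff.2 fun m _ => ?_⟩⟩
  have hm : j m ∈ Submodule.span Uᵐᵒᵖ (Set.range fun i => j (n i)) := by
    rw [hrange', ← hTs]
    exact Submodule.subset_span ⟨m, rfl⟩
  obtain ⟨c, hc⟩ := (Submodule.mem_span_range_iff_exists_fun _).1 hm
  have h1 := congrArg (C 0) hc
  rw [hC.apply_j, if_pos rfl, map_sum] at h1
  rw [← h1]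
  refine sum_mem fun i _ => ?_
  rw [← op_unop (c i), hC]
  exact Submodule.smul_mem _ _ (Submodule.subset_span ⟨i, rfl⟩)

end OreStep

end OreCounit

/-! ### `π`-adic completions -/

section CompletionBall

variable {R : Type u} [CommRing R] (π : R) (B : Type u) [Ring B] [Algebra R B]

variable {π B}

theorem Completion.ext' {z w : Completion π B} (h : ∀ n, z.1 n = w.1 n) : z = w :=
  Subtype.ext (funext h)

theorem mk_pow_smul_eq_zero (n : ℕ) (b : B) :
    Ideal.Quotient.mk (powIdeal π B n) (π ^ n • b) = 0 :=
  Ideal.Quotient.eq_zero_iff_mem.2 ((mem_powIdeal π).2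
    ⟨b, by rw [Algebra.smul_def, Algebra.commutes]⟩)

theorem exists_of_mk_eq_zero {n : ℕ} {b : B} (h : Ideal.Quotient.mk (powIdeal π B n) b = 0) :
    ∃ c, b = π ^ n • c := by
  obtain ⟨c, hc⟩ := (mem_powIdeal π).1 (Ideal.Quotient.eq_zero_iff_mem.1 h)
  exact ⟨c, by rw [← hc, Algebra.smul_def, Algebra.commutes]⟩

theorem Completion.val_smul (z : Completion π B) (r : R) (n : ℕ) : (r • z).1 n = r • z.1 n := rfl

theorem Completion.pow_smul_val (z : Completion π B) (n : ℕ) : (π ^ n • z).1 n = 0 := by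
  obtain ⟨b, hb⟩ := Ideal.Quotient.mk_surjective (z.1 n)
  rw [Completion.val_smul, ← hb]
  exact mk_pow_smul_eq_zero n b

/-- An element of the completion that vanishes modulo `πⁿ` is a multiple of `πⁿ`. -/
theorem Completion.exists_eq_pow_smul {z : Completion π B} {n : ℕ} (h : z.1 n = 0) :
    ∃ w, z = π ^ n • w := by
  -- representatives `b m` of `z` are written as `πⁿ s m` with `s` a Cauchy sequence: as `B` may have
  -- `π`-torsion, arbitrary quotients by `πⁿ` need not be compatible
  choose b hb using fun m => Ideal.Quotient.mk_surjective (z.1 (n + m))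
  have hstep : ∀ m, ∃ c, b (m + 1) - b m = π ^ (n + m) • c := fun m => by
    refine exists_of_mk_eq_zero ?_
    rw [map_sub, sub_eq_zero, hb m, ← z.2 (n + m) (n + (m + 1)) (by omega), ← hb (m + 1)]
    rfl
  obtain ⟨e, he⟩ : ∃ c, b 0 = π ^ n • c := exists_of_mk_eq_zero (by rw [← h]; exact hb 0)
  choose c hc using hstep
  let s : ℕ → B := fun m => e + ∑ i ∈ Finset.range m, π ^ i • c i
  have hs : ∀ m, b m = π ^ n • s m := by
    intro m
    induction m with
    | zero => simp [s, he]
    | succ m ih =>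
      have h1 := hc m
      rw [sub_eq_iff_eq_add, ih] at h1
      rw [h1]
      simp only [s, Finset.sum_range_succ, smul_add, smul_smul, pow_add]
      abel
  have hss : ∀ m m', m ≤ m' → ∃ d, s m' - s m = π ^ m • d := by
    intro m m' hmm
    induction m', hmm using Nat.le_induction with
    | base => exact ⟨0, by simp⟩
    | succ m' hm ih =>
      obtain ⟨d, hd⟩ := ih
      refine ⟨d + π ^ (m' - m) • c m', ?_⟩
      rw [smul_add, ← hd, smul_smul, ← pow_add, Nat.add_sub_cancel' hm]
      simp only [s, Finset.sum_range_succ]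
      abel
  refine ⟨⟨fun m => Ideal.Quotient.mk _ (s m), fun m m' hmm => ?_⟩, Completion.ext' fun m => ?_⟩
  · change Ideal.Quotient.mk (powIdeal π B m) (s m') = _
    obtain ⟨d, hd⟩ := hss m m' hmm
    rw [← sub_eq_zero, ← map_sub, hd]
    exact mk_pow_smul_eq_zero m d
  · change z.1 m = Ideal.Quotient.mk _ (π ^ n • s m)
    rw [← hs, ← z.2 m (n + m) (by omega), ← hb m]
    rfl

theorem Completion.sep {z : Completion π B} (h : ∀ n, ∃ w, z = π ^ n • w) : z = 0 := by
  refine Completion.ext' fun n => ?_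
  obtain ⟨w, rfl⟩ := h n
  exact Completion.pow_smul_val w n

theorem Completion.val_sum (f : ℕ → Completion π B) (k n : ℕ) :
    (∑ i ∈ Finset.range k, f i).1 n = ∑ i ∈ Finset.range k, (f i).1 n := by
  induction k with
  | zero => rfl
  | succ k ih => rw [Finset.sum_range_succ, Finset.sum_range_succ, ← ih]; rfl

theorem Completion.summable (b : ℕ → Completion π B) (hb : PiNull π b) :
    ∃ s, ∀ n, ∀ᶠ k in Filter.atTop, ∃ v, s - ∑ i ∈ Finset.range k, b i = π ^ n • v := by
  have h : ∀ n, ∃ K, ∀ k ≥ K, (b k).1 n = 0 := fun n => by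
    obtain ⟨K, hK⟩ := Filter.eventually_atTop.1 (hb n)
    refine ⟨K, fun k hk => ?_⟩
    obtain ⟨c, hc⟩ := hK k hk
    rw [hc]
    exact Completion.pow_smul_val c n
  choose K hK using h
  have hKs : ∀ n k, K n ≤ k → (∑ i ∈ Finset.range k, b i).1 n =
      (∑ i ∈ Finset.range (K n), b i).1 n := by
    intro n k hk
    induction k, hk using Nat.le_induction with
    | base => rfl
    | succ k hk ih =>
      rw [Completion.val_sum, Finset.sum_range_succ, ← Completion.val_sum, ih, hK n k hk, add_zero]
  let s : Completion π B := ⟨fun n => (∑ i ∈ Finset.range (K n), b i).1 n, fun m n hmn => by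
    dsimp only
    have h1 := hKs m (max (K m) (K n)) (le_max_left _ _)
    have h2 := hKs n (max (K m) (K n)) (le_max_right _ _)
    rw [← h1, ← h2]
    exact (∑ i ∈ Finset.range (max (K m) (K n)), b i).2 m n hmn⟩
  refine ⟨s, fun n => Filter.eventually_atTop.2 ⟨K n, fun k hk =>
    Completion.exists_eq_pow_smul ?_⟩⟩
  change (∑ i ∈ Finset.range (K n), b i).1 n - (∑ i ∈ Finset.range k, b i).1 n = 0
  rw [hKs n k hk, sub_self]

/-- Reduction of the completion modulo `π`. -/
def Completion.reduction : Completion π B →+* B ⧸ powIdeal π B 1 :=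
  (Pi.evalRingHom (fun n => B ⧸ powIdeal π B n) 1).comp (Completion π B).val.toRingHom

theorem Completion.reduction_surjective :
    Function.Surjective (Completion.reduction (π := π) (B := B)) := fun x => by
  obtain ⟨b, rfl⟩ := Ideal.Quotient.mk_surjective x
  exact ⟨toCompletion π B b, rfl⟩

theorem Completion.reduction_eq_zero (z : Completion π B) :
    Completion.reduction z = 0 ↔ ∃ w, z = π • w := by
  constructor
  · intro h
    obtain ⟨w, hw⟩ := Completion.exists_eq_pow_smul (n := 1) h
    exact ⟨w, by rwa [pow_one] at hw⟩
  · rintro ⟨w, rfl⟩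
    have := Completion.pow_smul_val w 1
    rwa [pow_one] at this

variable {K : Type u} [IsDomain R] [Field K] [Algebra R K] [IsFractionRing R K]

/-- The `π`-adic completion of `B`, with `B / π` right noetherian, is a complete unit ball in its
localisation. The condition on divisors of powers of `π` says that `K = R[1/π]`. -/
theorem completeBall_completion (hπ0 : π ≠ 0) (hπ : ∀ s : R, s ≠ 0 → ∃ n, s ∣ π ^ n)
    (hB : IsNoetherian (B ⧸ powIdeal π B 1)ᵐᵒᵖ (B ⧸ powIdeal π B 1)) :
    CompleteBall π (Algebra.TensorProduct.includeRight :
      Completion π B →ₐ[R] K ⊗[R] Completion π B) where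
  sep _ h := Completion.sep h
  summable := Completion.summable
  noeth := ⟨_, inferInstance, Completion.reduction, hB, Completion.reduction_surjective,
    Completion.reduction_eq_zero⟩
  isUnit := by
    have h : IsUnit (algebraMap R K π) :=
      ((map_ne_zero_iff _ (IsFractionRing.injective R K)).2 hπ0).isUnit
    have := h.map (algebraMap K (K ⊗[R] Completion π B))
    rwa [← IsScalarTower.algebraMap_apply] at this
  surj u := by
    obtain ⟨⟨a, s⟩, hs⟩ := IsLocalizedModule.surj (nonZeroDivisors R)
      (TensorProduct.mk R K (Completion π B) 1) u
    have hs' : (s : R) • u = (1 : K) ⊗ₜ[R] a := hs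
    obtain ⟨n, c, hc⟩ := hπ s (nonZeroDivisors.ne_zero s.2)
    refine ⟨n, c • a, ?_⟩
    rw [hc, mul_comm, mul_smul, hs', map_smul]
    rfl

end CompletionBall

theorem exists_dvd_pow {R : Type u} [CommRing R] [IsDomain R] [IsDiscreteValuationRing R] {π : R}
    (hπ : ¬ IsUnit π) {s : R} (hs : s ≠ 0) : ∃ n, s ∣ π ^ n := by
  obtain ⟨ϖ, hϖ⟩ := IsDiscreteValuationRing.exists_irreducible R
  obtain ⟨n, hn⟩ := IsDiscreteValuationRing.associated_pow_irreducible hs hϖ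
  have h1 : ϖ ∣ π := by
    have : π ∈ IsLocalRing.maximalIdeal R := hπ
    rwa [hϖ.maximalIdeal_eq, Ideal.mem_span_singleton] at this
  exact ⟨n, hn.dvd.trans (pow_dvd_pow_of_dvd h1 n)⟩

noncomputable section

/-! ### Enveloping algebras: universal property and a Poincaré–Birkhoff–Witt decomposition -/

namespace Enveloping

section Universal

variable {R A L : Type u} [CommRing R] [CommRing A] [Algebra R A] [LieRing L] [LieAlgebra R L]
  [Module A L] [LieRingModule L A]

theorem ιA_add_ιL (a : A) (x : L) :
    mk R A L (TensorAlgebra.ι R (a, x)) = ιA R A L a + ιL R A L x := by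
  rw [ιA_apply, ιL_apply, ← map_add, ← map_add]
  simp

theorem ιL_smul (a : A) (x : L) : ιL R A L (a • x) = ιA R A L a * ιL R A L x := by
  rw [ιL_apply, mk_rel (EnvelopingRel.smul a x), map_mul]
  rfl

theorem ιL_lie (x y : L) :
    ιL R A L ⁅x, y⁆ = ιL R A L x * ιL R A L y - ιL R A L y * ιL R A L x := by
  rw [ιL_apply, mk_rel (EnvelopingRel.lie x y), map_sub, map_mul, map_mul]
  rfl

theorem ιA_anchor (x : L) (a : A) :
    ιA R A L ⁅x, a⁆ = ιL R A L x * ιA R A L a - ιA R A L a * ιL R A L x := by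
  rw [ιA_apply, mk_rel (EnvelopingRel.anchor x a), map_sub, map_mul, map_mul]
  rfl

theorem induction {P : Enveloping R A L → Prop} (h0 : ∀ r, P (algebraMap R _ r))
    (hA : ∀ a, P (ιA R A L a)) (hL : ∀ x, P (ιL R A L x))
    (hmul : ∀ s t, P s → P t → P (s * t)) (hadd : ∀ s t, P s → P t → P (s + t))
    (z : Enveloping R A L) : P z := by
  obtain ⟨t, rfl⟩ := mk_surjective R A L z
  induction t using TensorAlgebra.induction with
  | algebraMap r => rw [AlgHom.commutes]; exact h0 r
  | ι w => rw [ιA_add_ιL]; exact hadd _ _ (hA _) (hL _)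
  | mul s t hs ht => rw [map_mul]; exact hmul _ _ hs ht
  | add s t hs ht => rw [map_add]; exact hadd _ _ hs ht

/-- A property of left multipliers can be checked on `A` and `L`. -/
theorem induction_left {P : Enveloping R A L → Prop} (h1 : P 1)
    (hadd : ∀ s t, P s → P t → P (s + t)) (hA : ∀ a s, P s → P (ιA R A L a * s))
    (hL : ∀ x s, P s → P (ιL R A L x * s)) (z : Enveloping R A L) : P z := by
  suffices ∀ s, P s → P (z * s) by simpa using this 1 h1
  induction z using Enveloping.induction with
  | h0 r =>
    intro s hs
    have := hA (algebraMap R A r) s hs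
    rwa [AlgHom.commutes] at this
  | hA a => exact hA a
  | hL x => exact hL x
  | hmul s t hs ht => intro u hu; rw [mul_assoc]; exact hs _ (ht _ hu)
  | hadd s t hs ht => intro u hu; rw [add_mul]; exact hadd _ _ (hs _ hu) (ht _ hu)

variable {E : Type u} [Ring E] [Algebra R E]

/-- The universal property of the enveloping algebra. -/
def lift (f : A →ₗ[R] E) (g : L →ₗ[R] E) (h1 : f 1 = 1) (hmul : ∀ a b, f (a * b) = f a * f b)
    (hsmul : ∀ (a : A) (x : L), g (a • x) = f a * g x)
    (hlie : ∀ x y, g ⁅x, y⁆ = g x * g y - g y * g x)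
    (hanchor : ∀ (x : L) (a : A), f ⁅x, a⁆ = g x * f a - f a * g x) :
    Enveloping R A L →ₐ[R] E :=
  RingQuot.liftAlgHom R ⟨TensorAlgebra.lift R (f.coprod g), by
    intro s t h
    cases h with
    | one => simpa using h1
    | mul a b => simpa using hmul a b
    | smul a x => simpa using hsmul a x
    | lie x y => simpa using hlie x y
    | anchor x a => simpa using hanchor x a⟩

variable (f : A →ₗ[R] E) (g : L →ₗ[R] E) (h1 : f 1 = 1) (hmul : ∀ a b, f (a * b) = f a * f b)
  (hsmul : ∀ (a : A) (x : L), g (a • x) = f a * g x)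
  (hlie : ∀ x y, g ⁅x, y⁆ = g x * g y - g y * g x)
  (hanchor : ∀ (x : L) (a : A), f ⁅x, a⁆ = g x * f a - f a * g x)

theorem lift_ιA (a : A) : lift f g h1 hmul hsmul hlie hanchor (ιA R A L a) = f a := by
  change RingQuot.liftAlgHom R _ (RingQuot.mkAlgHom R _ _) = _
  rw [RingQuot.liftAlgHom_mkAlgHom_apply]
  simp

theorem lift_ιL (x : L) : lift f g h1 hmul hsmul hlie hanchor (ιL R A L x) = g x := by
  change RingQuot.liftAlgHom R _ (RingQuot.mkAlgHom R _ _) = _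
  rw [RingQuot.liftAlgHom_mkAlgHom_apply]
  simp

theorem algHom_ext {φ ψ : Enveloping R A L →ₐ[R] E} (hA : ∀ a, φ (ιA R A L a) = ψ (ιA R A L a))
    (hL : ∀ x, φ (ιL R A L x) = ψ (ιL R A L x)) : φ = ψ := by
  refine AlgHom.ext fun z => ?_
  induction z using Enveloping.induction with
  | h0 r => rw [AlgHom.commutes, AlgHom.commutes]
  | hA a => exact hA a
  | hL x => exact hL x
  | hmul s t hs ht => rw [map_mul, map_mul, hs, ht]
  | hadd s t hs ht => rw [map_add, map_add, hs, ht]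

theorem map_ιL {L' : Type u} [LieRing L'] [LieAlgebra R L'] [Module A L'] [LieRingModule L' A]
    (g : LieRinehartAlgebra.Hom (AlgHom.id R A) L' L) (x : L') :
    map R A g (ιL R A L' x) = ιL R A L (g x) :=
  map_mk_ι R A g 0 x

end Universal

section Splitting

set_option linter.unusedSectionVars false

variable {R A L C : Type u} [CommRing R] [CommRing A] [Algebra R A]
  [LieRing L] [LieAlgebra R L] [Module A L] [LieRingModule L A]
  [LieRinehartRing A L] [LieRinehartAlgebra R A L]
  [LieRing C] [LieAlgebra R C] [Module A C] [LieRingModule C A]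
  [LieRinehartRing A C] [LieRinehartAlgebra R A C]

/-- A decomposition `L = C ⊕ A d` of a Lie–Rinehart algebra, where `d` normalises `C`. The maps
`p` and `q` are the projection to `C` and the coefficient of `d`. -/
structure Splitting (g : LieRinehartAlgebra.Hom (AlgHom.id R A) C L) where
  d : L
  p : L →ₗ[A] C
  q : L →ₗ[A] A
  decomp : ∀ y, y = g (p y) + q y • d
  p_incl : ∀ c, p (g c) = c
  q_incl : ∀ c, q (g c) = 0
  p_d : p d = 0
  q_d : q d = 1
  normal : ∀ c, q ⁅d, g c⁆ = 0

namespace Splitting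

variable {g : LieRinehartAlgebra.Hom (AlgHom.id R A) C L} (S : Splitting g)

/-- The derivation `c ↦ [d, c]` of `C`. -/
def ad : C →ₗ[R] C where
  toFun c := S.p ⁅S.d, g c⁆
  map_add' c c' := by rw [map_add g.toLieHom, lie_add, map_add]
  map_smul' r c := by
    rw [map_smul g.toLieHom, lie_smul, LinearMap.map_smul_of_tower, RingHom.id_apply]

theorem incl_ad (c : C) : g (S.ad c) = ⁅S.d, g c⁆ := by
  have := S.decomp ⁅S.d, g c⁆
  rw [S.normal, zero_smul, add_zero] at this
  exact this.symm

theorem incl_injective (S : Splitting g) : Function.Injective g :=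
  Function.LeftInverse.injective S.p_incl

theorem hom_smul (a : A) (c : C) : g (a • c) = a • g c := g.map_smul_apply a c

theorem hom_lie (c c' : C) : g ⁅c, c'⁆ = ⁅g c, g c'⁆ := g.toLieHom.map_lie c c'

theorem hom_anchor (c : C) (a : A) : ⁅g c, a⁆ = ⁅c, a⁆ := (g.apply_lie a c).symm

theorem ad_smul (a : A) (c : C) : S.ad (a • c) = a • S.ad c + ⁅S.d, a⁆ • c := by
  change S.p ⁅S.d, g (a • c)⁆ = _
  rw [hom_smul, LieRinehartRing.leibniz_smul_right, map_add, map_smul, map_smul, S.p_incl]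
  rfl

theorem ad_lie (c c' : C) : S.ad ⁅c, c'⁆ = ⁅S.ad c, c'⁆ + ⁅c, S.ad c'⁆ := by
  refine S.incl_injective ?_
  have h := map_add g.toLieHom ⁅S.ad c, c'⁆ ⁅c, S.ad c'⁆
  refine Eq.trans ?_ h.symm
  rw [S.incl_ad, hom_lie, hom_lie, hom_lie, S.incl_ad, S.incl_ad, leibniz_lie]

theorem d_anchor (c : C) (a : A) : ⁅S.d, ⁅c, a⁆⁆ = ⁅S.ad c, a⁆ + ⁅c, ⁅S.d, a⁆⁆ := by
  rw [← hom_anchor (g := g) c, ← hom_anchor (g := g) (S.ad c), ← hom_anchor (g := g) c, S.incl_ad,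
    leibniz_lie]

/-- The homomorphism `b ↦ b + δ(b) ε` to dual numbers that encodes the derivation `δ = [d, ·]` of
`U(C)`. -/
def dual : Enveloping R A C →ₐ[R] TrivSqZeroExt (Enveloping R A C) (Enveloping R A C) :=
  lift
    { toFun := fun a => TrivSqZeroExt.inl (ιA R A C a) + TrivSqZeroExt.inr (ιA R A C ⁅S.d, a⁆)
      map_add' := fun a b => by
        refine TrivSqZeroExt.ext ?_ ?_ <;> simp
      map_smul' := fun r a => by
        refine TrivSqZeroExt.ext ?_ ?_ <;> simp }
    { toFun := fun c => TrivSqZeroExt.inl (ιL R A C c) + TrivSqZeroExt.inr (ιL R A C (S.ad c))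
      map_add' := fun a b => by
        refine TrivSqZeroExt.ext ?_ ?_ <;> simp
      map_smul' := fun r a => by
        refine TrivSqZeroExt.ext ?_ ?_ <;> simp }
    (by
      have : ⁅S.d, (1 : A)⁆ = 0 := by
        have := LieRinehartRing.leibniz_mul_right S.d (1 : A) 1
        rw [mul_one, one_smul, mul_one] at this
        simpa using this
      refine TrivSqZeroExt.ext ?_ ?_ <;> simp [this])
    (fun a b => by
      refine TrivSqZeroExt.ext ?_ ?_
      · simp
      · simp [← map_mul, mul_comm])
    (fun a c => by
      refine TrivSqZeroExt.ext ?_ ?_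
      · simp [ιL_smul]
      · simp [ιL_smul, S.ad_smul])
    (fun c c' => by
      refine TrivSqZeroExt.ext ?_ ?_
      · simp [ιL_lie]
      · simp only [LinearMap.coe_mk, AddHom.coe_mk, TrivSqZeroExt.snd_add, TrivSqZeroExt.snd_inl,
          TrivSqZeroExt.snd_inr, zero_add, S.ad_lie, map_add, ιL_lie, TrivSqZeroExt.snd_sub,
          TrivSqZeroExt.snd_mul, TrivSqZeroExt.fst_add, TrivSqZeroExt.fst_inl,
          TrivSqZeroExt.fst_inr, add_zero, smul_eq_mul, op_smul_eq_mul]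
        abel)
    (fun c a => by
      refine TrivSqZeroExt.ext ?_ ?_
      · simp [ιA_anchor]
      · simp only [LinearMap.coe_mk, AddHom.coe_mk, TrivSqZeroExt.snd_add, TrivSqZeroExt.snd_inl,
          TrivSqZeroExt.snd_inr, zero_add, S.d_anchor, map_add, ιA_anchor, TrivSqZeroExt.snd_sub,
          TrivSqZeroExt.snd_mul, TrivSqZeroExt.fst_add, TrivSqZeroExt.fst_inl,
          TrivSqZeroExt.fst_inr, add_zero, smul_eq_mul, op_smul_eq_mul]
        abel)

end Splitting

end Splitting

end Enveloping

end

noncomputable section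

/-! ### The decomposition `U(L) = ⨁ₖ U(C) dᵏ` -/

namespace Enveloping

section Coefficients

set_option linter.unusedSectionVars false

variable {R A L C : Type u} [CommRing R] [CommRing A] [Algebra R A]
  [LieRing L] [LieAlgebra R L] [Module A L] [LieRingModule L A]
  [LieRinehartRing A L] [LieRinehartAlgebra R A L]
  [LieRing C] [LieAlgebra R C] [Module A C] [LieRingModule C A]
  [LieRinehartRing A C] [LieRinehartAlgebra R A C]

namespace Splitting

variable {g : LieRinehartAlgebra.Hom (AlgHom.id R A) C L} (S : Splitting g)

theorem dual_ιA (a : A) : S.dual (ιA R A C a) =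
    TrivSqZeroExt.inl (ιA R A C a) + TrivSqZeroExt.inr (ιA R A C ⁅S.d, a⁆) :=
  lift_ιA _ _ _ _ _ _ _ a

theorem dual_ιL (c : C) : S.dual (ιL R A C c) =
    TrivSqZeroExt.inl (ιL R A C c) + TrivSqZeroExt.inr (ιL R A C (S.ad c)) :=
  lift_ιL _ _ _ _ _ _ _ c

theorem fst_dual (b : Enveloping R A C) : (S.dual b).fst = b := by
  have : (TrivSqZeroExt.fstHom R (Enveloping R A C) (Enveloping R A C)).comp S.dual =
      AlgHom.id R _ := by
    refine algHom_ext (fun a => ?_) fun c => ?_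
    · simp [dual_ιA]
    · simp [dual_ιL]
  exact DFunLike.congr_fun this b

/-- The derivation `[d, ·]` of `U(C)`. -/
def der : Enveloping R A C →ₗ[R] Enveloping R A C where
  toFun b := (S.dual b).snd
  map_add' a b := by simp
  map_smul' r b := by simp

theorem der_ιA (a : A) : S.der (ιA R A C a) = ιA R A C ⁅S.d, a⁆ := by
  simp [der, dual_ιA]

theorem der_ιL (c : C) : S.der (ιL R A C c) = ιL R A C (S.ad c) := by
  simp [der, dual_ιL]

theorem der_mul (a b : Enveloping R A C) : S.der (a * b) = a * S.der b + S.der a * b := by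
  simp [der, fst_dual]

theorem der_one : S.der 1 = 0 := by simp [der]

/-- The derivation `der` of `U(C)` is the commutator with `d` in `U(L)`. -/
theorem map_der (b : Enveloping R A C) :
    ιL R A L S.d * map R A g b = map R A g b * ιL R A L S.d + map R A g (S.der b) := by
  induction b using Enveloping.induction with
  | h0 r =>
    rw [Algebra.algebraMap_eq_smul_one, map_smul, map_smul, S.der_one, map_one]
    simp
  | hA a => rw [S.der_ιA, map_ιA, map_ιA, ιA_anchor]; abel
  | hL c => rw [S.der_ιL, map_ιL, map_ιL, S.incl_ad, ιL_lie]; abel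
  | hmul s t hs ht =>
    rw [S.der_mul, map_mul, map_add, map_mul, map_mul, ← mul_assoc, hs, add_mul, mul_assoc, ht]
    noncomm_ring
  | hadd s t hs ht => rw [map_add, map_add, map_add, mul_add, hs, ht, add_mul]; abel

/-- The bracket of `L` in terms of the decomposition `L = C ⊕ A d`. -/
theorem lie_eq (y z : L) : ⁅y, z⁆ =
    g (⁅S.p y, S.p z⁆ - S.q z • S.ad (S.p y) + S.q y • S.ad (S.p z)) +
    (⁅S.p y, S.q z⁆ - ⁅S.p z, S.q y⁆ + S.q y * ⁅S.d, S.q z⁆ - S.q z * ⁅S.d, S.q y⁆) • S.d := by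
  have ha : ∀ a b, g (a + b) = g a + g b := map_add g.toLieHom
  have hs : ∀ a b, g (a - b) = g a - g b := map_sub g.toLieHom
  conv_lhs => rw [S.decomp y, S.decomp z]
  have h1 : ⁅S.q y • S.d, S.q z • S.d⁆ =
      (S.q y * ⁅S.d, S.q z⁆) • S.d - (S.q z * ⁅S.d, S.q y⁆) • S.d := by
    rw [LieRinehartRing.leibniz_smul_right, ← lie_skew (S.q y • S.d) S.d,
      LieRinehartRing.leibniz_smul_right, lie_self, LieRinehartRing.lie_smul_eq_mul]
    simp only [smul_zero, zero_add, smul_neg, mul_smul]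
    abel
  have h2 : ⁅g (S.p y), S.q z • S.d⁆ = - (S.q z • g (S.ad (S.p y))) + ⁅S.p y, S.q z⁆ • S.d := by
    rw [LieRinehartRing.leibniz_smul_right, hom_anchor, S.incl_ad, ← lie_skew S.d, smul_neg,
      neg_neg]
  have h3 : ⁅S.q y • S.d, g (S.p z)⁆ = S.q y • g (S.ad (S.p z)) - ⁅S.p z, S.q y⁆ • S.d := by
    rw [← lie_skew, LieRinehartRing.leibniz_smul_right, hom_anchor, S.incl_ad, ← lie_skew S.d,
      smul_neg]
    abel
  rw [add_lie, lie_add, lie_add, h1, h2, h3, ha, hs, hom_lie, hom_smul, hom_smul, sub_smul,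
    add_smul, sub_smul]
  abel

theorem p_lie (y z : L) : S.p ⁅y, z⁆ =
    ⁅S.p y, S.p z⁆ - S.q z • S.ad (S.p y) + S.q y • S.ad (S.p z) := by
  conv_lhs => rw [S.lie_eq y z]
  rw [map_add, map_smul, S.p_incl, S.p_d, smul_zero, add_zero]

theorem q_lie (y z : L) : S.q ⁅y, z⁆ =
    ⁅S.p y, S.q z⁆ - ⁅S.p z, S.q y⁆ + S.q y * ⁅S.d, S.q z⁆ - S.q z * ⁅S.d, S.q y⁆ := by
  conv_lhs => rw [S.lie_eq y z]
  rw [map_add, map_smul, S.q_incl, S.q_d, smul_eq_mul, mul_one, zero_add]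

theorem anchor_eq (y : L) (a : A) : ⁅y, a⁆ = ⁅S.p y, a⁆ + S.q y * ⁅S.d, a⁆ := by
  conv_lhs => rw [S.decomp y]
  rw [add_lie, hom_anchor, LieRinehartRing.lie_smul_eq_mul]

/-- The operator on sequences `P = (Pₖ)`, thought of as `∑ Pₖ dᵏ`, which is left multiplication by
`d`. -/
def shift : Module.End R (ℕ → Enveloping R A C) where
  toFun P k := S.der (P k) + Nat.casesOn k 0 P
  map_add' P Q := by
    funext k
    cases k
    · simp
    · simp; abel
  map_smul' r P := by
    funext k
    cases k <;> simp

theorem shift_lsmul (b : Enveloping R A C) :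
    S.shift * Algebra.lsmul R R (ℕ → Enveloping R A C) b =
      Algebra.lsmul R R (ℕ → Enveloping R A C) b * S.shift +
      Algebra.lsmul R R (ℕ → Enveloping R A C) (S.der b) := by
  refine LinearMap.ext fun P => funext fun k => ?_
  cases k
  · simp [shift, der_mul]
  · simp [shift, der_mul, mul_add]; abel

theorem shift_single (k : ℕ) : S.shift (Pi.single k 1) = Pi.single (k + 1) 1 := by
  funext j
  have h0 : S.der ((Pi.single k 1 : ℕ → Enveloping R A C) j) = 0 := by
    by_cases h : j = k
    · subst h; rw [Pi.single_eq_same, S.der_one]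
    · rw [Pi.single_eq_of_ne h, map_zero]
  change S.der _ + _ = _
  rw [h0, zero_add]
  cases j with
  | zero => rw [Pi.single_eq_of_ne (Nat.succ_ne_zero k).symm]; rfl
  | succ j => simp [Pi.single_apply]

/-- The commutator of `X + α D` and `Z + β D`, when `D` acts on the coefficients by a derivation. It
is the compatibility of `rep` with brackets. -/
theorem commutator_identity {E : Type u} [Ring E] {X Z α β D X' Z' α' β' : E}
    (hX : D * X = X * D + X') (hZ : D * Z = Z * D + Z') (hα : D * α = α * D + α')
    (hβ : D * β = β * D + β') (hαβ : α * β = β * α) :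
    (X * Z - Z * X - β * X' + α * Z') +
      ((X * β - β * X) - (Z * α - α * Z) + α * β' - β * α') * D =
    (X + α * D) * (Z + β * D) - (Z + β * D) * (X + α * D) := by
  have e1 : α * D * Z = α * (Z * D + Z') := by rw [mul_assoc, hZ]
  have e2 : α * D * (β * D) = α * (β * D + β') * D := by rw [← hβ]; noncomm_ring
  have e3 : β * D * X = β * (X * D + X') := by rw [mul_assoc, hX]
  have e4 : β * D * (α * D) = β * (α * D + α') * D := by rw [← hα]; noncomm_ring
  have e5 : α * (β * D + β') * D = β * α * D * D + α * β' * D := by rw [← hαβ]; noncomm_ring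
  rw [add_mul, mul_add, mul_add, add_mul, mul_add, mul_add, e1, e2, e3, e4, e5]
  noncomm_ring

/-- The action of `U(L)` by left multiplication on sequences in `U(C)`, thought of as sums
`∑ Pₖ dᵏ`. That the formulas define an action is what makes the sum `⨁ₖ U(C) dᵏ` direct. -/
def rep : Enveloping R A L →ₐ[R] Module.End R (ℕ → Enveloping R A C) :=
  lift ((Algebra.lsmul R R (ℕ → Enveloping R A C)).toLinearMap ∘ₗ (ιA R A C).toLinearMap)
    { toFun := fun y => Algebra.lsmul R R (ℕ → Enveloping R A C) (ιL R A C (S.p y)) +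
        Algebra.lsmul R R (ℕ → Enveloping R A C) (ιA R A C (S.q y)) * S.shift
      map_add' := fun y z => by
        simp only [map_add, add_mul]; abel
      map_smul' := fun r y => by
        simp only [LinearMap.map_smul_of_tower, map_smul, smul_add, smul_mul_assoc,
          RingHom.id_apply] }
    (by simp) (fun a b => by simp)
    (fun a y => by
      simp only [LinearMap.coe_mk, AddHom.coe_mk, map_smul, ιL_smul, smul_eq_mul, map_mul,
        LinearMap.comp_apply, AlgHom.toLinearMap_apply, mul_add, mul_assoc])
    (fun y z => by
      simp only [LinearMap.coe_mk, AddHom.coe_mk]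
      have hαβ : Algebra.lsmul R R (ℕ → Enveloping R A C) (ιA R A C (S.q y)) *
          Algebra.lsmul R R (ℕ → Enveloping R A C) (ιA R A C (S.q z)) =
          Algebra.lsmul R R (ℕ → Enveloping R A C) (ιA R A C (S.q z)) *
          Algebra.lsmul R R (ℕ → Enveloping R A C) (ιA R A C (S.q y)) :=
        (((Commute.all (S.q y) (S.q z)).map (ιA R A C)).map
          (Algebra.lsmul R R (ℕ → Enveloping R A C))).eq
      rw [← commutator_identity (S.shift_lsmul _) (S.shift_lsmul _) (S.shift_lsmul _)
        (S.shift_lsmul _) hαβ, S.p_lie, S.q_lie]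
      simp only [der_ιA, der_ιL, map_add, map_sub, ιL_lie, ιL_smul, map_mul, ιA_anchor])
    (fun y a => by
      simp only [LinearMap.coe_mk, AddHom.coe_mk, LinearMap.comp_apply, AlgHom.toLinearMap_apply]
      have hc : Algebra.lsmul R R (ℕ → Enveloping R A C) (ιA R A C a) *
          Algebra.lsmul R R (ℕ → Enveloping R A C) (ιA R A C (S.q y)) =
          Algebra.lsmul R R (ℕ → Enveloping R A C) (ιA R A C (S.q y)) *
          Algebra.lsmul R R (ℕ → Enveloping R A C) (ιA R A C a) :=
        (((Commute.all a (S.q y)).map (ιA R A C)).map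
          (Algebra.lsmul R R (ℕ → Enveloping R A C))).eq
      rw [add_mul, mul_assoc, S.shift_lsmul, mul_add, mul_add, S.anchor_eq, der_ιA, map_add,
        ιA_anchor (S.p y), ← mul_assoc _ _ S.shift, ← hc]
      simp only [map_add, map_sub, map_mul, mul_assoc]
      abel)

theorem rep_ιL (y : L) : S.rep (ιL R A L y) =
    Algebra.lsmul R R (ℕ → Enveloping R A C) (ιL R A C (S.p y)) +
        Algebra.lsmul R R (ℕ → Enveloping R A C) (ιA R A C (S.q y)) * S.shift :=
  lift_ιL _ _ _ _ _ _ _ y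

theorem rep_map (b : Enveloping R A C) :
    S.rep (map R A g b) = Algebra.lsmul R R (ℕ → Enveloping R A C) b := by
  have : S.rep.comp (map R A g) = Algebra.lsmul R R (ℕ → Enveloping R A C) := by
    refine algHom_ext (fun a => ?_) fun c => ?_
    · rw [AlgHom.comp_apply, map_ιA]
      exact lift_ιA _ _ _ _ _ _ _ a
    · rw [AlgHom.comp_apply, map_ιL, rep_ιL, S.p_incl, S.q_incl, map_zero, map_zero, zero_mul,
        add_zero]
  exact DFunLike.congr_fun this b

/-- The `k`-th coefficient of an element of `U(L) = ⨁ₖ U(C) dᵏ`: it is read off from the action on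
the sequence `1, 0, 0, …`. -/
def coeff (k : ℕ) : Enveloping R A L →ₗ[R] Enveloping R A C where
  toFun u := S.rep u (Pi.single 0 1) k
  map_add' u v := by simp
  map_smul' r u := by simp

theorem coeff_map_mul (k : ℕ) (b : Enveloping R A C) (u : Enveloping R A L) :
    S.coeff k (map R A g b * u) = b * S.coeff k u := by
  simp [coeff, rep_map]

theorem coeff_pow (k j : ℕ) : S.coeff k (ιL R A L S.d ^ j) = if k = j then 1 else 0 := by
  have h : S.rep (ιL R A L S.d ^ j) (Pi.single 0 1) = Pi.single j 1 := by
    induction j with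
    | zero => simp
    | succ j ih =>
      rw [pow_succ', map_mul, Module.End.mul_apply, ih, rep_ιL, S.p_d, S.q_d]
      simp [shift_single]
  change S.rep (ιL R A L S.d ^ j) (Pi.single 0 1) k = _
  rw [h, Pi.single_apply]

theorem exists_sum (u : Enveloping R A L) : ∃ (n : ℕ) (b : ℕ → Enveloping R A C),
    (∀ k, n ≤ k → b k = 0) ∧
    u = ∑ k ∈ Finset.range n, map R A g (b k) * ιL R A L S.d ^ k := by
  have ext : ∀ (n m : ℕ) (b : ℕ → Enveloping R A C), (∀ k, n ≤ k → b k = 0) →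
      ∑ k ∈ Finset.range n, map R A g (b k) * ιL R A L S.d ^ k =
      ∑ k ∈ Finset.range (n + m), map R A g (b k) * ιL R A L S.d ^ k := by
    intro n m b hb
    refine Finset.sum_subset (Finset.range_mono (Nat.le_add_right n m)) fun k _ hk => ?_
    rw [hb k (not_lt.1 fun h => hk (Finset.mem_range.2 h)), map_zero, zero_mul]
  have mulL : ∀ (c s : Enveloping R A _), (∃ (n : ℕ) (b : ℕ → Enveloping R A C),
      (∀ k, n ≤ k → b k = 0) ∧
      s = ∑ k ∈ Finset.range n, map R A g (b k) * ιL R A L S.d ^ k) →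
      ∃ (n : ℕ) (b : ℕ → Enveloping R A C), (∀ k, n ≤ k → b k = 0) ∧
      map R A g c * s = ∑ k ∈ Finset.range n, map R A g (b k) * ιL R A L S.d ^ k := by
    rintro c _ ⟨n, b, hb, rfl⟩
    refine ⟨n, fun k => c * b k, fun k hk => by simp only [hb k hk, mul_zero], ?_⟩
    rw [Finset.mul_sum]
    exact Finset.sum_congr rfl fun k _ => by rw [map_mul, mul_assoc]
  have hadd : ∀ s t : Enveloping R A L, (∃ (n : ℕ) (b : ℕ → Enveloping R A C),
      (∀ k, n ≤ k → b k = 0) ∧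
      s = ∑ k ∈ Finset.range n, map R A g (b k) * ιL R A L S.d ^ k) →
      (∃ (n : ℕ) (b : ℕ → Enveloping R A C),
      (∀ k, n ≤ k → b k = 0) ∧
      t = ∑ k ∈ Finset.range n, map R A g (b k) * ιL R A L S.d ^ k) →
      ∃ (n : ℕ) (b : ℕ → Enveloping R A C), (∀ k, n ≤ k → b k = 0) ∧
      s + t = ∑ k ∈ Finset.range n, map R A g (b k) * ιL R A L S.d ^ k := by
    rintro _ _ ⟨n, b, hb, rfl⟩ ⟨m, b', hb', rfl⟩
    refine ⟨n + m, fun k => b k + b' k, fun k hk => ?_, ?_⟩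
    · simp only [hb k (by omega), hb' k (by omega), add_zero]
    · rw [ext n m b hb, ext m n b' hb', add_comm m n, ← Finset.sum_add_distrib]
      exact Finset.sum_congr rfl fun k _ => by rw [map_add, add_mul]
  induction u using Enveloping.induction_left with
  | h1 =>
    refine ⟨1, Pi.single 0 1, fun k hk => Pi.single_eq_of_ne (by omega) _, ?_⟩
    simp
  | hadd s t hs ht => exact hadd s t hs ht
  | hA a s hs =>
    rw [← map_ιA R A g]
    exact mulL _ _ hs
  | hL y s hs =>
    rw [S.decomp y, map_add, ιL_smul, add_mul, ← map_ιL, ← map_ιA R A g, mul_assoc]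
    refine hadd _ _ (mulL _ _ hs) (mulL _ _ ?_)
    obtain ⟨n, b, hb, rfl⟩ := hs
    rw [Finset.mul_sum]
    simp_rw [← mul_assoc, S.map_der, add_mul, Finset.sum_add_distrib]
    refine hadd _ _ ⟨n + 1, fun k => Nat.casesOn k 0 b, fun k hk => ?_, ?_⟩
      ⟨n, fun k => S.der (b k), fun k hk => by simp only [hb k hk, map_zero], rfl⟩
    · obtain ⟨j, rfl⟩ : ∃ j, k = j + 1 := ⟨k - 1, by omega⟩
      exact hb j (by omega)
    · rw [Finset.sum_range_succ']
      simp [mul_assoc, pow_succ']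

theorem coeff_sum (n : ℕ) (b : ℕ → Enveloping R A C) (hb : ∀ k, n ≤ k → b k = 0) (k : ℕ) :
    S.coeff k (∑ k ∈ Finset.range n, map R A g (b k) * ιL R A L S.d ^ k) = b k := by
  rw [map_sum]
  simp_rw [S.coeff_map_mul, S.coeff_pow]
  simp only [mul_ite, mul_one, mul_zero, Finset.sum_ite_eq, Finset.mem_range]
  split_ifs with h
  · rfl
  · exact (hb k (not_lt.1 h)).symm

/-- Every element of `U(L)` is the sum of its coefficients times powers of `d`. -/
theorem eq_sum_coeff (u : Enveloping R A L) : ∃ n : ℕ, (∀ k, n ≤ k → S.coeff k u = 0) ∧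
    u = ∑ k ∈ Finset.range n, map R A g (S.coeff k u) * ιL R A L S.d ^ k := by
  obtain ⟨n, b, hb, hu⟩ := S.exists_sum u
  have h : ∀ k, S.coeff k u = b k := fun k => by rw [hu, S.coeff_sum n b hb]
  refine ⟨n, fun k hk => by rw [h, hb k hk], ?_⟩
  simp_rw [h]
  exact hu

end Splitting

end Coefficients

end Enveloping

end

noncomputable section

/-! ### The enveloping algebra modulo `π` is noetherian -/

section Noetherian

variable {R : Type u} [CommRing R]

theorem IsNoetherianRing.isNoetherian_op {Q : Type u} [Ring Q] (h : IsNoetherianRing Qᵐᵒᵖ) :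
    IsNoetherian Qᵐᵒᵖ Q := by
  have h' : IsNoetherian Qᵐᵒᵖ Qᵐᵒᵖ := h
  let e : Qᵐᵒᵖ ≃ₗ[Qᵐᵒᵖ] Q :=
    { toFun := unop
      map_add' := fun _ _ => rfl
      map_smul' := fun _ _ => rfl
      invFun := op
      left_inv := fun _ => rfl
      right_inv := fun _ => rfl }
  exact isNoetherian_of_linearEquiv e

/-- A surjection modulo `π` onto `A` from a noetherian ring, and generators of `L` over `A`, exhibit
the opposite of `U(L) / π` as an almost commutative ring. -/
theorem isNoetherian_enveloping_quotient {A L : Type u} [CommRing A] [Algebra R A] [LieRing L]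
    [LieAlgebra R L] [Module A L] [LieRingModule L A] [Module.Finite A L]
    (π : R) {S₀ : Type u} [CommRing S₀] [IsNoetherianRing S₀] (β : S₀ →+* A)
    (hβ : ∀ a, ∃ p a', a = β p + π • a') :
    IsNoetherian (Enveloping R A L ⧸ powIdeal π (Enveloping R A L) 1)ᵐᵒᵖ
      (Enveloping R A L ⧸ powIdeal π (Enveloping R A L) 1) := by
  refine IsNoetherianRing.isNoetherian_op ?_
  let mk := Ideal.Quotient.mk (powIdeal π (Enveloping R A L) 1)
  obtain ⟨d, x, hx⟩ := Module.Finite.exists_fin (R := A) (M := L)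
  let κ : A →+* Enveloping R A L ⧸ powIdeal π (Enveloping R A L) 1 :=
    mk.comp (Enveloping.ιA R A L).toRingHom
  have hκ : ∀ a b, Commute (κ a) (κ b) := fun a b => (Commute.all a b).map κ
  let ι : S₀ →+* (Enveloping R A L ⧸ powIdeal π (Enveloping R A L) 1)ᵐᵒᵖ :=
    (κ.comp β).toOpposite fun a b => hκ (β a) (β b)
  have hι : ∀ a : A, ∃ b, ι b = op (κ a) := by
    intro a
    obtain ⟨p, a', rfl⟩ := hβ a
    refine ⟨p, ?_⟩
    have h0 : κ (π • a') = 0 := by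
      change mk (Enveloping.ιA R A L (π • a')) = 0
      rw [map_smul]
      have := mk_pow_smul_eq_zero (π := π) 1 (Enveloping.ιA R A L a')
      rwa [pow_one] at this
    rw [map_add, h0, add_zero]
    rfl
  -- `ι a * y i` is the class of `x i * β a`: coefficients stand on the right in `U(L)`
  let y : Fin d → (Enveloping R A L ⧸ powIdeal π (Enveloping R A L) 1)ᵐᵒᵖ :=
    fun i => op (mk (Enveloping.ιL R A L (x i)))
  have hAL : ∀ (i : Fin d) (a : A), op (κ a) * y i = y i * op (κ a) + op (κ ⁅x i, a⁆) := by
    intro i a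
    have h : κ ⁅x i, a⁆ = mk (Enveloping.ιL R A L (x i)) * κ a -
        κ a * mk (Enveloping.ιL R A L (x i)) := by
      change mk (Enveloping.ιA R A L ⁅x i, a⁆) = _
      rw [Enveloping.ιA_anchor, map_sub, map_mul, map_mul]
      rfl
    rw [h]
    refine unop_injective ?_
    change mk (Enveloping.ιL R A L (x i)) * κ a = κ a * mk (Enveloping.ιL R A L (x i)) + _
    exact (add_sub_cancel _ _).symm
  have hL : ∀ z : L, ∃ (b : S₀) (c : Fin d → S₀),
      op (mk (Enveloping.ιL R A L z)) = ι b + ∑ k, ι (c k) * y k := by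
    intro z
    obtain ⟨a, rfl⟩ := (Submodule.mem_span_range_iff_exists_fun A).1
      (hx ▸ Submodule.mem_top : z ∈ Submodule.span A (Set.range x))
    choose c hc using hι
    refine ⟨-∑ k, c ⁅x k, a k⁆, fun k => c (a k), ?_⟩
    have h1 : op (mk (Enveloping.ιL R A L (∑ i, a i • x i))) = ∑ i, y i * op (κ (a i)) := by
      rw [map_sum, map_sum, Finset.op_sum]
      refine Finset.sum_congr rfl fun i _ => ?_
      rw [Enveloping.ιL_smul, map_mul]
      rfl
    rw [h1, map_neg, map_sum]
    simp_rw [hc, hAL, Finset.sum_add_distrib]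
    abel
  have key : AlmostCommutative ι y := by
    refine ⟨fun i p => ?_, fun i j => ?_, fun s => ?_⟩
    · obtain ⟨b, hb⟩ := hι ⁅x i, β p⁆
      refine ⟨-b, ?_⟩
      have h := hAL i (β p)
      rw [map_neg, hb]
      change op (κ (β p)) * y i = _ at h
      change _ = op (κ (β p)) * y i + _
      rw [h, add_neg_cancel_right]
      rfl
    · obtain ⟨b, c, h⟩ := hL ⁅x j, x i⁆
      refine ⟨b, c, ?_⟩
      rw [add_assoc, ← h, Enveloping.ιL_lie, map_sub, map_mul, map_mul]
      refine unop_injective ?_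
      change _ = mk _ * mk _ + (_ - _)
      rw [add_sub_cancel]
      rfl
    · obtain ⟨u, hu⟩ := Ideal.Quotient.mk_surjective s.unop
      obtain rfl : s = op (mk u) := unop_injective hu.symm
      clear hu
      have hA : ∀ a, op (κ a) ∈ Subring.closure (Set.range ι ∪ Set.range y) := fun a => by
        obtain ⟨b, hb⟩ := hι a
        exact Subring.subset_closure (Or.inl ⟨b, hb⟩)
      induction u using Enveloping.induction with
      | h0 r =>
        have h := hA (algebraMap R A r)
        change op (mk (Enveloping.ιA R A L _)) ∈ _ at h
        rwa [AlgHom.commutes] at h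
      | hA a => exact hA a
      | hL z =>
        obtain ⟨b, c, h⟩ := hL z
        rw [h]
        exact add_mem (Subring.subset_closure (Or.inl ⟨b, rfl⟩)) (sum_mem fun k _ =>
          mul_mem (Subring.subset_closure (Or.inl ⟨_, rfl⟩))
            (Subring.subset_closure (Or.inr ⟨k, rfl⟩)))
      | hmul s t hs ht => rw [map_mul, op_mul]; exact mul_mem ht hs
      | hadd s t hs ht => rw [map_add, MulOpposite.op_add]; exact add_mem hs ht
  exact key.isNoetherianRing

end Noetherian

/-! ### Strictly convergent power series modulo `π` -/

section Tate

variable (R K : Type u) [CommRing R] [IsDomain R] [Field K] [Algebra R K] [IsFractionRing R K]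

/-- Polynomials as strictly convergent power series. -/
def polynomialToTate (n : ℕ) : MvPolynomial (Fin n) R →ₐ[R] integralTateAlgebra R K n :=
  AlgHom.codRestrict ((MvPowerSeries.mapAlgHom (σ := Fin n) (Algebra.ofId R K)).comp
    (MvPolynomial.coeToMvPowerSeries.algHom R)) _ fun p => by
    refine ⟨fun s _ => ?_, ⟨_, rfl⟩⟩
    rw [Filter.eventually_cofinite]
    refine p.support.finite_toSet.subset fun α hα => ?_
    by_contra h
    refine hα ⟨0, ?_⟩
    have h0 : p.coeff α = 0 := by simpa using h
    simp [MvPowerSeries.mapAlgHom, h0]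

theorem coeff_polynomialToTate {n : ℕ} (p : MvPolynomial (Fin n) R) (α : Fin n →₀ ℕ) :
    MvPowerSeries.coeff α (polynomialToTate R K n p : MvPowerSeries (Fin n) K) =
      algebraMap R K (p.coeff α) := by
  simp [polynomialToTate, MvPowerSeries.mapAlgHom]

/-- A strictly convergent power series is a polynomial modulo `π`. -/
theorem exists_polynomial_add {π : R} (hπ0 : π ≠ 0) {n : ℕ} (f : integralTateAlgebra R K n) :
    ∃ (p : MvPolynomial (Fin n) R) (h : integralTateAlgebra R K n),
      f = polynomialToTate R K n p + π • h := by
  classical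
  obtain ⟨f, hf, g, hg⟩ := f
  have inj := IsFractionRing.injective R K
  have hπ' : algebraMap R K π ≠ 0 := (map_ne_zero_iff _ inj).2 hπ0
  have hfg : ∀ α, MvPowerSeries.coeff α f = algebraMap R K (MvPowerSeries.coeff α g) := by
    intro α
    rw [← hg]
    rfl
  have hfin := hf π hπ0
  rw [Filter.eventually_cofinite] at hfin
  let p : MvPolynomial (Fin n) R :=
    ∑ α ∈ hfin.toFinset, MvPolynomial.monomial α (MvPowerSeries.coeff α g)
  have hp : ∀ α, p.coeff α = if α ∈ hfin.toFinset then MvPowerSeries.coeff α g else 0 := by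
    intro α
    simp only [p, MvPolynomial.coeff_sum, MvPolynomial.coeff_monomial, Finset.sum_ite_eq']
  have hdiv : ∀ α, ∃ c, MvPowerSeries.coeff α g - p.coeff α = π * c := by
    intro α
    rw [hp]
    split_ifs with h
    · exact ⟨0, by rw [sub_self, mul_zero]⟩
    · rw [Set.Finite.mem_toFinset, Set.mem_ofPred_eq, not_not] at h
      obtain ⟨c, hc⟩ := h
      exact ⟨c, by rw [sub_zero]; exact inj (by rw [← hfg, hc])⟩
  choose c hc using hdiv
  have hpK := coeff_polynomialToTate R K p
  let h : MvPowerSeries (Fin n) K := fun α => algebraMap R K (c α)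
  have hh : ∀ α, MvPowerSeries.coeff α h = algebraMap R K (c α) := fun α => rfl
  refine ⟨p, ⟨h, ?_, fun α => c α, rfl⟩, Subtype.ext (MvPowerSeries.ext fun α => ?_)⟩
  · intro s hs
    filter_upwards [hf (π * s) (mul_ne_zero hπ0 hs),
      (polynomialToTate R K n p).2.1 (π * s) (mul_ne_zero hπ0 hs)] with α ⟨a, ha⟩ ⟨b, hb⟩
    refine ⟨a - b, ?_⟩
    rw [hh]
    congr 1
    refine mul_left_cancel₀ hπ0 ?_
    rw [← hc]
    refine inj ?_
    rw [map_sub, ← hfg, ← hpK, ha, hb, ← map_sub]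
    congr 1
    ring
  · change MvPowerSeries.coeff α f = MvPowerSeries.coeff α
      ((polynomialToTate R K n p : MvPowerSeries (Fin n) K) + π • h)
    rw [map_add, hpK, hfg]
    change _ = _ + π • algebraMap R K (c α)
    rw [Algebra.smul_def, ← map_mul, ← map_add, ← hc, add_sub_cancel]

/-- An admissible algebra is a quotient of a polynomial ring modulo `π`. -/
theorem IsAdmissibleAlgebra.exists_polynomial {B : Type u} [CommRing B] [Algebra R B]
    (hB : IsAdmissibleAlgebra R K B) {π : R} (hπ0 : π ≠ 0) :
    ∃ (n : ℕ) (β : MvPolynomial (Fin n) R →+* B), ∀ a, ∃ p a', a = β p + π • a' := by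
  obtain ⟨⟨n, φ, hφ⟩, -⟩ := hB
  refine ⟨n, (φ.comp (polynomialToTate R K n)).toRingHom, fun a => ?_⟩
  obtain ⟨f, rfl⟩ := hφ a
  obtain ⟨p, h, rfl⟩ := exists_polynomial_add R K hπ0 f
  exact ⟨p, φ h, by rw [map_add, map_smul]; rfl⟩

end Tate

section Ball

variable {R K : Type u} [CommRing R] [IsDomain R] [IsDiscreteValuationRing R] [Field K]
  [Algebra R K] [IsFractionRing R K] {π : R}
  {A : Type u} [CommRing A] [Algebra K A] [Algebra R A]
  (𝒜 : Subalgebra R A) [IsAffineFormalModel R K 𝒜]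
  (L : Type u) [LieRing L] [LieAlgebra R L] [Module 𝒜 L] [LieRingModule L 𝒜] [Module.Finite 𝒜 L]

/-- `Û(L)` is a complete noetherian unit ball in `Û(L)_K`. -/
theorem completeBall_UHat (hπ0 : π ≠ 0) (hπ : ¬ IsUnit π) : CompleteBall π
    (Algebra.TensorProduct.includeRight : UHat π 𝒜 L →ₐ[R] UHatK K π 𝒜 L) := by
  obtain ⟨n, β, hβ⟩ := (IsAffineFormalModel.admissible (R := R) (K := K)
    (𝒜 := 𝒜)).exists_polynomial R K hπ0
  exact completeBall_completion hπ0 (fun s hs => exists_dvd_pow hπ hs)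
    (isNoetherian_enveloping_quotient π β hβ)

end Ball

end

noncomputable section

/-! ### The centraliser of one function -/

section CompletionLinear

variable {R : Type u} [CommRing R] {π : R} {B B' : Type u} [Ring B] [Algebra R B] [Ring B']
  [Algebra R B'] (T : B →ₗ[R] B')

theorem mk_linear_eq {n : ℕ} {b b' : B} (h : Ideal.Quotient.mk (powIdeal π B n) b =
    Ideal.Quotient.mk (powIdeal π B n) b') :
    Ideal.Quotient.mk (powIdeal π B' n) (T b) = Ideal.Quotient.mk (powIdeal π B' n) (T b') := by
  rw [← sub_eq_zero, ← map_sub] at h ⊢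
  obtain ⟨c, hc⟩ := exists_of_mk_eq_zero h
  rw [← map_sub, hc, map_smul]
  exact mk_pow_smul_eq_zero n _

theorem exists_completionLinear (z : Completion π B) : ∃ w : Completion π B', ∀ n b,
    Ideal.Quotient.mk (powIdeal π B n) b = z.1 n →
      w.1 n = Ideal.Quotient.mk (powIdeal π B' n) (T b) := by
  choose b hb using fun n => Ideal.Quotient.mk_surjective (z.1 n)
  refine ⟨⟨fun n => Ideal.Quotient.mk (powIdeal π B' n) (T (b n)), fun m n hmn => ?_⟩,
    fun n b' h => mk_linear_eq T ((hb n).trans h.symm)⟩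
  refine mk_linear_eq T ?_
  rw [hb, ← z.2 m n hmn, ← hb n]
  rfl

variable (π) in
/-- The map of `π`-adic completions induced by an `R`-linear map. -/
def completionLinear : Completion π B →ₗ[R] Completion π B' where
  toFun z := (exists_completionLinear T z).choose
  map_add' z z' := Completion.ext' fun n => by
    obtain ⟨b, hb⟩ := Ideal.Quotient.mk_surjective (z.1 n)
    obtain ⟨b', hb'⟩ := Ideal.Quotient.mk_surjective (z'.1 n)
    have h : Ideal.Quotient.mk (powIdeal π B n) (b + b') = (z + z').1 n := by
      rw [map_add, hb, hb']; rfl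
    rw [(exists_completionLinear T (z + z')).choose_spec n _ h, map_add, map_add,
      ← (exists_completionLinear T z).choose_spec n _ hb,
      ← (exists_completionLinear T z').choose_spec n _ hb']
    rfl
  map_smul' r z := Completion.ext' fun n => by
    obtain ⟨b, hb⟩ := Ideal.Quotient.mk_surjective (z.1 n)
    have h : Ideal.Quotient.mk (powIdeal π B n) (r • b) = (r • z).1 n := by
      rw [Completion.val_smul, ← hb]; rfl
    rw [(exists_completionLinear T (r • z)).choose_spec n _ h, map_smul, RingHom.id_apply,
      Completion.val_smul, (exists_completionLinear T z).choose_spec n _ hb]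
    rfl

theorem completionLinear_val {z : Completion π B} {n : ℕ} {b : B}
    (h : Ideal.Quotient.mk (powIdeal π B n) b = z.1 n) :
    (completionLinear π T z).1 n = Ideal.Quotient.mk (powIdeal π B' n) (T b) :=
  (exists_completionLinear T z).choose_spec n b h

theorem completionLinear_toCompletion (b : B) :
    completionLinear π T (toCompletion π B b) = toCompletion π B' (T b) :=
  Completion.ext' fun _ => completionLinear_val T rfl

variable {T} {g : B' →ₐ[R] B}

theorem completionLinear_mul (hT : ∀ b' b, T (g b' * b) = b' * T b) (v : Completion π B')
    (u : Completion π B) :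
    completionLinear π T (completionMap π g v * u) = v * completionLinear π T u :=
  Completion.ext' fun n => by
    obtain ⟨b, hb⟩ := Ideal.Quotient.mk_surjective (v.1 n)
    obtain ⟨b', hb'⟩ := Ideal.Quotient.mk_surjective (u.1 n)
    have h : Ideal.Quotient.mk (powIdeal π _ n) (g b * b') = (completionMap π g v * u).1 n := by
      have e : (completionMap π g v).1 n = Ideal.Quotient.mk (powIdeal π _ n) (g b) := by
        change Ideal.quotientMap _ _ _ (v.1 n) = _
        rw [← hb]
        rfl
      rw [map_mul, ← e, hb']
      rfl
    rw [completionLinear_val _ h, hT, map_mul, hb, ← completionLinear_val _ hb']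
    rfl

theorem baseChange_completionLinear_mul (K : Type u) [Field K] [Algebra R K]
    (hT : ∀ b' b, T (g b' * b) = b' * T b)
    (v : K ⊗[R] Completion π B') (u : K ⊗[R] Completion π B) :
    (completionLinear π T).baseChange K
        (Algebra.TensorProduct.map (AlgHom.id K K) (completionMap π g) v * u) =
      v * (completionLinear π T).baseChange K u := by
  induction v using TensorProduct.induction_on with
  | zero => rw [map_zero, zero_mul, zero_mul, map_zero]
  | add v v' hv hv' => rw [map_add, add_mul, add_mul, map_add, hv, hv']
  | tmul c z =>
    induction u using TensorProduct.induction_on with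
    | zero => rw [mul_zero, map_zero, mul_zero]
    | add u u' hu hu' => rw [mul_add, map_add, hu, hu', map_add, mul_add]
    | tmul c' z' =>
      rw [Algebra.TensorProduct.map_tmul, Algebra.TensorProduct.tmul_mul_tmul,
        LinearMap.baseChange_tmul, LinearMap.baseChange_tmul, Algebra.TensorProduct.tmul_mul_tmul,
        completionLinear_mul hT]
      rfl

end CompletionLinear

section Act

variable {R K : Type u} [CommRing R] [IsDomain R] [Field K] [Algebra R K] [IsFractionRing R K]
  {A : Type u} [CommRing A] [Algebra K A] [Algebra R A] [IsScalarTower R K A]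
  (𝒜 : Subalgebra R A) [IsAffineFormalModel R K 𝒜]
  {L : Type u} [LieRing L] [LieAlgebra R L] [Module 𝒜 L] [LieRingModule L 𝒜]
  [LieRinehartRing 𝒜 L] [LieRinehartAlgebra R 𝒜 L]

theorem act_one (x : L) : act R K 𝒜 x 1 = 0 := by
  have h1 : (1 : A) = modelEquiv R K 𝒜 ((1 : K) ⊗ₜ[R] (1 : 𝒜)) := by
    rw [modelEquiv_tmul, one_smul]; rfl
  have h0 : ⁅x, (1 : 𝒜)⁆ = 0 := by
    have := LieRinehartRing.leibniz_mul_right x (1 : 𝒜) 1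
    rw [mul_one, one_smul, mul_one] at this
    simpa using this
  rw [h1, act_modelEquiv, h0, tmul_zero, map_zero]

theorem act_add_left (x y : L) (f : A) :
    act R K 𝒜 (x + y) f = act R K 𝒜 x f + act R K 𝒜 y f := by
  obtain ⟨s, a, -, rfl⟩ := exists_eq_modelEquiv_tmul R K 𝒜 f
  simp only [act_modelEquiv, add_lie, tmul_add, map_add]

theorem act_smul_left (b : 𝒜) (x : L) (f : A) :
    act R K 𝒜 (b • x) f = b * act R K 𝒜 x f := by
  obtain ⟨s, a, -, rfl⟩ := exists_eq_modelEquiv_tmul R K 𝒜 f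
  rw [act_modelEquiv, act_modelEquiv, modelEquiv_tmul, modelEquiv_tmul,
    LieRinehartRing.lie_smul_eq_mul, Subalgebra.coe_mul, mul_smul_comm]

theorem act_lie (x y : L) (f : A) : act R K 𝒜 ⁅x, y⁆ f =
    act R K 𝒜 x (act R K 𝒜 y f) - act R K 𝒜 y (act R K 𝒜 x f) := by
  obtain ⟨s, a, -, rfl⟩ := exists_eq_modelEquiv_tmul R K 𝒜 f
  simp only [act_modelEquiv, lie_lie, tmul_sub, map_sub]

/-- The commutator of `y ∈ L` with a function is given by the action of `y`. -/
theorem ιL_mul_functionMap (π : R) (y : L) (f : A) :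
    ((1 : K) ⊗ₜ[R] toCompletion π _ (Enveloping.ιL R 𝒜 L y) : UHatK K π 𝒜 L) *
        functionMap K π 𝒜 L f =
      functionMap K π 𝒜 L f * (1 : K) ⊗ₜ[R] toCompletion π _ (Enveloping.ιL R 𝒜 L y) +
        functionMap K π 𝒜 L (act R K 𝒜 y f) := by
  obtain ⟨s, a, -, rfl⟩ := exists_eq_modelEquiv_tmul R K 𝒜 f
  rw [act_modelEquiv, functionMap_modelEquiv, functionMap_modelEquiv,
    Algebra.TensorProduct.tmul_mul_tmul, Algebra.TensorProduct.tmul_mul_tmul, one_mul, mul_one,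
    ← tmul_add, Enveloping.ιA_anchor, map_sub, map_mul, map_mul, add_sub_cancel]

/-- If `d · f = 1` and `L · f ⊆ 𝒜`, then `L = C_L(f) ⊕ 𝒜 d`. -/
def centraliserSplitting (f : A) (hf : ∀ y : L, act R K 𝒜 y f ∈ 𝒜) (d : L)
    (hd : act R K 𝒜 d f = 1) :
    Enveloping.Splitting ((centraliser R K 𝒜 {f} : LieRinehartSubalgebra 𝒜 L).incl R) where
  d := d
  q :=
    { toFun := fun y => ⟨act R K 𝒜 y f, hf y⟩
      map_add' := fun y z => Subtype.ext (act_add_left 𝒜 y z f)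
      map_smul' := fun b y => Subtype.ext (act_smul_left 𝒜 b y f) }
  p :=
    { toFun := fun y => ⟨y - (⟨act R K 𝒜 y f, hf y⟩ : 𝒜) • d, by
        rintro _ rfl
        rw [sub_eq_add_neg, ← neg_smul, act_add_left, act_smul_left, hd, mul_one]
        exact add_neg_cancel _⟩
      map_add' := fun y z => Subtype.ext (by
        have h : (⟨act R K 𝒜 (y + z) f, hf (y + z)⟩ : 𝒜) =
          ⟨act R K 𝒜 y f, hf y⟩ + ⟨act R K 𝒜 z f, hf z⟩ := Subtype.ext (act_add_left 𝒜 y z f)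
        change y + z - _ • d = (y - _ • d) + (z - _ • d)
        rw [h, add_smul]
        abel)
      map_smul' := fun b y => Subtype.ext (by
        have h : (⟨act R K 𝒜 (b • y) f, hf (b • y)⟩ : 𝒜) = b * ⟨act R K 𝒜 y f, hf y⟩ :=
          Subtype.ext (act_smul_left 𝒜 b y f)
        change b • y - _ • d = b • (y - _ • d)
        rw [h, mul_smul, smul_sub]) }
  decomp y := (sub_add_cancel _ _).symm
  p_incl c := Subtype.ext (by
    have h : (⟨act R K 𝒜 (c : L) f, hf c⟩ : 𝒜) = 0 := Subtype.ext (c.2 f rfl)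
    change (c : L) - (⟨act R K 𝒜 (c : L) f, hf c⟩ : 𝒜) • d = c
    rw [h, zero_smul, sub_zero])
  q_incl c := Subtype.ext (c.2 f rfl)
  p_d := Subtype.ext (by
    have h : (⟨act R K 𝒜 d f, hf d⟩ : 𝒜) = 1 := Subtype.ext hd
    change d - _ • d = 0
    rw [h, one_smul, sub_self])
  q_d := Subtype.ext hd
  normal c := Subtype.ext (by
    change act R K 𝒜 ⁅d, (c : L)⁆ f = 0
    rw [act_lie, c.2 f rfl, map_zero, hd, act_one, sub_zero])

theorem centraliser_finite [Module.Finite 𝒜 L] (f : A) (hf : ∀ y : L, act R K 𝒜 y f ∈ 𝒜) (d : L)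
    (hd : act R K 𝒜 d f = 1) :
    Module.Finite 𝒜 (centraliser R K 𝒜 {f} : LieRinehartSubalgebra 𝒜 L) :=
  Module.Finite.of_surjective (centraliserSplitting 𝒜 f hf d hd).p fun c =>
    ⟨_, (centraliserSplitting 𝒜 f hf d hd).p_incl c⟩

end Act

section Step

set_option linter.unusedSectionVars false

variable {R K : Type u} [CommRing R] [IsDomain R] [IsDiscreteValuationRing R] [Field K] [CharZero K]
  [Algebra R K] [IsFractionRing R K] {π : R}
  {A : Type u} [CommRing A] [Algebra K A] [Algebra R A] [IsScalarTower R K A]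
  (𝒜 : Subalgebra R A) [IsAffineFormalModel R K 𝒜]
  {L C : Type u} [LieRing L] [LieAlgebra R L] [Module 𝒜 L] [LieRingModule L 𝒜]
  [LieRinehartRing 𝒜 L] [LieRinehartAlgebra R 𝒜 L] [Module.Finite 𝒜 L]
  [LieRing C] [LieAlgebra R C] [Module 𝒜 C] [LieRingModule C 𝒜]
  [LieRinehartRing 𝒜 C] [LieRinehartAlgebra R 𝒜 C] [Module.Finite 𝒜 C]
  {g : LieRinehartAlgebra.Hom (AlgHom.id R 𝒜) C L}

variable (K) in
/-- The divided power `fⁿ / n!` in `Û(L)_K`. -/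
def dividedPower (π : R) (L : Type u) [LieRing L] [LieAlgebra R L] [Module 𝒜 L] [LieRingModule L 𝒜]
    (f : A) (n : ℕ) : UHatK K π 𝒜 L :=
  functionMap K π 𝒜 L ((n.factorial : K)⁻¹ • f ^ n)

/-- A splitting `L = C ⊕ 𝒜 d` with `d · f = 1` and `f` central in `Û(C)_K` makes `Û(L)_K` a ring of
differential operators in one variable over `Û(C)_K`. -/
def Enveloping.Splitting.oreStep (S : Enveloping.Splitting g) (hπ0 : π ≠ 0) (hπ : ¬ IsUnit π)
    (f : A) (hcentral : ∀ v, Commute (functionMap K π 𝒜 C f) v) (hd : act R K 𝒜 S.d f = 1) :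
    OreStep π (Algebra.TensorProduct.includeRight : UHat π 𝒜 C →ₐ[R] UHatK K π 𝒜 C)
      (Algebra.TensorProduct.includeRight : UHat π 𝒜 L →ₐ[R] UHatK K π 𝒜 L)
      (completionMap π (Enveloping.map R 𝒜 g)) (UHatK.map K π 𝒜 g).toRingHom
      (functionMap K π 𝒜 C f) (dividedPower K 𝒜 π C f) where
  D := toCompletion π _ (Enveloping.ιL R 𝒜 L S.d)
  c₀ k := completionLinear π (S.coeff k)
  c k := ((completionLinear π (S.coeff k)).baseChange K).toAddMonoidHom
  ballV := completeBall_UHat 𝒜 C hπ0 hπ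
  ballU := completeBall_UHat 𝒜 L hπ0 hπ
  map_ι v := by
    change UHatK.map K π 𝒜 g (1 ⊗ₜ v) = _
    rw [UHatK.map, Algebra.TensorProduct.map_tmul]
    rfl
  central := hcentral
  comm := by
    have h := ιL_mul_functionMap (K := K) 𝒜 π S.d f
    rw [hd, map_one] at h
    have e : (UHatK.map K π 𝒜 g).toRingHom (functionMap K π 𝒜 C f) = functionMap K π 𝒜 L f :=
      UHatK.map_functionMap K π 𝒜 g f
    rw [e]
    exact h
  c₀_mul k := completionLinear_mul (S.coeff_map_mul k)
  c₀_pow k j := by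
    rw [← map_pow, completionLinear_toCompletion, S.coeff_pow]
    split_ifs
    · exact map_one _
    · exact map_zero _
  c₀_null u n := by
    obtain ⟨b, hb⟩ := Ideal.Quotient.mk_surjective (u.1 n)
    obtain ⟨N, hN, -⟩ := S.eq_sum_coeff b
    filter_upwards [Filter.eventually_ge_atTop N] with k hk
    refine Completion.exists_eq_pow_smul ?_
    rw [completionLinear_val _ hb, hN k hk, map_zero]
  c₀_inj u hu := Completion.ext' fun n => by
    obtain ⟨b, hb⟩ := Ideal.Quotient.mk_surjective (u.1 n)
    obtain ⟨N, -, hN⟩ := S.eq_sum_coeff b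
    have h : ∀ k, ∃ c, S.coeff k b = π ^ n • c := fun k => by
      refine exists_of_mk_eq_zero ?_
      rw [← completionLinear_val _ hb, hu k]
      rfl
    choose c hc using h
    have e : b = π ^ n • ∑ k ∈ Finset.range N,
        Enveloping.map R 𝒜 g (c k) * Enveloping.ιL R 𝒜 L S.d ^ k := by
      rw [hN, Finset.smul_sum]
      refine Finset.sum_congr rfl fun k _ => ?_
      rw [hc, map_smul, smul_mul_assoc]
    rw [← hb, e]
    exact mk_pow_smul_eq_zero n _
  c_mul k := baseChange_completionLinear_mul K (S.coeff_map_mul k)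
  c_ι k u := by
    change (completionLinear π (S.coeff k)).baseChange K (1 ⊗ₜ u) = _
    rw [LinearMap.baseChange_tmul]
    rfl
  xd_zero := by
    rw [dividedPower, Nat.factorial_zero, Nat.cast_one, inv_one, one_smul, pow_zero, map_one]
  xd_succ n := by
    rw [dividedPower, dividedPower, ← map_mul, ← map_nsmul]
    congr 1
    rw [Nat.factorial_succ, pow_succ, smul_mul_assoc, ← Nat.cast_smul_eq_nsmul K, smul_smul]
    congr 1
    have h1 : ((n + 1 : ℕ) : K) ≠ 0 := Nat.cast_ne_zero.2 (Nat.succ_ne_zero n)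
    rw [Nat.cast_mul, mul_inv, ← mul_assoc, mul_inv_cancel₀ h1, one_mul]
  nat_unit n := by
    have h1 : IsUnit ((n + 1 : ℕ) : K) := (Nat.cast_ne_zero.2 (Nat.succ_ne_zero n)).isUnit
    have := h1.map (algebraMap K (UHatK K π 𝒜 C))
    rwa [map_natCast] at this

end Step

end

noncomputable section

/-! ### Functoriality, coordinates and centralisers -/

section KilledBy

variable {V U : Type u} [Ring V] [Ring U] {φ : V →+* U} {s : Set V} {t : Set U}

/-- The right `V`-module structure on `M[φ(s)]`, for `s` central in `V`. -/
@[reducible] def killedByBaseModule (hs : ∀ z ∈ s, ∀ v : V, Commute z v) (hst : φ '' s = t)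
    (M : Type u) [AddCommGroup M] [Module Uᵐᵒᵖ M] : Module Vᵐᵒᵖ (killedBy t M) :=
  Module.compHom (killedBy t M) ((RingEquiv.opOp (AddMonoid.End (killedBy t M))).symm.toRingHom.comp
    (RingHom.op (killedByAction hs hst M)))

end KilledBy

section Bijective

variable {V U N M : Type u} [Ring V] [Ring U] [AddCommGroup N] [Module Vᵐᵒᵖ N] [AddCommGroup M]
  [Module Uᵐᵒᵖ M] {φ : V →+* U} {j : N →+ M}

/-- Induction along an isomorphism of rings does not change the module. -/
theorem IsInduced.bijective (hφ : Function.Bijective φ) (hj : IsInduced φ j) :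
    Function.Bijective j := by
  constructor
  · let e := RingEquiv.ofBijective φ hφ
    let : Module Uᵐᵒᵖ N := Module.compHom N (RingHom.op e.symm.toRingHom)
    obtain ⟨h, hh⟩ := hj.univ N (AddMonoidHom.id N) fun v n => by
      change op v • n = op (e.symm (e v)) • n
      rw [e.symm_apply_apply]
    exact Function.LeftInverse.injective (g := h) hh
  · intro m
    have hm : m ∈ Submodule.span Uᵐᵒᵖ (Set.range j) := hj.gen ▸ Submodule.mem_top
    induction hm using Submodule.span_induction with
    | mem x hx => exact hx
    | zero => exact ⟨0, map_zero j⟩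
    | add x y _ _ hx hy =>
      obtain ⟨x, rfl⟩ := hx
      obtain ⟨y, rfl⟩ := hy
      exact ⟨x + y, map_add j x y⟩
    | smul a x _ hx =>
      obtain ⟨x, rfl⟩ := hx
      obtain ⟨v, hv⟩ := hφ.2 a.unop
      exact ⟨op v • x, by rw [hj.semi, hv, op_unop]⟩

theorem isInduced_of_bijective (hφ : Function.Surjective φ)
    (hj : ∀ v n, j (op v • n) = op (φ v) • j n) (hbij : Function.Bijective j) :
    IsInduced φ j where
  semi := hj
  gen := by rw [hbij.2.range_eq, Submodule.span_univ]
  univ P _ _ g hg := by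
    let e := AddEquiv.ofBijective j hbij
    have he : ∀ n, e.symm (j n) = n := e.symm_apply_apply
    refine ⟨{ toFun := fun m => g (e.symm m), map_add' := fun m m' => by rw [map_add, map_add],
              map_smul' := fun a m => ?_ }, fun n => congrArg g (he n)⟩
    obtain ⟨n, rfl⟩ := hbij.2 m
    obtain ⟨v, hv⟩ := hφ a.unop
    rw [← op_unop a, ← hv, ← hj, he, he, hg]
    rfl

theorem finite_of_bijective (hφ : Function.Surjective φ) [Module.Finite Uᵐᵒᵖ M]
    (hj : ∀ v n, j (op v • n) = op (φ v) • j n) (hbij : Function.Bijective j) :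
    Module.Finite Vᵐᵒᵖ N := by
  obtain ⟨k, s, hs⟩ := Module.Finite.exists_fin (R := Uᵐᵒᵖ) (M := M)
  choose t ht using fun i => hbij.2 (s i)
  refine ⟨Submodule.fg_def.2 ⟨Set.range t, Set.finite_range _, eq_top_iff.2 fun n _ => ?_⟩⟩
  obtain ⟨c, hc⟩ := (Submodule.mem_span_range_iff_exists_fun _).1
    (hs ▸ Submodule.mem_top : j n ∈ Submodule.span Uᵐᵒᵖ (Set.range s))
  choose v hv using fun i => hφ (c i).unop
  have : n = ∑ i, op (v i) • t i := hbij.1 (by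
    rw [← hc, map_sum]
    exact Finset.sum_congr rfl fun i _ => by rw [hj, hv, ht, op_unop])
  rw [this]
  exact sum_mem fun i _ => Submodule.smul_mem _ _ (Submodule.subset_span ⟨i, rfl⟩)

end Bijective

section Functoriality

variable {R K : Type u} [CommRing R] [IsDomain R] [Field K] [Algebra R K] [IsFractionRing R K]
  {π : R} {A : Type u} [CommRing A] [Algebra K A] [Algebra R A] [IsScalarTower R K A]
  {𝒜 : Subalgebra R A}
  {C L L₁ : Type u} [LieRing L] [LieAlgebra R L] [Module 𝒜 L] [LieRingModule L 𝒜]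
  [LieRing C] [LieAlgebra R C] [Module 𝒜 C] [LieRingModule C 𝒜]
  [LieRing L₁] [LieAlgebra R L₁] [Module 𝒜 L₁] [LieRingModule L₁ 𝒜]

set_option linter.unusedSectionVars false

/-- Functoriality of `Û(L)_K`, for a composition that is only known pointwise. -/
theorem UHatK.map_eq_of_forall {g : LieRinehartAlgebra.Hom (AlgHom.id R 𝒜) C L}
    {g₁ : LieRinehartAlgebra.Hom (AlgHom.id R 𝒜) C L₁}
    {k : LieRinehartAlgebra.Hom (AlgHom.id R 𝒜) L₁ L} (h : ∀ c, g c = k (g₁ c))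
    (v : UHatK K π 𝒜 C) : UHatK.map K π 𝒜 g v = UHatK.map K π 𝒜 k (UHatK.map K π 𝒜 g₁ v) := by
  have h1 : Enveloping.map R 𝒜 g = (Enveloping.map R 𝒜 k).comp (Enveloping.map R 𝒜 g₁) :=
    Enveloping.algHom_ext (fun a => by
      rw [AlgHom.comp_apply, Enveloping.map_ιA, Enveloping.map_ιA, Enveloping.map_ιA])
      fun x => by
        rw [AlgHom.comp_apply, Enveloping.map_ιL, Enveloping.map_ιL, Enveloping.map_ιL, h]
  have h2 : ∀ z, completionMap π (Enveloping.map R 𝒜 g) z =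
      completionMap π (Enveloping.map R 𝒜 k) (completionMap π (Enveloping.map R 𝒜 g₁) z) := by
    intro z
    refine Completion.ext' fun n => ?_
    change Ideal.quotientMap _ _ _ (z.1 n) =
      Ideal.quotientMap _ _ _ (Ideal.quotientMap _ _ _ (z.1 n))
    obtain ⟨b, hb⟩ := Ideal.Quotient.mk_surjective (z.1 n)
    rw [← hb]
    exact congrArg (Ideal.Quotient.mk _) (DFunLike.congr_fun h1 b)
  induction v using TensorProduct.induction_on with
  | zero => simp
  | add x y hx hy => rw [map_add, map_add, map_add, hx, hy]
  | tmul c z =>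
    simp only [UHatK.map, Algebra.TensorProduct.map_tmul]
    rw [h2]
    rfl

theorem UHatK.map_id (v : UHatK K π 𝒜 L) :
    UHatK.map K π 𝒜 (LieRinehartAlgebra.Hom.id : LieRinehartAlgebra.Hom (AlgHom.id R 𝒜) L L) v =
      v := by
  have h1 : Enveloping.map R 𝒜 (LieRinehartAlgebra.Hom.id :
      LieRinehartAlgebra.Hom (AlgHom.id R 𝒜) L L) = AlgHom.id R _ :=
    Enveloping.algHom_ext (fun a => by rw [Enveloping.map_ιA]; rfl)
      fun x => by rw [Enveloping.map_ιL]; rfl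
  have h2 : ∀ z, completionMap π (Enveloping.map R 𝒜 (LieRinehartAlgebra.Hom.id :
      LieRinehartAlgebra.Hom (AlgHom.id R 𝒜) L L)) z = z := by
    intro z
    refine Completion.ext' fun n => ?_
    change Ideal.quotientMap _ _ _ (z.1 n) = _
    obtain ⟨b, hb⟩ := Ideal.Quotient.mk_surjective (z.1 n)
    rw [← hb]
    exact congrArg (Ideal.Quotient.mk _) (DFunLike.congr_fun h1 b)
  induction v using TensorProduct.induction_on with
  | zero => simp
  | add x y hx hy => rw [map_add, hx, hy]
  | tmul c z =>
    simp only [UHatK.map, Algebra.TensorProduct.map_tmul]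
    rw [h2]
    rfl

theorem UHatK.map_bijective {g : LieRinehartAlgebra.Hom (AlgHom.id R 𝒜) C L}
    (hg : Function.Bijective g) : Function.Bijective (UHatK.map K π 𝒜 g) := by
  let e := Equiv.ofBijective g hg
  have he : ∀ x, g (e.symm x) = x := e.apply_symm_apply
  let k : LieRinehartAlgebra.Hom (AlgHom.id R 𝒜) L C :=
    { toFun := e.symm
      map_add' := fun x y => hg.1 (by
        refine Eq.trans ?_ (map_add g.toLieHom (e.symm x) (e.symm y)).symm
        rw [he, he, he])
      map_smul' := fun r x => hg.1 (by
        refine Eq.trans ?_ (map_smul g.toLieHom r (e.symm x)).symm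
        rw [he, he])
      map_lie' := fun {x y} => hg.1 (by
        refine (he ⁅x, y⁆).trans (Eq.trans ?_ (g.toLieHom.map_lie (e.symm x) (e.symm y)).symm)
        rw [he, he])
      map_smul_apply' := fun a x => hg.1 (by
        refine (he (a • x)).trans (Eq.trans ?_ (g.map_smul_apply a (e.symm x)).symm)
        rw [he]
        rfl)
      apply_lie' := fun a x => by
        have := g.apply_lie a (e.symm x)
        rw [he] at this
        exact this.symm }
  refine Function.bijective_iff_has_inverse.2 ⟨UHatK.map K π 𝒜 k, fun v => ?_, fun v => ?_⟩
  · exact (UHatK.map_eq_of_forall (g := (LieRinehartAlgebra.Hom.id :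
      LieRinehartAlgebra.Hom (AlgHom.id R 𝒜) C C)) (g₁ := g) (k := k)
      (fun c => (e.symm_apply_apply c).symm) v).symm.trans (UHatK.map_id v)
  · exact (UHatK.map_eq_of_forall (g := (LieRinehartAlgebra.Hom.id :
      LieRinehartAlgebra.Hom (AlgHom.id R 𝒜) L L)) (g₁ := k) (k := g)
      (fun c => (he c).symm) v).symm.trans (UHatK.map_id v)

end Functoriality

section Coordinates

variable {R K : Type u} [CommRing R] [IsDomain R] [Field K]
  [Algebra R K] [IsFractionRing R K] {π : R}
  {A : Type u} [CommRing A] [Algebra K A] [Algebra R A] [IsScalarTower R K A]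
  {𝒜 : Subalgebra R A} [IsAffineFormalModel R K 𝒜]
  {L C : Type u} [LieRing L] [LieAlgebra R L] [Module 𝒜 L] [LieRingModule L 𝒜]
  [LieRinehartRing 𝒜 L] [LieRinehartAlgebra R 𝒜 L]
  [LieRing C] [LieAlgebra R C] [Module 𝒜 C] [LieRingModule C 𝒜]
  [LieRinehartRing 𝒜 C] [LieRinehartAlgebra R 𝒜 C]

set_option linter.unusedSectionVars false

theorem act_hom (g : LieRinehartAlgebra.Hom (AlgHom.id R 𝒜) C L) (c : C) (f : A) :
    act R K 𝒜 (g c) f = act R K 𝒜 c f := by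
  obtain ⟨s, a, -, rfl⟩ := exists_eq_modelEquiv_tmul R K 𝒜 f
  rw [act_modelEquiv, act_modelEquiv]
  have : ⁅c, a⁆ = ⁅g c, a⁆ := g.apply_lie a c
  rw [this]

/-- A homomorphism with values in the centraliser of `F`, as a homomorphism to the centraliser. -/
def toCentraliser (g : LieRinehartAlgebra.Hom (AlgHom.id R 𝒜) C L) (F : Set A)
    (hg : ∀ c : C, ∀ f ∈ F, act R K 𝒜 c f = 0) :
    LieRinehartAlgebra.Hom (AlgHom.id R 𝒜) C
      (centraliser R K 𝒜 F : LieRinehartSubalgebra 𝒜 L) where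
  toFun c := ⟨g c, fun f hf => (act_hom g c f).trans (hg c f hf)⟩
  map_add' x y := Subtype.ext (map_add g.toLieHom x y)
  map_smul' r x := Subtype.ext (map_smul g.toLieHom r x)
  map_lie' {x y} := Subtype.ext (g.toLieHom.map_lie x y)
  map_smul_apply' a x := Subtype.ext (g.map_smul_apply a x)
  apply_lie' a x := g.apply_lie a x

variable (K) in
/-- The functions `f i` are coordinates in the directions of `L`: the tuples `(y · f i)ᵢ`, for
`y ∈ L`, are the tuples of elements of `𝒜`. -/
structure IsCoordinates (L : Type u) [LieRing L] [LieAlgebra R L] [Module 𝒜 L] [LieRingModule L 𝒜]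
    [LieRinehartRing 𝒜 L] [LieRinehartAlgebra R 𝒜 L] {r : ℕ} (f : Fin r → A) : Prop where
  mem : ∀ (y : L) i, act R K 𝒜 y (f i) ∈ 𝒜
  surj : ∀ a : Fin r → 𝒜, ∃ y : L, ∀ i, act R K 𝒜 y (f i) = a i

variable (K) in
/-- `g` identifies `C` with the centraliser of the functions `f i` in `L`. -/
structure IsCentraliser (g : LieRinehartAlgebra.Hom (AlgHom.id R 𝒜) C L) {r : ℕ} (f : Fin r → A) :
    Prop where
  inj : Function.Injective g
  range : ∀ y, (∃ c, g c = y) ↔ ∀ i, act R K 𝒜 y (f i) = 0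

variable {r : ℕ}

theorem IsCoordinates.exists_act_eq_one {f : Fin r → A} (hf : IsCoordinates K (𝒜 := 𝒜) L f)
    (i : Fin r) : ∃ d : L, act R K 𝒜 d (f i) = 1 := by
  obtain ⟨d, hd⟩ := hf.surj (Pi.single i 1)
  exact ⟨d, by rw [hd, Pi.single_eq_same]; rfl⟩

/-- The remaining functions are coordinates on the centraliser of the first one. -/
theorem IsCoordinates.centraliser {f : Fin (r + 1) → A} (hf : IsCoordinates K (𝒜 := 𝒜) L f) :
    IsCoordinates K (𝒜 := 𝒜) (centraliser R K 𝒜 {f 0} : LieRinehartSubalgebra 𝒜 L)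
      (fun i => f i.succ) where
  mem y i := by
    rw [← act_hom ((RigidKashiwara.centraliser R K 𝒜 {f 0} : LieRinehartSubalgebra 𝒜 L).incl R)]
    exact hf.mem _ _
  surj a := by
    obtain ⟨y, hy⟩ := hf.surj (Fin.cons 0 a)
    refine ⟨⟨y, by rintro _ rfl; exact hy 0⟩, fun i => ?_⟩
    rw [← act_hom ((RigidKashiwara.centraliser R K 𝒜 {f 0} : LieRinehartSubalgebra 𝒜 L).incl R)]
    exact hy i.succ

theorem IsCentraliser.act_eq_zero {g : LieRinehartAlgebra.Hom (AlgHom.id R 𝒜) C L} {f : Fin r → A}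
    (hg : IsCentraliser K g f) (i : Fin r) (c : C) : ∀ x ∈ ({f i} : Set A), act R K 𝒜 c x = 0 := by
  rintro _ rfl
  rw [← act_hom g]
  exact (hg.range _).1 ⟨c, rfl⟩ i

/-- The centraliser of all the functions is the centraliser of the remaining ones in the centraliser
of the first one. -/
theorem isCentraliser_toCentraliser {g : LieRinehartAlgebra.Hom (AlgHom.id R 𝒜) C L}
    {f : Fin (r + 1) → A} (hg : IsCentraliser K g f) :
    IsCentraliser K (toCentraliser g {f 0} (hg.act_eq_zero 0)) (fun i => f i.succ) where
  inj c c' h := hg.inj (congrArg Subtype.val h)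
  range y := by
    constructor
    · rintro ⟨c, rfl⟩ i
      rw [act_hom]
      exact hg.act_eq_zero i.succ c _ rfl
    · intro h
      obtain ⟨c, hc⟩ := (hg.range y.1).2 fun i => by
        cases i using Fin.cases with
        | zero => exact y.2 _ rfl
        | succ i =>
          rw [← h i, ← act_hom ((RigidKashiwara.centraliser R K 𝒜 {f 0} :
            LieRinehartSubalgebra 𝒜 L).incl R)]
          rfl
      exact ⟨c, Subtype.ext hc⟩

theorem IsCentraliser.bijective {g : LieRinehartAlgebra.Hom (AlgHom.id R 𝒜) C L} {f : Fin 0 → A}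
    (hg : IsCentraliser K g f) : Function.Bijective g :=
  ⟨hg.inj, fun y => (hg.range y).2 fun i => i.elim0⟩

end Coordinates

end

noncomputable section

/-! ### Several functions -/

section Main

variable {R K : Type u} [CommRing R] [IsDomain R] [IsDiscreteValuationRing R] [Field K] [CharZero K]
  [Algebra R K] [IsFractionRing R K] {π : R}
  {A : Type u} [CommRing A] [Algebra K A] [Algebra R A] [IsScalarTower R K A]
  {𝒜 : Subalgebra R A} [IsAffineFormalModel R K 𝒜]

set_option linter.unusedSectionVars false

variable (K π 𝒜) in
/-- The canonical map `Û(L) → Û(L)_K`. -/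
abbrev UHat.toUHatK (L : Type u) [LieRing L] [LieAlgebra R L] [Module 𝒜 L] [LieRingModule L 𝒜] :
    UHat π 𝒜 L →ₐ[R] UHatK K π 𝒜 L :=
  Algebra.TensorProduct.includeRight

section

variable {L C : Type u} [LieRing L] [LieAlgebra R L] [Module 𝒜 L] [LieRingModule L 𝒜]
  [LieRinehartRing 𝒜 L] [LieRinehartAlgebra R 𝒜 L]
  [LieRing C] [LieAlgebra R C] [Module 𝒜 C] [LieRingModule C 𝒜]
  [LieRinehartRing 𝒜 C] [LieRinehartAlgebra R 𝒜 C]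

/-- Each coordinate exhibits `Û(L)_K` as a ring of differential operators in one variable over the
completed enveloping algebra of its centraliser. -/
theorem exists_oreStep [Module.Finite 𝒜 L] (hπ0 : π ≠ 0) (hπ : ¬ IsUnit π) {r : ℕ} {f : Fin r → A}
    (hf : IsCoordinates K (𝒜 := 𝒜) L f) (i : Fin r) :
    Nonempty (OreStep π (UHat.toUHatK K π 𝒜 (centraliser R K 𝒜 {f i} : LieRinehartSubalgebra 𝒜 L))
      (UHat.toUHatK K π 𝒜 L)
      (completionMap π (Enveloping.map R 𝒜
        ((centraliser R K 𝒜 {f i} : LieRinehartSubalgebra 𝒜 L).incl R)))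
      (centInclusion K π 𝒜 L {f i}) (functionMap K π 𝒜 _ (f i)) (dividedPower K 𝒜 π _ (f i))) := by
  obtain ⟨d, hd⟩ := hf.exists_act_eq_one i
  have hfin := centraliser_finite 𝒜 (f i) (fun y => hf.mem y i) d hd
  exact ⟨(centraliserSplitting 𝒜 (f i) (fun y => hf.mem y i) d hd).oreStep 𝒜 hπ0 hπ (f i)
    (functionMap_central K π 𝒜 (Set.mem_singleton (f i))) hd⟩

theorem IsCoordinates.finite_centraliser [Module.Finite 𝒜 L] {r : ℕ} {f : Fin r → A}
    (hf : IsCoordinates K (𝒜 := 𝒜) L f) (i : Fin r) :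
    Module.Finite 𝒜 (RigidKashiwara.centraliser R K 𝒜 {f i} : LieRinehartSubalgebra 𝒜 L) := by
  obtain ⟨d, hd⟩ := hf.exists_act_eq_one i
  exact centraliser_finite 𝒜 (f i) (fun y => hf.mem y i) d hd

theorem comp_centInclusion (g : LieRinehartAlgebra.Hom (AlgHom.id R 𝒜) C L) (F : Set A)
    (hg : ∀ c : C, ∀ f ∈ F, act R K 𝒜 c f = 0) :
    (centInclusion K π 𝒜 L F).comp (UHatK.map K π 𝒜 (toCentraliser g F hg)).toRingHom =
      (UHatK.map K π 𝒜 g).toRingHom :=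
  RingHom.ext fun v => (UHatK.map_eq_of_forall (fun _ => rfl) v).symm

variable {N M : Type u} [AddCommGroup N] [Module (UHatK K π 𝒜 C)ᵐᵒᵖ N] [AddCommGroup M]
  [Module (UHatK K π 𝒜 L)ᵐᵒᵖ M] {j : N →+ M}

/-- A central function that kills `N` kills every module induced from `N`. -/
theorem IsInduced.smul_functionMap_eq_zero {g : LieRinehartAlgebra.Hom (AlgHom.id R 𝒜) C L}
    (hj : IsInduced (UHatK.map K π 𝒜 g).toRingHom j) {f : A}
    (hc : ∀ v, Commute (functionMap K π 𝒜 L f) v)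
    (hN : ∀ n : N, op (functionMap K π 𝒜 C f) • n = 0) (m : M) :
    op (functionMap K π 𝒜 L f) • m = 0 := by
  have hm : m ∈ Submodule.span _ (Set.range j) := hj.gen ▸ Submodule.mem_top
  induction hm using Submodule.span_induction with
  | mem x hx =>
    obtain ⟨n, rfl⟩ := hx
    have h := hj.semi (functionMap K π 𝒜 C f) n
    rw [hN, map_zero] at h
    refine Eq.trans ?_ h.symm
    exact congrArg (fun u => op u • j n) (UHatK.map_functionMap K π 𝒜 g f).symm
  | zero => rw [smul_zero]
  | add x y _ _ hx hy => rw [smul_add, hx, hy, add_zero]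
  | smul a x _ hx =>
    have h : op (functionMap K π 𝒜 L f) * a = a * op (functionMap K π 𝒜 L f) :=
      unop_injective (hc a.unop).symm
    rw [smul_smul, h, mul_smul, hx, smul_zero]

/-- The divided powers of each coordinate tend to zero on an induced module: it is induced from a
module over the centraliser of that coordinate alone. -/
theorem IsCentraliser.nullSeq [Module.Finite 𝒜 L] (hπ0 : π ≠ 0) (hπ : ¬ IsUnit π) {r : ℕ}
    {f : Fin r → A} (hf : IsCoordinates K (𝒜 := 𝒜) L f)
    {g : LieRinehartAlgebra.Hom (AlgHom.id R 𝒜) C L}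
    (hg : IsCentraliser K g f) (hj : IsInduced (UHatK.map K π 𝒜 g).toRingHom j)
    [Module.Finite (UHatK K π 𝒜 C)ᵐᵒᵖ N]
    (hN : ∀ i, ∀ n : N, op (functionMap K π 𝒜 C (f i)) • n = 0) (i : Fin r) (m : M) :
    NullSeq π (UHat.toUHatK K π 𝒜 L) fun n => op (dividedPower K 𝒜 π L (f i) n) • m := by
  obtain ⟨h⟩ := exists_oreStep hπ0 hπ hf i
  rw [← comp_centInclusion g {f i} (hg.act_eq_zero i)] at hj
  have hu := isInduced_unit (UHatK.map K π 𝒜 (toCentraliser g {f i} (hg.act_eq_zero i))).toRingHom N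
  obtain ⟨k, hk, -⟩ := hu.exists_factor hj
  have := hu.finite
  have key := h.nullSeq_of_isInduced hk
    (hu.smul_functionMap_eq_zero (functionMap_central K π 𝒜 (Set.mem_singleton (f i))) (hN i)) m
  have e : ∀ n, centInclusion K π 𝒜 L {f i} (dividedPower K 𝒜 π _ (f i) n) =
    dividedPower K 𝒜 π L (f i) n := fun n => UHatK.map_functionMap K π 𝒜 _ _
  simp only [e] at key
  exact key

end

/-- `N` is recovered from the induced module `N ⊗ U` as the part killed by the coordinates. -/
theorem injective_and_range (hπ0 : π ≠ 0) (hπ : ¬ IsUnit π) : ∀ (r : ℕ) (f : Fin r → A)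
    (L C : Type u) [LieRing L] [LieAlgebra R L] [Module 𝒜 L] [LieRingModule L 𝒜]
    [LieRinehartRing 𝒜 L] [LieRinehartAlgebra R 𝒜 L] [Module.Finite 𝒜 L]
    [LieRing C] [LieAlgebra R C] [Module 𝒜 C] [LieRingModule C 𝒜]
    [LieRinehartRing 𝒜 C] [LieRinehartAlgebra R 𝒜 C]
    (_ : IsCoordinates K (𝒜 := 𝒜) L f) (g : LieRinehartAlgebra.Hom (AlgHom.id R 𝒜) C L)
    (_ : IsCentraliser K g f) (N M : Type u) [AddCommGroup N] [Module (UHatK K π 𝒜 C)ᵐᵒᵖ N]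
    [AddCommGroup M] [Module (UHatK K π 𝒜 L)ᵐᵒᵖ M] (j : N →+ M)
    (_ : IsInduced (UHatK.map K π 𝒜 g).toRingHom j)
    (_ : ∀ i, ∀ n : N, op (functionMap K π 𝒜 C (f i)) • n = 0),
    Function.Injective j ∧ ∀ m, (∃ n, j n = m) ↔ ∀ i, op (functionMap K π 𝒜 L (f i)) • m = 0 := by
  intro r
  induction r with
  | zero =>
    intro f L C _ _ _ _ _ _ _ _ _ _ _ _ _ hf g hg N M _ _ _ _ j hj hN
    have hφ : Function.Bijective (UHatK.map K π 𝒜 g).toRingHom :=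
      UHatK.map_bijective (K := K) (π := π) hg.bijective
    have := hj.bijective hφ
    exact ⟨this.1, fun m => ⟨fun _ i => i.elim0, fun _ => this.2 m⟩⟩
  | succ r ih =>
    intro f L C _ _ _ _ _ _ _ _ _ _ _ _ _ hf g hg N M _ _ _ _ j hj hN
    obtain ⟨h⟩ := exists_oreStep hπ0 hπ hf 0
    rw [← comp_centInclusion g {f 0} (hg.act_eq_zero 0)] at hj
    -- `M₁` is the intermediate module, over the completed enveloping algebra of `C_L(f 0)`
    obtain ⟨M₁, _, _, u, hu⟩ : ∃ (M₁ : Type u) (_ : AddCommGroup M₁)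
        (_ : Module (CentHatK K π 𝒜 L {f 0})ᵐᵒᵖ M₁) (u : N →+ M₁), IsInduced
          (UHatK.map K π 𝒜 (toCentraliser g {f 0} (hg.act_eq_zero 0))).toRingHom u :=
      ⟨_, _, _, _, isInduced_unit _ N⟩
    have hfin := hf.finite_centraliser 0
    obtain ⟨hinj, hrange⟩ := ih (fun i => f i.succ) _ C hf.centraliser _
      (isCentraliser_toCentraliser hg) N _ _ hu fun i => hN i.succ
    obtain ⟨k, hk, rfl⟩ := hu.exists_factor hj
    have hx := hu.smul_functionMap_eq_zero
      (functionMap_central K π 𝒜 (Set.mem_singleton (f 0))) (hN 0)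
    have hkinj := h.injective_of_isInduced hk
    have hkr := h.mem_range_iff hk hx
    have e : ∀ i, centInclusion K π 𝒜 L {f 0} (functionMap K π 𝒜 _ (f i)) =
      functionMap K π 𝒜 L (f i) := fun n => UHatK.map_functionMap K π 𝒜 _ _
    rw [e] at hkr
    have hks : ∀ (i : Fin (r + 1)) (m₁ : M₁), op (functionMap K π 𝒜 L (f i)) • k m₁ =
        k (op (functionMap K π 𝒜 (centraliser R K 𝒜 {f 0} : LieRinehartSubalgebra 𝒜 L) (f i)) •
          m₁) := fun i m₁ =>
      (congrArg (fun v => op v • k m₁) (e i)).symm.trans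
        (hk.semi (functionMap K π 𝒜 _ (f i)) m₁).symm
    refine ⟨hkinj.comp hinj, fun m => ⟨?_, fun hm => ?_⟩⟩
    · rintro ⟨n, rfl⟩ i
      rw [AddMonoidHom.comp_apply]
      refine (hks i _).trans ((congrArg k ?_).trans (map_zero k))
      cases i using Fin.cases with
      | zero => exact hx _
      | succ i => exact (hrange _).1 ⟨n, rfl⟩ i
    · obtain ⟨m₁, rfl⟩ := (hkr m).2 (hm 0)
      obtain ⟨n, rfl⟩ := (hrange m₁).2 fun i =>
        hkinj ((hks i.succ m₁).symm.trans ((hm i.succ).trans (map_zero k).symm))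
      exact ⟨n, rfl⟩

/-- If the divided powers of the coordinates tend to zero on `M`, then `M` is induced from the part
killed by the coordinates. -/
theorem finite_and_isInduced (hπ0 : π ≠ 0) (hπ : ¬ IsUnit π) : ∀ (r : ℕ) (f : Fin r → A)
    (L C : Type u) [LieRing L] [LieAlgebra R L] [Module 𝒜 L] [LieRingModule L 𝒜]
    [LieRinehartRing 𝒜 L] [LieRinehartAlgebra R 𝒜 L] [Module.Finite 𝒜 L]
    [LieRing C] [LieAlgebra R C] [Module 𝒜 C] [LieRingModule C 𝒜]
    [LieRinehartRing 𝒜 C] [LieRinehartAlgebra R 𝒜 C]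
    (_ : IsCoordinates K (𝒜 := 𝒜) L f) (g : LieRinehartAlgebra.Hom (AlgHom.id R 𝒜) C L)
    (_ : IsCentraliser K g f) (N M : Type u) [AddCommGroup N] [Module (UHatK K π 𝒜 C)ᵐᵒᵖ N]
    [AddCommGroup M] [Module (UHatK K π 𝒜 L)ᵐᵒᵖ M] [Module.Finite (UHatK K π 𝒜 L)ᵐᵒᵖ M]
    (_ : ∀ i, ∀ m : M, NullSeq π (UHat.toUHatK K π 𝒜 L) fun n =>
      op (dividedPower K 𝒜 π L (f i) n) • m)
    (j : N →+ M) (_ : ∀ v n, j (op v • n) = op ((UHatK.map K π 𝒜 g).toRingHom v) • j n)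
    (_ : Function.Injective j)
    (_ : ∀ m, (∃ n, j n = m) ↔ ∀ i, op (functionMap K π 𝒜 L (f i)) • m = 0),
    Module.Finite (UHatK K π 𝒜 C)ᵐᵒᵖ N ∧ IsInduced (UHatK.map K π 𝒜 g).toRingHom j := by
  intro r
  induction r with
  | zero =>
    intro f L C _ _ _ _ _ _ _ _ _ _ _ _ _ hf g hg N M _ _ _ _ _ hM j hj hinj hr
    have hb : Function.Bijective j := ⟨hinj, fun m => (hr m).2 fun i => i.elim0⟩
    have hs := (UHatK.map_bijective (K := K) (π := π) hg.bijective).2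
    exact ⟨finite_of_bijective hs hj hb, isInduced_of_bijective hs hj hb⟩
  | succ r ih =>
    intro f L C _ _ _ _ _ _ _ _ _ _ _ _ _ hf g hg N M _ _ _ _ _ hM j hj hinj hr
    obtain ⟨h⟩ := exists_oreStep hπ0 hπ hf 0
    have hfin := hf.finite_centraliser 0
    have e : ∀ a, centInclusion K π 𝒜 L {f 0} (functionMap K π 𝒜 _ a) =
      functionMap K π 𝒜 L a := fun n => UHatK.map_functionMap K π 𝒜 _ _
    -- the intermediate module is the part of `M` killed by `f 0`
    let M₁ := killedBy (functionMap K π 𝒜 L '' {f 0}) M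
    let : Module (CentHatK K π 𝒜 L {f 0})ᵐᵒᵖ M₁ :=
      killedByBaseModule (centImage_central K π 𝒜 L {f 0}) (centInclusion_image K π 𝒜 L {f 0}) M
    have hkr : ∀ m, (∃ n, M₁.subtype n = m) ↔ op (functionMap K π 𝒜 L (f 0)) • m = 0 := by
      intro m
      constructor
      · rintro ⟨n, rfl⟩
        exact n.2 _ ⟨_, rfl, rfl⟩
      · intro hm
        refine ⟨⟨m, ?_⟩, rfl⟩
        rintro _ ⟨_, rfl, rfl⟩
        exact hm
    have hks : ∀ v n, M₁.subtype (op v • n) = op (centInclusion K π 𝒜 L {f 0} v) • M₁.subtype n :=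
      fun v n => rfl
    obtain ⟨hM₁, hk⟩ := h.finite_and_isInduced (j := M₁.subtype)
      (fun m => by simp only [dividedPower, e]; exact hM 0 m) hks
      Subtype.val_injective (by rw [e]; exact hkr)
    let j₁ : N →+ M₁ :=
      { toFun := fun n => ⟨j n, by
          rintro _ ⟨_, rfl, rfl⟩
          exact (hr _).1 ⟨n, rfl⟩ 0⟩
        map_zero' := Subtype.ext (map_zero j)
        map_add' := fun x y => Subtype.ext (map_add j x y) }
    have hcomp := comp_centInclusion (K := K) (π := π) g {f 0} (hg.act_eq_zero 0)
    obtain ⟨hN, hj₁⟩ := ih (fun i => f i.succ) _ C hf.centraliser _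
      (isCentraliser_toCentraliser hg) N M₁ (fun i m => h.nullSeq_descend hk (by
        have := hM i.succ m.1
        simp only [hks, dividedPower, e]
        exact this)) j₁
      (fun v n => Subtype.ext (by
        change j _ = op (centInclusion K π 𝒜 L {f 0} _) • j n
        rw [hj, ← hcomp]
        rfl))
      (fun x y hxy => hinj (congrArg Subtype.val hxy))
      (fun m => by
        constructor
        · rintro ⟨n, rfl⟩ i
          refine Subtype.ext ?_
          change op (centInclusion K π 𝒜 L {f 0} (functionMap K π 𝒜 _ (f i.succ))) • j n = 0
          rw [e]
          exact (hr _).1 ⟨n, rfl⟩ i.succ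
        · intro hm
          obtain ⟨n, hn⟩ := (hr m.1).2 fun i => by
            cases i using Fin.cases with
            | zero => exact (hkr _).1 ⟨m, rfl⟩
            | succ i =>
              have := congrArg Subtype.val (hm i)
              change op (centInclusion K π 𝒜 L {f 0} (functionMap K π 𝒜 _ (f i.succ))) • m.1 = 0
                at this
              rwa [e] at this
          exact ⟨n, Subtype.ext hn⟩)
    have := hj₁.trans hk
    rw [hcomp] at this
    exact ⟨hN, this⟩

end Main

end

noncomputable section

/-! ### The equivalence of categories -/

section Equivalence

theorem Induced.desc_mk {V U N P : Type u} [Ring V] [Ring U] [AddCommGroup N] [Module Vᵐᵒᵖ N]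
    [AddCommGroup P] [Module Uᵐᵒᵖ P] (φ : V →+* U) (g : N →+ P)
    (hg : ∀ v n, g (op v • n) = op (φ v) • g n) (u : U) (n : N) :
    Induced.desc φ g hg (Submodule.Quotient.mk (u ⊗ₜ n)) = op u • g n := by
  rw [← Induced.op_smul_unit, map_smul, Induced.desc_unit]

variable {V U : Type u} [Ring V] [Ring U] {φ : V →+* U} {s : Set V} {t : Set U}

variable (s) in
/-- The right `V`-module underlying a right `V/(s)`-module. -/
abbrev underlying (N : ModuleCat.{u} (QuotientBy s)ᵐᵒᵖ) : ModuleCat.{u} Vᵐᵒᵖ :=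
  (ModuleCat.restrictScalars (RingHom.op (TwoSidedIdeal.span s).ringCon.mk')).obj N

theorem op_smul_underlying (N : ModuleCat.{u} (QuotientBy s)ᵐᵒᵖ) (v : V) (n : underlying s N) :
    op v • n = (op ((TwoSidedIdeal.span s).ringCon.mk' v) • (show N from n) : N) := rfl

theorem smul_underlying_eq_zero (N : ModuleCat.{u} (QuotientBy s)ᵐᵒᵖ) {z : V} (hz : z ∈ s)
    (n : underlying s N) : op z • n = 0 := by
  have h : (TwoSidedIdeal.span s).ringCon.mk' z = 0 := by
    rw [← map_zero (TwoSidedIdeal.span s).ringCon.mk']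
    exact (RingCon.eq _).2 ((TwoSidedIdeal.mem_iff _ _).1 (TwoSidedIdeal.subset_span hz))
  rw [op_smul_underlying, h, op_zero]
  exact zero_smul _ (show N from n)

theorem finite_underlying_iff (N : ModuleCat.{u} (QuotientBy s)ᵐᵒᵖ) :
    Module.Finite Vᵐᵒᵖ (underlying s N) ↔ Module.Finite (QuotientBy s)ᵐᵒᵖ N := by
  have hsurj : Function.Surjective (TwoSidedIdeal.span s).ringCon.mk' := RingCon.mk'_surjective _
  let j : underlying s N →+ N := AddMonoidHom.id N
  have hj : ∀ v n, j (op v • n) = op ((TwoSidedIdeal.span s).ringCon.mk' v) • j n :=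
    fun _ _ => rfl
  exact ⟨fun _ => (isInduced_of_bijective hsurj hj Function.bijective_id).finite,
    fun _ => finite_of_bijective hsurj hj Function.bijective_id⟩

/-- An additive map that commutes with the action of `V` is linear over quotients of `V`. -/
def linearOfSemilinear {N N' : ModuleCat.{u} (QuotientBy s)ᵐᵒᵖ} (g : N →+ N')
    (hg : ∀ (v : V) (n : N), g (op ((TwoSidedIdeal.span s).ringCon.mk' v) • n) =
      op ((TwoSidedIdeal.span s).ringCon.mk' v) • g n) : N →ₗ[(QuotientBy s)ᵐᵒᵖ] N' where
  toFun := g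
  map_add' := map_add g
  map_smul' q n := by
    obtain ⟨v, hv⟩ := RingCon.mk'_surjective _ q.unop
    obtain rfl : q = op ((TwoSidedIdeal.span s).ringCon.mk' v) := unop_injective hv.symm
    exact hg v n

/-- Sufficient conditions, in terms of modules, for induction and passage to the part killed by `t`
to be inverse equivalences. -/
theorem exists_equivalence (hs : ∀ z ∈ s, ∀ v : V, Commute z v) (hst : φ '' s = t)
    (P : ObjectProperty (ModuleCat.{u} Uᵐᵒᵖ))
    (hP : ∀ (N : Type u) [AddCommGroup N] [Module Vᵐᵒᵖ N] [Module.Finite Vᵐᵒᵖ N],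
      (∀ z ∈ s, ∀ n : N, op z • n = 0) → P (ModuleCat.of Uᵐᵒᵖ (Induced φ N)))
    (hunit : ∀ (N : Type u) [AddCommGroup N] [Module Vᵐᵒᵖ N],
      (∀ z ∈ s, ∀ n : N, op z • n = 0) → Function.Injective (Induced.unit φ N) ∧
        ∀ m, (∃ n, Induced.unit φ N n = m) ↔ m ∈ killedBy t (Induced φ N))
    (hcounit : ∀ M : ModuleCat.{u} Uᵐᵒᵖ, P M → ∀ (N : Type u) [AddCommGroup N] [Module Vᵐᵒᵖ N]
      (j : N →+ M), (∀ v n, j (op v • n) = op (φ v) • j n) → Function.Injective j →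
      (∀ m, (∃ n, j n = m) ↔ m ∈ killedBy t M) → Module.Finite Vᵐᵒᵖ N ∧ IsInduced φ j) :
    ∃ (hT : ∀ N : (finitelyGenerated (QuotientBy s)).FullSubcategory,
        P ((quotientInductionFunctor φ s).obj N.obj))
      (hS : ∀ M : P.FullSubcategory, finitelyGenerated (QuotientBy s)
        ((killedByFunctor hs hst).obj M.obj))
      (e : (finitelyGenerated (QuotientBy s)).FullSubcategory ≌ P.FullSubcategory),
      e.functor = ObjectProperty.lift _
          (ObjectProperty.ι _ ⋙ quotientInductionFunctor φ s) hT ∧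
      e.inverse = ObjectProperty.lift _ (ObjectProperty.ι _ ⋙ killedByFunctor hs hst) hS := by
  have hT : ∀ N : (finitelyGenerated (QuotientBy s)).FullSubcategory,
      P ((quotientInductionFunctor φ s).obj N.obj) := fun N => by
    have : Module.Finite Vᵐᵒᵖ (underlying s N.obj) := (finite_underlying_iff N.obj).2 N.property
    exact hP (underlying s N.obj) fun z hz => smul_underlying_eq_zero N.obj hz
  let j : ∀ M : ModuleCat.{u} Uᵐᵒᵖ, underlying s ((killedByFunctor hs hst).obj M) →+ M :=
    fun M => (killedBy t M).subtype
  have hj : ∀ M v n, j M (op v • n) = op (φ v) • j M n := fun _ _ _ => rfl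
  have hjI : ∀ M, P M → Module.Finite Vᵐᵒᵖ (underlying s ((killedByFunctor hs hst).obj M)) ∧
      IsInduced φ (j M) := fun M hM => hcounit M hM _ (j M) (hj M) Subtype.val_injective
    fun m => ⟨fun ⟨n, hn⟩ => hn ▸ n.2, fun hm => ⟨⟨m, hm⟩, rfl⟩⟩
  have hS : ∀ M : P.FullSubcategory, finitelyGenerated (QuotientBy s)
      ((killedByFunctor hs hst).obj M.obj) := fun M =>
    (finite_underlying_iff _).1 (hjI M.obj M.property).1
  have hu : ∀ N : ModuleCat.{u} (QuotientBy s)ᵐᵒᵖ, Function.Injective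
      (Induced.unit φ (underlying s N)) ∧ ∀ m, (∃ n, Induced.unit φ (underlying s N) n = m) ↔
        m ∈ killedBy t (Induced φ (underlying s N)) := fun N =>
    hunit (underlying s N) fun z hz => smul_underlying_eq_zero N hz
  let uhom : ∀ N : ModuleCat.{u} (QuotientBy s)ᵐᵒᵖ,
      N →+ ((killedByFunctor hs hst).obj ((quotientInductionFunctor φ s).obj N)) := fun N =>
    { toFun := fun n => (⟨Induced.unit φ (underlying s N) n, ((hu N).2 _).1 ⟨n, rfl⟩⟩ :
        killedBy t (Induced φ (underlying s N)))
      map_zero' := Subtype.ext (map_zero (Induced.unit φ (underlying s N)))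
      map_add' := fun x y => Subtype.ext (map_add (Induced.unit φ (underlying s N)) x y) }
  have hub : ∀ N, Function.Bijective (uhom N) := fun N =>
    ⟨fun x y h => (hu N).1 (congrArg Subtype.val h), fun m => by
      obtain ⟨n, hn⟩ := ((hu N).2 m.1).2 m.2
      exact ⟨n, Subtype.ext hn⟩⟩
  let η : 𝟭 _ ≅ ObjectProperty.lift P (ObjectProperty.ι _ ⋙ quotientInductionFunctor φ s) hT ⋙
      ObjectProperty.lift (finitelyGenerated (QuotientBy s))
        (ObjectProperty.ι _ ⋙ killedByFunctor hs hst) hS :=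
    NatIso.ofComponents (fun N => ObjectProperty.isoMk _ (LinearEquiv.toModuleIso
      (LinearEquiv.ofBijective (linearOfSemilinear (uhom N.obj) fun v n => Subtype.ext
        (Induced.unit_semi φ (N := underlying s N.obj) v n)) (hub N.obj))))
      fun {N N'} g => rfl
  let ε : ObjectProperty.lift (finitelyGenerated (QuotientBy s))
        (ObjectProperty.ι _ ⋙ killedByFunctor hs hst) hS ⋙
      ObjectProperty.lift P (ObjectProperty.ι _ ⋙ quotientInductionFunctor φ s) hT ≅ 𝟭 _ :=
    NatIso.ofComponents (fun M => ObjectProperty.isoMk _ (LinearEquiv.toModuleIso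
      (LinearEquiv.ofBijective (Induced.desc φ (j M.obj) (hj M.obj))
        (hjI M.obj M.property).2.bijective_desc)))
      fun {M M'} g => by
        refine ObjectProperty.hom_ext _ (ModuleCat.hom_ext (Induced.hom_ext φ fun u n => ?_))
        refine (Induced.desc_mk φ (j M'.obj) (hj M'.obj) u _).trans ?_
        refine Eq.trans ?_ (congrArg g.hom.hom (Induced.desc_mk φ (j M.obj) (hj M.obj) u n)).symm
        exact (map_smul g.hom.hom (op u) (j M.obj n)).symm
  exact ⟨hT, hS, CategoryTheory.Equivalence.mk _ _ η ε, rfl, rfl⟩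

end Equivalence

/-! ### Lattices -/

section Lattice

theorem ball_eq_closure {R U₀ U M : Type u} [CommRing R] {π : R} [Ring U₀] [Algebra R U₀] [Ring U]
    [Algebra R U] [AddCommGroup M] [Module Uᵐᵒᵖ M] [DecidableEq M] (ι : U₀ →ₐ[R] U) {α : Type*}
    [Fintype α] (n : ℕ) (s : α → M) :
    ball π ι n s = AddSubgroup.closure {m | ∃ y ∈ Finset.univ.image fun i =>
      op (algebraMap R U (π ^ n)) • s i, ∃ u, m = op (ι u) • y} := by
  classical
  have e : ∀ a i, op (ι (π ^ n • a)) • s i = op (ι a) • op (algebraMap R U (π ^ n)) • s i := by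
    intro a i
    rw [map_smul, op_algebraMap_smul']
  refine le_antisymm ?_ ?_
  · rintro _ ⟨a, rfl⟩
    exact sum_mem fun i _ => AddSubgroup.subset_closure
      ⟨_, Finset.mem_image_of_mem _ (Finset.mem_univ i), a i, e _ _⟩
  · rw [AddSubgroup.closure_le]
    rintro _ ⟨_, hy, u, rfl⟩
    obtain ⟨i, -, rfl⟩ := Finset.mem_image.1 hy
    rw [← e]
    refine ⟨Pi.single i u, ?_⟩
    rw [Finset.sum_eq_single i]
    · rw [Pi.single_eq_same]
    · intro j _ hj
      rw [Pi.single_eq_of_ne hj, smul_zero, map_zero, op_zero, zero_smul]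
    · exact fun h => absurd (Finset.mem_univ i) h

variable {R K : Type u} [CommRing R] [IsDomain R] [IsDiscreteValuationRing R] [Field K]
  [Algebra R K] [IsFractionRing R K] {π : R}
  {A : Type u} [CommRing A] [Algebra K A] [Algebra R A]
  {𝒜 : Subalgebra R A} [IsAffineFormalModel R K 𝒜]
  {L : Type u} [LieRing L] [LieAlgebra R L] [Module 𝒜 L] [LieRingModule L 𝒜] [Module.Finite 𝒜 L]
  {M : Type u} [AddCommGroup M] [Module (UHatK K π 𝒜 L)ᵐᵒᵖ M]

/-- The balls of a generating family are lattices. -/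
theorem isLattice_ball (hπ0 : π ≠ 0) (hπ : ¬ IsUnit π) {k : ℕ} {x : Fin k → M}
    (hx : Submodule.span (UHatK K π 𝒜 L)ᵐᵒᵖ (Set.range x) = ⊤) (n : ℕ) :
    IsLattice K π 𝒜 L (ball π (UHat.toUHatK K π 𝒜 L) n x) where
  fg := by
    classical
    exact ⟨_, ball_eq_closure (UHat.toUHatK K π 𝒜 L) n x⟩
  span := by
    rw [eq_top_iff]
    intro m _
    obtain ⟨l, hl⟩ := (completeBall_UHat (K := K) 𝒜 L hπ0 hπ).exists_smul_mem_ball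
      (hx ▸ Submodule.mem_top : m ∈ Submodule.span _ (Set.range x))
    have hne : algebraMap R K (π ^ (n + l)) ≠ 0 :=
      (map_ne_zero_iff _ (IsFractionRing.injective R K)).2 (pow_ne_zero _ hπ0)
    refine AddSubgroup.subset_closure ⟨(algebraMap R K (π ^ (n + l)))⁻¹,
      op (algebraMap R (UHatK K π 𝒜 L) (π ^ (n + l))) • m, ?_, ?_⟩
    · have := smul_mem_ball_add hl n
      rwa [smul_smul, ← op_mul, ← map_mul, ← pow_add, add_comm l, add_zero] at this
    · rw [IsScalarTower.algebraMap_apply R K (UHatK K π 𝒜 L), smul_smul, ← op_mul, ← map_mul,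
        mul_inv_cancel₀ hne, map_one, op_one, one_smul]

/-- Convergence with respect to lattices is convergence with respect to balls. -/
theorem tendsToZero_iff_nullSeq (hπ0 : π ≠ 0) (hπ : ¬ IsUnit π)
    [Module.Finite (UHatK K π 𝒜 L)ᵐᵒᵖ M] (x : ℕ → M) :
    TendsToZero K π 𝒜 L x ↔ NullSeq π (UHat.toUHatK K π 𝒜 L) x := by
  constructor
  · exact fun h k s hs n => h _ (isLattice_ball hπ0 hπ hs n)
  · intro h Λ hΛ
    obtain ⟨S, hS⟩ := hΛ.fg
    let s : S → M := Subtype.val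
    have hle : ball π (UHat.toUHatK K π 𝒜 L) 0 s ≤ Λ := by
      rw [hS]
      rintro _ ⟨a, rfl⟩
      refine sum_mem fun i _ => AddSubgroup.subset_closure ⟨_, i.2, a i, ?_⟩
      rw [pow_zero, one_smul]
      rfl
    have hΛs : ∀ y ∈ Λ, y ∈ Submodule.span (UHatK K π 𝒜 L)ᵐᵒᵖ (Set.range s) := by
      intro y hy
      have : Λ ≤ (Submodule.span (UHatK K π 𝒜 L)ᵐᵒᵖ (Set.range s)).toAddSubgroup := by
        rw [hS, AddSubgroup.closure_le]
        rintro _ ⟨z, hz, u, rfl⟩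
        exact Submodule.smul_mem _ _ (Submodule.subset_span ⟨⟨z, hz⟩, rfl⟩)
      exact this hy
    have hs : Submodule.span (UHatK K π 𝒜 L)ᵐᵒᵖ (Set.range s) = ⊤ := by
      rw [eq_top_iff]
      have : (⊤ : AddSubgroup M) ≤
          (Submodule.span (UHatK K π 𝒜 L)ᵐᵒᵖ (Set.range s)).toAddSubgroup := by
        rw [← hΛ.span, AddSubgroup.closure_le]
        rintro _ ⟨c, y, hy, rfl⟩
        exact Submodule.smul_mem _ _ (hΛs y hy)
      exact fun m _ => this (AddSubgroup.mem_top m)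
    exact (h.eventually_mem_ball (completeBall_UHat 𝒜 L hπ0 hπ) hs 0).mono fun i hi => hle hi

end Lattice

end

end RigidKashiwara

open RigidKashiwara in
theorem mainTheorem6 {R K : Type u} [CommRing R] [IsDomain R] [IsDiscreteValuationRing R]
    [IsAdicComplete (IsLocalRing.maximalIdeal R) R]
    [Field K] [CharZero K] [Algebra R K] [IsFractionRing R K]
    (π : R) (hπ0 : π ≠ 0) (hπ : ¬ IsUnit π)
    {A : Type u} [CommRing A] [IsReduced A] [Algebra K A] [Algebra R A] [IsScalarTower R K A]
    (hA : IsAffinoidAlgebra R K A)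
    (𝒜 : Subalgebra R A) [IsAffineFormalModel R K 𝒜]
    {L : Type u} [LieRing L] [LieAlgebra R L] [Module 𝒜 L] [LieRingModule L 𝒜]
    [LieRinehartRing 𝒜 L] [LieRinehartAlgebra R 𝒜 L]
    [Module.Finite 𝒜 L] [Module.Projective 𝒜 L]
    {r : ℕ} (f : Fin r → A)
    (hf : Set.range (fun (x : L) (i : Fin r) => act R K 𝒜 x (f i)) = {g | ∀ i, g i ∈ 𝒜}) :
    ∃ (hT : ∀ N : (finitelyGenerated (CentHatKMod K π 𝒜 L (Set.range f))).FullSubcategory,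
        finitelyGeneratedDp K π 𝒜 L (Set.range f)
          ((pushforward K π 𝒜 L (Set.range f)).obj N.obj))
      (hS : ∀ M : (finitelyGeneratedDp K π 𝒜 L (Set.range f)).FullSubcategory,
        finitelyGenerated (CentHatKMod K π 𝒜 L (Set.range f))
          ((pullback K π 𝒜 L (Set.range f)).obj M.obj))
      (e : (finitelyGenerated (CentHatKMod K π 𝒜 L (Set.range f))).FullSubcategory ≌
        (finitelyGeneratedDp K π 𝒜 L (Set.range f)).FullSubcategory),
      e.functor = ObjectProperty.lift _
          (ObjectProperty.ι _ ⋙ pushforward K π 𝒜 L (Set.range f)) hT ∧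
      e.inverse = ObjectProperty.lift _
          (ObjectProperty.ι _ ⋙ pullback K π 𝒜 L (Set.range f)) hS := by
  have hcoord : IsCoordinates K (𝒜 := 𝒜) L f :=
    ⟨fun y => hf.subset ⟨y, rfl⟩, fun a => by
      obtain ⟨y, hy⟩ := hf.superset (fun i => (a i).2 : (fun i => (a i : A)) ∈ {g | ∀ i, g i ∈ 𝒜})
      exact ⟨y, congrFun hy⟩⟩
  let g := (centraliser R K 𝒜 (Set.range f) : LieRinehartSubalgebra 𝒜 L).incl R
  have hg : IsCentraliser K g f :=
    ⟨Subtype.val_injective, fun y => ⟨fun ⟨c, hc⟩ i => hc ▸ c.2 _ ⟨i, rfl⟩,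
      fun h => ⟨⟨y, by rintro _ ⟨i, rfl⟩; exact h i⟩, rfl⟩⟩⟩
  have hkill : ∀ (M : Type u) [AddCommGroup M] [Module (UHatK K π 𝒜 L)ᵐᵒᵖ M] (m : M),
      m ∈ killedBy (functionMap K π 𝒜 L '' Set.range f) M ↔
        ∀ i, op (functionMap K π 𝒜 L (f i)) • m = 0 := fun M _ _ m =>
    ⟨fun h i => h _ ⟨_, ⟨i, rfl⟩, rfl⟩, by rintro h _ ⟨_, ⟨i, rfl⟩, rfl⟩; exact h i⟩
  refine exists_equivalence (centImage_central K π 𝒜 L (Set.range f))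
    (centInclusion_image K π 𝒜 L (Set.range f)) (finitelyGeneratedDp K π 𝒜 L (Set.range f))
    (fun N _ _ _ hN => ?_) (fun N _ _ hN => ?_) (fun M hM N _ _ j hj hinj hrange => ?_)
  · have hI := isInduced_unit (centInclusion K π 𝒜 L (Set.range f)) N
    have hfin := hI.finite
    refine ⟨hfin, Set.eq_univ_of_forall ?_⟩
    rintro m _ ⟨i, rfl⟩
    exact (tendsToZero_iff_nullSeq hπ0 hπ _).2
      (hg.nullSeq hπ0 hπ hcoord hI (fun i => hN _ ⟨_, ⟨i, rfl⟩, rfl⟩) i m)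
  · simp_rw [hkill]
    exact injective_and_range hπ0 hπ r f L _ hcoord g hg N _ _
      (isInduced_unit (centInclusion K π 𝒜 L (Set.range f)) N) fun i => hN _ ⟨_, ⟨i, rfl⟩, rfl⟩
  · simp_rw [hkill] at hrange
    have : Module.Finite (UHatK K π 𝒜 L)ᵐᵒᵖ M := hM.1
    refine finite_and_isInduced hπ0 hπ r f L _ hcoord g hg N M (fun i m => ?_) j hj hinj hrange
    exact (tendsToZero_iff_nullSeq hπ0 hπ _).1
      ((Set.eq_univ_iff_forall.1 hM.2 m) (f i) ⟨i, rfl⟩)
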